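/- There exist universal constants $C>0$ and $p\in\mathbb N$ such that the following holds. Let $\mathcal X$ be a measurable space (e.g. $\mathbb R^d$), let $n,m\ge 1$ and $k\ge 2$ be integers, let $\gamma>0$ and $\delta\in(0,1)$. Let $\mu$ be a probability measure on $\mathcal X\times\{1,\dots,k\}$ with marginal $\mu_{\mathcal X}$ on $\mathcal X$, and let $\nu_n$ be a data augmentation distribution, that is, a probability measure on $\mathcal X$ depending measurably on points $(x_1,\dots,x_n)\in\mathcal X^n$ (a Markov kernel). Let $\mathcal F,\mathcal G$ be sets of measurable predictors $\mathcal X\to\mathbb R^k$ that are pointwise measurable, meaning that each contains a countable subset such that every member of the set is the pointwise limit of a sequence from that subset. For $v\in\mathbb R^k$ let $$\mathcal M_\gamma(v)_j:=\ell_\gamma\Bigl(v_j-\max_{y'\ne j}v_{y'}\Bigr),\qquad \ell_\gamma(z):=\begin{cases}1,&z\le 0,\\ 1-z/\gamma,&0<z<\gamma,\\ 0,&z\ge\gamma.\end{cases}$$ For a set $\mathcal H$ of predictors and a sample $u_1,\dots,u_N\in\mathcal X$, let $$\mathrm{Rad}_N(\mathcal H):=\sup_{\bar y\in\{1,\dots,k\}^N}\mathbb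 E_{\varepsilon}\sup_{h\in\mathcal H}\frac1N\sum_{i=1}^N\varepsilon_i\,h(u_i)_{\bar y_i}\in[0,\infty],$$ where $\varepsilon_1,\dots,\varepsilon_N$ are iid uniform on $\{-1,+1\}$. Let $\bigl\|\frac{d\mu_{\mathcal X}}{d\nu_n}\bigr\|_\infty\in[0,\infty]$ be the $\nu_n$-essential supremum of the density, taken to be $\infty$ if $\mu_{\mathcal X}\not\ll\nu_n$. Draw $(x_i,y_i)_{i=1}^n$ iid from $\mu$ and then, conditionally on these, $(z_i)_{i=1}^m$ iid from $\nu_n=\nu_n(x_1,\dots,x_n)$. Then with probability at least $1-2\delta$ (that is, on a measurable event of at least this probability), every $f\in\mathcal F$ and $g\in\mathcal G$ satisfy $$\begin{aligned}\Pr_{(x,y)\sim\mu}\bigl[\operatorname*{arg\,max}_{y'}f(x)_{y'}\ne y\bigr]\le{}&\Bigl\|\frac{d\mu_{\mathcal X}}{d\nu_n}\Bigr\|_\infty\frac1m\sum_{i=1}^m\bigl\|\mathcal M_\gamma(f(z_i))-\mathcal M_\gamma(g(z_i))\bigr\|_1+\frac1n\sum_{i=1}^n\mathcal M_\gamma(g(x_i))_{y_i}\\&+C(1+\ln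 m)^p\,\frac{k^{3/2}}{\gamma}\Bigl\|\frac{d\mu_{\mathcal X}}{d\nu_n}\Bigr\|_\infty\bigl(\mathrm{Rad}_m(\mathcal F)+\mathrm{Rad}_m(\mathcal G)\bigr)+C(1+\ln n)^p\,\frac{\sqrt k}{\gamma}\,\mathrm{Rad}_n(\mathcal G)\\&+3\sqrt{\frac{\ln(1/\delta)}{2n}}\Bigl(1+\Bigl\|\frac{d\mu_{\mathcal X}}{d\nu_n}\Bigr\|_\infty\sqrt{\frac nm}\Bigr),\end{aligned}$$ where $\mathrm{Rad}_m$ is evaluated on $(z_i)_{i=1}^m$ and $\mathrm{Rad}_n$ on $(x_i)_{i=1}^n$, and where a tie for the maximum counts as an error. If the right-hand side is infinite, the inequality is vacuous. -/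

import Mathlib

open MeasureTheory ProbabilityTheory Filter Topology

/-- The ramp `ℓ_γ`: equal to `1` on `(-∞, 0]`, to `1 - z/γ` on `(0, γ)`, and to `0` on `[γ, ∞)`. -/
noncomputable def ramp (γ z : ℝ) : ℝ :=
  if z ≤ 0 then 1 else if z < γ then 1 - z / γ else 0

/-- The multiclass ramp loss `M_γ : ℝ^k → [0,1]^k`,
`M_γ(v)_j = ℓ_γ (v_j - max_{y' ≠ j} v_{y'})` (used for `k ≥ 2`). -/
noncomputable def rampLoss {k : ℕ} (γ : ℝ) (v : Fin k → ℝ) (j : Fin k) : ℝ :=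
  ramp γ (v j - ⨆ y' : {y' : Fin k // y' ≠ j}, v y')

/-- `ℓ¹` distance of the ramp outputs at the score vectors `v` and `w`. -/
noncomputable def rampDist {k : ℕ} (γ : ℝ) (v w : Fin k → ℝ) : ℝ :=
  ∑ j, |rampLoss γ v j - rampLoss γ w j|

/-- `argmax_{y'} v_{y'} ≠ y`, where a tie for the maximum counts as an error, so that this event
contains the error event of every tie-breaking rule. -/
def Misclassifies {k : ℕ} (v : Fin k → ℝ) (y : Fin k) : Prop :=
  ∃ j, j ≠ y ∧ v y ≤ v j

/-- Empirical Rademacher complexity `E_ε sup_{h ∈ H} (1/n) ∑ ε_i h(z_i)` of a class of univariate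
functions on the sample `z`, the signs being uniform on `{-1, 1}^n`. It is extended-real valued,
since the supremum may be infinite. -/
noncomputable def rademacher {Z : Type*} {n : ℕ} (H : Set (Z → ℝ)) (z : Fin n → Z) : EReal :=
  (((1 / 2 : ℝ) ^ n : ℝ) : EReal) *
    ∑ ε : Fin n → ℤˣ, ⨆ h ∈ H, (((1 / (n : ℝ)) * ∑ i, ((ε i : ℤ) : ℝ) * h (z i) : ℝ) : EReal)

/-- Rademacher complexity of a multiclass family on the sample `x`, via worst-case labels:
`sup_{y ∈ [k]^n} Rad({(x, y) ↦ f(x)_y : f ∈ F})`. -/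
noncomputable def rademacherMulti {X : Type*} {n k : ℕ} (F : Set (X → Fin k → ℝ))
    (x : Fin n → X) : EReal :=
  ⨆ y : Fin n → Fin k,
    rademacher ((fun (f : X → Fin k → ℝ) (p : X × Fin k) => f p.1 p.2) '' F)
      (fun i => (x i, y i))

open Classical in
/-- `‖dμ/dν‖_∞`, the `ν`-essential supremum of the density; infinite if there is no density. -/
noncomputable def densityRatioSup {X : Type*} [MeasurableSpace X] (μ ν : Measure X) : ENNReal :=
  if μ ≪ ν then essSup (μ.rnDeriv ν) ν else ⊤

/-- A family of measurable predictors with a countable subfamily whose pointwise sequential limits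
exhaust it (a pointwise measurable class). -/
def PointwiseMeasurable {X : Type*} [MeasurableSpace X] {k : ℕ}
    (F : Set (X → Fin k → ℝ)) : Prop :=
  (∀ f ∈ F, Measurable f) ∧
    ∃ F₀ ⊆ F, F₀.Countable ∧ ∀ f ∈ F, ∃ u : ℕ → X → Fin k → ℝ,
      (∀ j, u j ∈ F₀) ∧ ∀ x, Tendsto (fun j => u j x) atTop (𝓝 (f x))

/-- Given the labelled sample `s`, the law of `m` iid draws from the augmentation distribution
`ν (x_1, …, x_n)`. -/
noncomputable def augmentationKernel {X : Type*} [MeasurableSpace X] {n k : ℕ}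
    (ν : Kernel (Fin n → X) X) [IsMarkovKernel ν] (m : ℕ) :
    Kernel (Fin n → X × Fin k) (Fin m → X) where
  toFun s := Measure.pi fun _ => ν fun i => (s i).1
  measurable' := by
    have hs : Measurable fun s : Fin n → X × Fin k => fun i => (s i).1 := by fun_prop
    refine Measurable.measure_of_isPiSystem_of_isProbabilityMeasure
      generateFrom_pi.symm isPiSystem_pi ?_
    rintro _ ⟨t, ht, rfl⟩
    simp only [Measure.pi_pi]
    exact Finset.measurable_prod _ fun i _ =>
      (Kernel.measurable_coe ν (ht i (Set.mem_univ i))).comp hs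

instance augmentationKernel_isMarkovKernel {X : Type*} [MeasurableSpace X] {n k : ℕ}
    (ν : Kernel (Fin n → X) X) [IsMarkovKernel ν]
    (m : ℕ) : IsMarkovKernel (augmentationKernel (k := k) ν m) :=
  ⟨fun s => inferInstanceAs
    (IsProbabilityMeasure (Measure.pi fun _ : Fin m => ν fun i => (s i).1))⟩

/-- The joint law of the data: `(x_i, y_i)`, `i ≤ n`, iid from `μ`, and then `z_i`, `i ≤ m`, iid
from `ν (x_1, …, x_n)`. -/
noncomputable def sampleLaw {X : Type*} [MeasurableSpace X] {n k : ℕ} (μ : Measure (X × Fin k))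
    (ν : Kernel (Fin n → X) X) [IsMarkovKernel ν] (m : ℕ) :
    Measure ((Fin n → X × Fin k) × (Fin m → X)) :=
  (Measure.pi fun _ : Fin n => μ) ⊗ₘ augmentationKernel ν m

/-! A misclassified point has ramp loss exactly `1`, so the error of `f` is at most the expected
ramp loss of `g` plus the expected sup-norm distance between the two ramp outputs. That distance
depends on `x` alone, so its expectation under the marginal of `μ` is at most the density ratio
times its expectation under the augmentation distribution. Both expectations are then replaced by
empirical means through a uniform deviation bound. The distance is handled conditionally on the
labelled sample, given which the `z_i` are iid.

The deviation bound uses one concentration step. The functional (supremum of deviations) minus twice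
(empirical Rademacher complexity) has bounded differences `3/n` after normalization and nonpositive
mean by symmetrization; this yields `3√(ln(1/δ)/(2n))` with the empirical complexity already in
place.

It remains to bound two complexities by worst-label ones. The distance is Lipschitz in the `2k`
scores, and vector contraction costs a factor of order `k/γ`, within the allowed `k^{3/2}/γ`. The
ramp loss of `g` may cost only `√k/γ` up to logarithms. By scalar contraction this reduces to the
main estimate `radSum_max_le`: coordinatewise maxima of a `k`-vector-valued family have complexity
at most `√k` times a polylogarithm times the worst-label complexity `A`.

That estimate is chaining over dyadic `ℓ²` scales, with a Sudakov-type packing inequality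
(`packing_bound`): `2^L` maxima that are `r`-separated force `r√L ≲ √k A`, up to logarithms. For the
proof put `τ ≈ r/√(Lk)`. Two members either differ by at least `τ` at an argmax label in some row,
or have many small differences. In the second case rows are thrown at random, with random labels and
signs, into about `L` blocks, and some block sum differs by at least `τ`; products of cosines make
the failure probability exponentially small in `L`. Fixed thresholds on single scores and on block
sums therefore separate all members. A Sauer-type counting argument turns separation into a
shattered set of about `L` tests, up to logarithms, and shattering with gap of order `τ` gives
Rademacher complexity at least of order `Lτ`. Block sums inherit the complexity `A` on average,
because a random block sign times a random row sign is again a uniform sign.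

All of this is done for finite families. Countable dense sequences and dominated convergence
transfer it to pointwise measurable classes. -/

/-! ### Rademacher sums: contraction and lower bounds from sign patterns -/

/-- The unnormalized Rademacher complexity `E_ε sup_t ∑ ε_i a_{t,i}` of a finite family of vectors. -/
noncomputable def radSum {ι : Type*} {n : ℕ} (a : ι → Fin n → ℝ) : ℝ :=
  (1 / 2 : ℝ) ^ n * ∑ ε : Fin n → ℤˣ, ⨆ t, ∑ i, ((ε i : ℤ) : ℝ) * a t i

theorem sum_fin_succ_arrow {Ω : Type*} [Fintype Ω] {n : ℕ} (F : (Fin (n + 1) → Ω) → ℝ) :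
    ∑ ω, F ω = ∑ x : Ω, ∑ w : Fin n → Ω, F (Fin.cons x w) := by
  rw [← (Fin.consEquiv (fun _ : Fin (n + 1) => Ω)).sum_comp, Fintype.sum_prod_type]
  rfl

theorem sum_intUnits (F : ℤˣ → ℝ) : ∑ e, F e = F 1 + F (-1) := by
  rw [show (Finset.univ : Finset ℤˣ) = {1, -1} from rfl, Finset.sum_pair (by decide)]

theorem le_iSup_finite {ι : Type*} [Finite ι] (f : ι → ℝ) (t : ι) : f t ≤ ⨆ t, f t :=
  le_ciSup (Set.finite_range f).bddAbove t

/-- Row by row comparison of the expected suprema of two random sums. -/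
theorem sum_iSup_le_sum_iSup_of_step {ι Ω : Type*} [Fintype Ω] {n : ℕ}
    (f g : Fin n → Ω → ι → ℝ)
    (H : ∀ i (R : ι → ℝ), ∑ ω, ⨆ t, (R t + f i ω t) ≤ ∑ ω, ⨆ t, (R t + g i ω t)) (R : ι → ℝ) :
    ∑ ω : Fin n → Ω, ⨆ t, (R t + ∑ i, f i (ω i) t) ≤
      ∑ ω : Fin n → Ω, ⨆ t, (R t + ∑ i, g i (ω i) t) := by
  induction n generalizing R with
  | zero => simp
  | succ n ih =>
    rw [sum_fin_succ_arrow, sum_fin_succ_arrow]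
    simp only [Fin.sum_univ_succ, Fin.cons_zero, Fin.cons_succ]
    -- Hybrid argument: the tail is exchanged with row `0` absorbed into `R`, then row `0` is
    -- exchanged with the new tail absorbed into `R`.
    calc ∑ x, ∑ w : Fin n → Ω, ⨆ t, (R t + (f 0 x t + ∑ i, f i.succ (w i) t))
        ≤ ∑ x, ∑ w : Fin n → Ω, ⨆ t, (R t + (f 0 x t + ∑ i, g i.succ (w i) t)) := by
          refine Finset.sum_le_sum fun x _ => ?_
          simpa only [add_assoc] using
            ih (fun i => f i.succ) (fun i => g i.succ) (fun i => H i.succ) (fun t => R t + f 0 x t)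
      _ = ∑ w : Fin n → Ω, ∑ x, ⨆ t, ((R t + ∑ i, g i.succ (w i) t) + f 0 x t) := by
          rw [Finset.sum_comm]
          refine Finset.sum_congr rfl fun x _ => Finset.sum_congr rfl fun w _ => ?_
          congr 1; ext t; ring
      _ ≤ ∑ w : Fin n → Ω, ∑ x, ⨆ t, ((R t + ∑ i, g i.succ (w i) t) + g 0 x t) :=
          Finset.sum_le_sum fun w _ => H 0 _
      _ = _ := by
          rw [Finset.sum_comm]
          refine Finset.sum_congr rfl fun x _ => Finset.sum_congr rfl fun w _ => ?_
          congr 1; ext t; ring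

section
variable {ι : Type*} [Finite ι] [Nonempty ι]

/-- Take maximizers `t` and `t'` for the two signs. Their gain `a t - a t'` is split over the
labels, and for each `j` the pair is matched with the two signs in the order that makes `b t j - b
t' j` count positively. -/
theorem sum_iSup_step {κ : Type*} [Fintype κ] (a : ι → ℝ) (b : ι → κ → ℝ)
    (hab : ∀ t t', |a t - a t'| ≤ ∑ j, |b t j - b t' j|) (R : ι → ℝ) :
    ∑ ω : ℤˣ × κ, ⨆ t, (R t + ((ω.1 : ℤ) : ℝ) * a t) ≤
      ∑ ω : ℤˣ × κ, ⨆ t, (R t + ((ω.1 : ℤ) : ℝ) * (Fintype.card κ * b t ω.2)) := by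
  simp only [Fintype.sum_prod_type, sum_intUnits, Units.val_one, Int.cast_one, one_mul,
    Units.val_neg, Int.cast_neg, neg_mul, Finset.sum_const, Finset.card_univ, nsmul_eq_mul]
  rw [← Finset.sum_add_distrib]
  obtain ⟨t, ht⟩ := exists_eq_ciSup_of_finite (f := fun t => R t + a t)
  obtain ⟨t', ht'⟩ := exists_eq_ciSup_of_finite (f := fun t => R t + -a t)
  rw [← ht, ← ht']
  have h1 : a t - a t' ≤ ∑ j, |b t j - b t' j| := (le_abs_self _).trans (hab t t')
  calc (Fintype.card κ : ℝ) * (R t + a t) + Fintype.card κ * (R t' + -a t')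
      = Fintype.card κ * (R t + R t') + Fintype.card κ * (a t - a t') := by ring
    _ ≤ Fintype.card κ * (R t + R t') + Fintype.card κ * ∑ j, |b t j - b t' j| := by gcongr
    _ = ∑ j, (R t + R t' + Fintype.card κ * |b t j - b t' j|) := by
        rw [Finset.sum_add_distrib, Finset.mul_sum]; simp [mul_add]
    _ ≤ _ := by
        refine Finset.sum_le_sum fun j _ => ?_
        have e1 := fun t => le_iSup_finite (fun t => R t + Fintype.card κ * b t j) t
        have e2 := fun t => le_iSup_finite (fun t => R t + -(Fintype.card κ * b t j)) t
        rcases abs_cases (b t j - b t' j) with ⟨h, _⟩ | ⟨h, _⟩ <;> rw [h]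
        · linarith [e1 t, e2 t']
        · linarith [e1 t', e2 t]

/-- Vector contraction: if `a` is dominated coordinatewise by `κ` many features `b`, its Rademacher
complexity is at most `|κ|` times that of `b` with worst-case labels. -/
theorem radSum_le_card_mul {κ : Type*} [Fintype κ] [Nonempty κ] {n : ℕ} (a : ι → Fin n → ℝ)
    (b : ι → Fin n → κ → ℝ) (hab : ∀ t t' i, |a t i - a t' i| ≤ ∑ j, |b t i j - b t' i j|)
    {A : ℝ} (hA : ∀ y : Fin n → κ, radSum (fun t i => b t i (y i)) ≤ A) :
    radSum a ≤ Fintype.card κ * A := by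
  have hK : (0 : ℝ) < Fintype.card κ := by exact_mod_cast Fintype.card_pos
  -- Each row draws a sign and a label. A sum over labels is `|κ|` times an average, which is the
  -- source of the factor; the average over labels is then bounded by the worst labelling.
  have h := sum_iSup_le_sum_iSup_of_step (ι := ι) (Ω := ℤˣ × κ)
    (fun (i : Fin n) ω t => ((ω.1 : ℤ) : ℝ) * a t i)
    (fun i ω t => ((ω.1 : ℤ) : ℝ) * (Fintype.card κ * b t i ω.2))
    (fun i R => sum_iSup_step (fun t => a t i) (fun t j => b t i j) (fun t t' => hab t t' i) R)
    (fun _ => 0)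
  simp only [zero_add] at h
  rw [← (Equiv.arrowProdEquivProdArrow (Fin n) (fun _ => ℤˣ) (fun _ => κ)).symm.sum_comp,
    ← (Equiv.arrowProdEquivProdArrow (Fin n) (fun _ => ℤˣ) (fun _ => κ)).symm.sum_comp,
    Fintype.sum_prod_type_right, Fintype.sum_prod_type_right] at h
  simp only [Equiv.arrowProdEquivProdArrow_symm_apply, Finset.sum_const, Finset.card_univ,
    nsmul_eq_mul] at h
  have h2 : ∀ y : Fin n → κ, ∑ ε : Fin n → ℤˣ,
      ⨆ t, ∑ i, ((ε i : ℤ) : ℝ) * (Fintype.card κ * b t i (y i)) ≤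
        2 ^ n * (Fintype.card κ * A) := by
    intro y
    have := hA y
    rw [radSum, one_div, inv_pow, inv_mul_le_iff₀ (by positivity)] at this
    calc _ = ∑ ε : Fin n → ℤˣ, Fintype.card κ * ⨆ t, ∑ i, ((ε i : ℤ) : ℝ) * b t i (y i) := by
          refine Finset.sum_congr rfl fun ε _ => ?_
          rw [Real.mul_iSup_of_nonneg hK.le]
          congr 1; ext t; rw [Finset.mul_sum]
          exact Finset.sum_congr rfl fun i _ => by ring
      _ ≤ _ := by
          rw [← Finset.mul_sum]
          calc _ ≤ (Fintype.card κ : ℝ) * (2 ^ n * A) := by gcongr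
            _ = _ := by ring
  have h3 := h.trans (Finset.sum_le_sum fun y _ => h2 y)
  simp only [Finset.sum_const, Finset.card_univ, nsmul_eq_mul] at h3
  have hp : (0 : ℝ) < Fintype.card (Fin n → κ) := by exact_mod_cast Fintype.card_pos
  have h4 := le_of_mul_le_mul_left h3 hp
  rw [radSum, one_div, inv_pow, inv_mul_le_iff₀ (by positivity)]
  exact h4

/-- Scalar contraction. -/
theorem radSum_le_of_abs_sub_le {n : ℕ} (a b : ι → Fin n → ℝ)
    (hab : ∀ t t' i, |a t i - a t' i| ≤ |b t i - b t' i|) : radSum a ≤ radSum b := by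
  have := radSum_le_card_mul (κ := Unit) a (fun t i _ => b t i) (by simpa using hab)
    (A := radSum b) (fun y => le_rfl)
  simpa using this

theorem sum_mul_eq_zero_signs {n : ℕ} (c : Fin n → ℝ) :
    ∑ ε : Fin n → ℤˣ, ∑ i, ((ε i : ℤ) : ℝ) * c i = 0 := by
  have h := Equiv.sum_comp (Equiv.neg (Fin n → ℤˣ))
    (fun ε : Fin n → ℤˣ => ∑ i, ((ε i : ℤ) : ℝ) * c i)
  simp only [Equiv.neg_apply, Pi.neg_apply, Units.val_neg, Int.cast_neg, neg_mul,
    Finset.sum_neg_distrib] at h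
  linarith

theorem radSum_nonneg {n : ℕ} (a : ι → Fin n → ℝ) : 0 ≤ radSum a := by
  obtain ⟨t⟩ := ‹Nonempty ι›
  refine mul_nonneg (by positivity) ?_
  rw [← sum_mul_eq_zero_signs (a t)]
  exact Finset.sum_le_sum fun ε _ => le_iSup_finite (fun t => ∑ i, ((ε i : ℤ) : ℝ) * a t i) t

omit [Finite ι] [Nonempty ι] in
theorem radSum_neg {n : ℕ} (a : ι → Fin n → ℝ) : radSum (fun t i => -a t i) = radSum a := by
  unfold radSum
  congr 1
  rw [← Equiv.sum_comp (Equiv.neg (Fin n → ℤˣ))]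
  simp

omit [Finite ι] in
theorem radSum_le_of_forall_le {n : ℕ} (a : ι → Fin n → ℝ) {B : ℝ}
    (h : ∀ ε : Fin n → ℤˣ, ∀ t, ∑ i, ((ε i : ℤ) : ℝ) * a t i ≤ B) : radSum a ≤ B := by
  rw [radSum, one_div, inv_pow, inv_mul_le_iff₀ (by positivity)]
  calc _ ≤ ∑ ε : Fin n → ℤˣ, B := Finset.sum_le_sum fun ε _ => ciSup_le (h ε)
    _ = _ := by simp [Fintype.card_units_int]

-- Recentring by `c` is free, since signed sums of a fixed vector average to zero.
omit [Nonempty ι] in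
theorem le_radSum {n : ℕ} (a : ι → Fin n → ℝ) {B : ℝ}
    (c : Fin n → ℝ) (h : ∀ ε : Fin n → ℤˣ, ∃ t, B ≤ ∑ i, ((ε i : ℤ) : ℝ) * (a t i - c i)) :
    B ≤ radSum a := by
  rw [radSum, one_div, inv_pow, le_inv_mul_iff₀ (by positivity)]
  calc _ = ∑ ε : Fin n → ℤˣ, (B + ∑ i, ((ε i : ℤ) : ℝ) * c i) := by
        rw [Finset.sum_add_distrib, sum_mul_eq_zero_signs]; simp [Fintype.card_units_int]
    _ ≤ _ := Finset.sum_le_sum fun ε _ => by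
        obtain ⟨t, ht⟩ := h ε
        refine le_trans ?_ (le_iSup_finite (fun t => ∑ i, ((ε i : ℤ) : ℝ) * a t i) t)
        simp only [mul_sub, Finset.sum_sub_distrib] at ht
        linarith

theorem radSum_add_le {n : ℕ} (a b : ι → Fin n → ℝ) :
    radSum (fun t i => a t i + b t i) ≤ radSum a + radSum b := by
  unfold radSum
  rw [← mul_add, ← Finset.sum_add_distrib]
  gcongr with ε
  refine ciSup_le fun t => ?_
  simp only [mul_add, Finset.sum_add_distrib]
  exact add_le_add (le_iSup_finite (fun t => ∑ i, ((ε i : ℤ) : ℝ) * a t i) t)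
    (le_iSup_finite (fun t => ∑ i, ((ε i : ℤ) : ℝ) * b t i) t)

omit [Nonempty ι] in
theorem radSum_comp_le {ι' : Type*} [Nonempty ι'] {n : ℕ} (a : ι → Fin n → ℝ) (φ : ι' → ι) :
    radSum (fun t i => a (φ t) i) ≤ radSum a := by
  unfold radSum
  gcongr with ε
  exact ciSup_le fun t => le_iSup_finite (fun t => ∑ i, ((ε i : ℤ) : ℝ) * a t i) (φ t)

omit [Finite ι] [Nonempty ι] in
theorem radSum_const_mul {n : ℕ} (a : ι → Fin n → ℝ) {c : ℝ} (hc : 0 ≤ c) :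
    radSum (fun t i => c * a t i) = c * radSum a := by
  unfold radSum
  have : ∀ ε : Fin n → ℤˣ, ⨆ t, ∑ i, ((ε i : ℤ) : ℝ) * (c * a t i)
      = c * ⨆ t, ∑ i, ((ε i : ℤ) : ℝ) * a t i := by
    intro ε
    rw [Real.mul_iSup_of_nonneg hc]
    congr 1; ext t; rw [Finset.mul_sum]
    exact Finset.sum_congr rfl fun i _ => by ring
  simp only [this, ← Finset.mul_sum]
  ring

/-- A family that realizes every sign pattern on the rows in `S` with margin `g` has large
Rademacher complexity. -/
theorem card_mul_le_radSum {n : ℕ} (a : ι → Fin n → ℝ) (S : Finset (Fin n)) (θ : Fin n → ℝ) (g : ℝ)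
    (h : ∀ ε : Fin n → ℤˣ, ∃ t, ∀ i ∈ S,
      (ε i = 1 → θ i + g ≤ a t i) ∧ (ε i = -1 → a t i ≤ θ i)) :
    S.card * (g / 2) ≤ radSum a := by
  classical
  -- Zeroing the rows outside `S` is a contraction. On `S` the centre is the midpoint `θ + g/2`, so
  -- each row contributes at least `g/2` when the member follows the sign pattern.
  refine le_trans ?_ (radSum_le_of_abs_sub_le (fun t i => if i ∈ S then a t i else 0) a ?_)
  · refine le_radSum _ (fun i => if i ∈ S then θ i + g / 2 else 0) fun ε => ?_
    obtain ⟨t, ht⟩ := h ε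
    refine ⟨t, ?_⟩
    calc (S.card : ℝ) * (g / 2) = ∑ i, if i ∈ S then g / 2 else 0 := by
          rw [Finset.sum_ite_mem]; simp
      _ ≤ _ := Finset.sum_le_sum fun i _ => by
          by_cases hi : i ∈ S
          · simp only [hi, if_true]
            rcases Int.units_eq_one_or (ε i) with e | e
            · have := (ht i hi).1 e
              simp [e]; linarith
            · have := (ht i hi).2 e
              simp [e]; linarith
          · simp [hi]
  · intro t t' i
    by_cases hi : i ∈ S <;> simp [hi]

/-- Two members alone realize both signs on a single row. This converts a complexity bound into a
bound on the range of every coordinate. -/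
theorem abs_sub_le_two_mul_radSum {n : ℕ} (a : ι → Fin n → ℝ) (t t' : ι) (i : Fin n) :
    |a t i - a t' i| ≤ 2 * radSum a := by
  have key : ∀ t t', a t i - a t' i ≤ 2 * radSum a := fun t t' => by
    have := card_mul_le_radSum a {i} (fun i => a t' i) (a t i - a t' i) (fun ε => by
      rcases Int.units_eq_one_or (ε i) with e | e
      · exact ⟨t, by simp [e]⟩
      · exact ⟨t', by simp [e]⟩)
    simp only [Finset.card_singleton, Nat.cast_one, one_mul] at this
    linarith
  exact abs_sub_le_iff.2 ⟨key t t', key t' t⟩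

end

/-! ### Separated families shatter large sets of two-outcome tests -/

section
variable {α Q : Type*}

/-- The set `S` of tests is shattered by `T`: every prescribed pattern of outcomes on `S` is
attained by an element of `T`. -/
def TestShatters (up dn : α → Q → Prop) (T : Finset α) (S : Finset Q) : Prop :=
  ∀ P ⊆ S, ∃ t ∈ T, (∀ q ∈ P, up t q) ∧ ∀ q ∈ S, q ∉ P → dn t q

variable {up dn : α → Q → Prop}

theorem TestShatters.mono {T T' : Finset α} {S : Finset Q} (h : TestShatters up dn T S)
    (hT : T ⊆ T') : TestShatters up dn T' S := fun P hP => by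
  obtain ⟨t, ht, h⟩ := h P hP
  exact ⟨t, hT ht, h⟩

open Classical in
/-- A pairwise separated family has a test splitting it into two large parts. -/
theorem exists_splitting_test [Fintype Q] [Nonempty Q] (T : Finset α)
    (hsep : ∀ t ∈ T, ∀ t' ∈ T, t ≠ t' → ∃ q, (up t q ∧ dn t' q) ∨ (up t' q ∧ dn t q))
    {M : ℕ} (hM : 0 < M) (hT : 2 * Fintype.card Q * M ≤ T.card) :
    ∃ q, M ≤ (T.filter (up · q)).card ∧ M ≤ (T.filter (dn · q)).card := by
  by_contra! hcon
  have hW : 0 < Fintype.card Q := Fintype.card_pos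
  -- `R q` is the rare outcome of `q`. Deleting all rare outcomes leaves at least two elements of
  -- `T`, yet the test separating them puts one of the two in a rare outcome.
  set R : Q → Finset α := fun q =>
    if (T.filter (up · q)).card < M then T.filter (up · q) else T.filter (dn · q) with hR
  have hRc : ∀ q, (R q).card ≤ M - 1 := fun q => by
    simp only [hR]
    split_ifs with h
    · omega
    · have := hcon q (not_lt.1 h); omega
  have h1 : (Finset.univ.biUnion R).card ≤ Fintype.card Q * (M - 1) := by
    simpa using Finset.card_biUnion_le_card_mul Finset.univ R (M - 1) fun q _ => hRc q
  have h2 : 1 < (T \ Finset.univ.biUnion R).card := by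
    have := Finset.le_card_sdiff (Finset.univ.biUnion R) T
    obtain ⟨M, rfl⟩ : ∃ M', M = M' + 1 := ⟨M - 1, by omega⟩
    simp only [Nat.add_sub_cancel] at h1
    have : 2 * Fintype.card Q * (M + 1) =
      Fintype.card Q * M + Fintype.card Q * M + 2 * Fintype.card Q := by ring
    omega
  obtain ⟨t, ht, t', ht', hne⟩ := Finset.one_lt_card.1 h2
  simp only [Finset.mem_sdiff, Finset.mem_biUnion, Finset.mem_univ, true_and, not_exists] at ht ht'
  obtain ⟨q, hq⟩ := hsep t ht.1 t' ht'.1 hne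
  have a := ht.2 q
  have b := ht'.2 q
  simp only [hR] at a b
  split_ifs at a b with h
  · rcases hq with hq | hq
    · exact a (Finset.mem_filter.2 ⟨ht.1, hq.1⟩)
    · exact b (Finset.mem_filter.2 ⟨ht'.1, hq.1⟩)
  · rcases hq with hq | hq
    · exact b (Finset.mem_filter.2 ⟨ht'.1, hq.2⟩)
    · exact a (Finset.mem_filter.2 ⟨ht.1, hq.2⟩)

open Classical in
/-- A pairwise separated family shatters many sets of tests. -/
theorem two_pow_le_card_testShatters [Fintype Q] [Nonempty Q]
    (hdisj : ∀ t q, up t q → ¬ dn t q) (h : ℕ) (T : Finset α)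
    (hsep : ∀ t ∈ T, ∀ t' ∈ T, t ≠ t' → ∃ q, (up t q ∧ dn t' q) ∨ (up t' q ∧ dn t q))
    (hT : (2 * Fintype.card Q) ^ h ≤ T.card) :
    2 ^ h ≤ (Finset.univ.filter fun S : Finset Q => TestShatters up dn T S).card := by
  have hW : 0 < Fintype.card Q := Fintype.card_pos
  induction h generalizing T with
  | zero =>
    obtain ⟨t, ht⟩ : T.Nonempty := Finset.card_pos.1 (by simpa using hT)
    rw [pow_zero, Nat.one_le_iff_ne_zero, Finset.card_ne_zero]
    refine ⟨∅, Finset.mem_filter.2 ⟨Finset.mem_univ _, fun P hP => ⟨t, ht, ?_, by simp⟩⟩⟩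
    rw [Finset.subset_empty.1 hP]; simp
  | succ h ih =>
    obtain ⟨q, hq1, hq2⟩ := exists_splitting_test T hsep (M := (2 * Fintype.card Q) ^ h)
      (by positivity) (by rw [← pow_succ']; exact hT)
    set T1 := T.filter (up · q)
    set T2 := T.filter (dn · q)
    have hT1 : T1 ⊆ T := Finset.filter_subset _ _
    have hT2 : T2 ⊆ T := Finset.filter_subset _ _
    have i1 := ih T1 (fun t ht t' ht' => hsep t (hT1 ht) t' (hT1 ht')) hq1
    have i2 := ih T2 (fun t ht t' ht' => hsep t (hT2 ht) t' (hT2 ht')) hq2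
    set A := Finset.univ.filter fun S : Finset Q => TestShatters up dn T1 S
    set B := Finset.univ.filter fun S : Finset Q => TestShatters up dn T2 S
    -- All of `T1` answers `up` at `q`, so no set shattered by `T1` contains `q`; symmetrically for
    -- `T2`.
    have hA : ∀ S ∈ A, q ∉ S := fun S hS hqS => by
      obtain ⟨t, ht, -, h⟩ := (Finset.mem_filter.1 hS).2 ∅ (by simp)
      exact hdisj t q (Finset.mem_filter.1 ht).2 (h q hqS (by simp))
    have hB : ∀ S ∈ B, q ∉ S := fun S hS hqS => by
      obtain ⟨t, ht, h, -⟩ := (Finset.mem_filter.1 hS).2 S subset_rfl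
      exact hdisj t q (h q hqS) (Finset.mem_filter.1 ht).2
    -- A set shattered by both halves can be enlarged by `q`. Hence `T` shatters at least `|A ∪ B| +
    -- |A ∩ B| = |A| + |B|` sets, and the count doubles.
    have hsub : (A ∪ B) ∪ (A ∩ B).image (insert q) ⊆
        Finset.univ.filter fun S : Finset Q => TestShatters up dn T S := by
      intro S hS
      refine Finset.mem_filter.2 ⟨Finset.mem_univ _, ?_⟩
      rcases Finset.mem_union.1 hS with hS | hS
      · rcases Finset.mem_union.1 hS with hS | hS
        · exact (Finset.mem_filter.1 hS).2.mono hT1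
        · exact (Finset.mem_filter.1 hS).2.mono hT2
      · obtain ⟨S, hS', rfl⟩ := Finset.mem_image.1 hS
        obtain ⟨hSA, hSB⟩ := Finset.mem_inter.1 hS'
        intro P hP
        by_cases hqP : q ∈ P
        · obtain ⟨t, ht, h1, h2⟩ := (Finset.mem_filter.1 hSA).2 (P.erase q) (by
            intro x hx
            rcases Finset.mem_insert.1 (hP (Finset.mem_of_mem_erase hx)) with rfl | h
            · simp at hx
            · exact h)
          refine ⟨t, hT1 ht, fun x hx => ?_, fun x hx hxP => ?_⟩
          · rcases eq_or_ne x q with rfl | hne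
            · exact (Finset.mem_filter.1 ht).2
            · exact h1 x (Finset.mem_erase.2 ⟨hne, hx⟩)
          · rcases Finset.mem_insert.1 hx with rfl | hx
            · exact absurd hqP hxP
            · exact h2 x hx fun h => hxP (Finset.mem_of_mem_erase h)
        · obtain ⟨t, ht, h1, h2⟩ := (Finset.mem_filter.1 hSB).2 P (by
            intro x hx
            rcases Finset.mem_insert.1 (hP hx) with rfl | h
            · exact absurd hx hqP
            · exact h)
          refine ⟨t, hT2 ht, h1, fun x hx hxP => ?_⟩
          rcases Finset.mem_insert.1 hx with rfl | hx
          · exact (Finset.mem_filter.1 ht).2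
          · exact h2 x hx hxP
    have hdj : Disjoint (A ∪ B) ((A ∩ B).image (insert q)) := by
      rw [Finset.disjoint_right]
      intro S hS hS'
      obtain ⟨S, -, rfl⟩ := Finset.mem_image.1 hS
      rcases Finset.mem_union.1 hS' with h | h
      · exact hA _ h (Finset.mem_insert_self _ _)
      · exact hB _ h (Finset.mem_insert_self _ _)
    have hinj : ((A ∩ B).image (insert q)).card = (A ∩ B).card := by
      refine Finset.card_image_of_injOn fun S hS S' hS' hSS => ?_
      have e1 := hA S (Finset.mem_inter.1 hS).1
      have e2 := hA S' (Finset.mem_inter.1 hS').1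
      rw [← Finset.erase_insert e1, ← Finset.erase_insert e2, hSS]
    have := Finset.card_le_card hsub
    rw [Finset.card_union_of_disjoint hdj, hinj, Finset.card_union_add_card_inter] at this
    rw [pow_succ]; omega

theorem card_filter_card_le [Fintype Q] (d : ℕ) :
    (Finset.univ.filter fun S : Finset Q => S.card ≤ d).card ≤ (1 + Fintype.card Q) ^ d := by
  classical
  calc _ ≤ ((Finset.range (d + 1)).biUnion
        fun i => Finset.powersetCard i (Finset.univ : Finset Q)).card := by
        refine Finset.card_le_card fun S hS => ?_
        simp only [Finset.mem_filter, Finset.mem_univ, true_and] at hS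
        simp only [Finset.mem_biUnion, Finset.mem_range, Finset.mem_powersetCard,
          Finset.subset_univ, true_and]
        exact ⟨S.card, by omega, rfl⟩
    _ ≤ ∑ i ∈ Finset.range (d + 1), (Fintype.card Q).choose i := by
        refine Finset.card_biUnion_le.trans (le_of_eq ?_)
        simp [Finset.card_powersetCard]
    _ ≤ ∑ i ∈ Finset.range (d + 1), Fintype.card Q ^ i * d.choose i := by
        refine Finset.sum_le_sum fun i hi => ?_
        calc (Fintype.card Q).choose i ≤ Fintype.card Q ^ i := Nat.choose_le_pow _ _
          _ ≤ _ := Nat.le_mul_of_pos_right _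
            (Nat.choose_pos (by simpa [Nat.lt_succ_iff] using hi))
    _ = _ := by
        rw [add_comm 1, add_pow]; simp

/-- A large pairwise separated family shatters a large set of tests. -/
theorem exists_testShatters_card_ge [Fintype Q]
    (hdisj : ∀ t q, up t q → ¬ dn t q) (T : Finset α)
    (hsep : ∀ t ∈ T, ∀ t' ∈ T, t ≠ t' → ∃ q, (up t q ∧ dn t' q) ∨ (up t' q ∧ dn t q))
    {Λ L : ℕ} (hΛ : 2 * Fintype.card Q ≤ 2 ^ Λ) (hL : 1 ≤ L) (hT : 2 ^ L ≤ T.card) :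
    ∃ S, TestShatters up dn T S ∧ L ≤ 2 * Λ ^ 2 * S.card := by
  classical
  obtain ⟨t, ht, t', ht', hne⟩ := Finset.one_lt_card.1
    (lt_of_lt_of_le (Nat.one_lt_two_pow (by omega)) hT)
  obtain ⟨q₀, hq₀⟩ := hsep t ht t' ht' hne
  have : Nonempty Q := ⟨q₀⟩
  have hW : 0 < Fintype.card Q := Fintype.card_pos
  have hΛ0 : 1 ≤ Λ := by
    rcases Nat.eq_zero_or_pos Λ with rfl | h
    · simp at hΛ; omega
    · exact h
  have hlt := Nat.lt_mul_div_succ L hΛ0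
  -- If `L < Λ`, a single separating test is enough. Otherwise `2^(L/Λ)` sets are shattered, whereas
  -- there are at most `2^(Λd)` sets of size at most `d`.
  rcases Nat.eq_zero_or_pos (L / Λ) with h0 | hpos
  · refine ⟨{q₀}, fun P hP => ?_, ?_⟩
    · rcases Finset.subset_singleton_iff.1 hP with rfl | rfl
      · rcases hq₀ with h | h
        · exact ⟨t', ht', by simpa using h.2⟩
        · exact ⟨t, ht, by simpa using h.2⟩
      · rcases hq₀ with h | h
        · exact ⟨t, ht, by simpa using h.1⟩
        · exact ⟨t', ht', by simpa using h.1⟩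
    · rw [h0] at hlt
      simp only [Finset.card_singleton]
      nlinarith
  · by_contra! hcon
    have h1 := two_pow_le_card_testShatters hdisj (L / Λ) T hsep (by
      calc _ ≤ (2 ^ Λ) ^ (L / Λ) := Nat.pow_le_pow_left hΛ _
        _ = 2 ^ (Λ * (L / Λ)) := by rw [pow_mul]
        _ ≤ 2 ^ L := Nat.pow_le_pow_right (by norm_num) (Nat.mul_div_le _ _)
        _ ≤ _ := hT)
    set d := (L - 1) / (2 * Λ ^ 2) with hd
    have h2 : (Finset.univ.filter fun S : Finset Q => TestShatters up dn T S).card ≤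
        (1 + Fintype.card Q) ^ d := by
      refine le_trans (Finset.card_le_card fun S hS => ?_) (card_filter_card_le d)
      simp only [Finset.mem_filter, Finset.mem_univ, true_and] at hS ⊢
      have := hcon S hS
      rw [hd, Nat.le_div_iff_mul_le (by positivity), mul_comm]
      omega
    have h3 : 2 ^ (L / Λ) ≤ 2 ^ (Λ * d) := by
      calc _ ≤ _ := h1.trans h2
        _ ≤ (2 ^ Λ) ^ d := Nat.pow_le_pow_left (by omega) _
        _ = _ := by rw [pow_mul]
    have h4 : L / Λ ≤ Λ * d := (Nat.pow_le_pow_iff_right (by norm_num)).1 h3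
    have h5 : 2 * Λ ^ 2 * d ≤ L - 1 := Nat.mul_div_le _ _
    have h6 : Λ * (L / Λ) ≤ Λ * (Λ * d) := Nat.mul_le_mul_left _ h4
    have h7 : Λ * 1 ≤ Λ * (L / Λ) := Nat.mul_le_mul_left _ hpos
    have h8 : Λ * (Λ * d) = Λ ^ 2 * d := by ring
    have h9 : Λ * (L / Λ + 1) = Λ * (L / Λ) + Λ := by ring
    have h10 : 2 * Λ ^ 2 * d = 2 * (Λ ^ 2 * d) := by ring
    omega

end

/-! ### Anticoncentration of random signed block sums -/

section
variable {M n : ℕ} {κ : Type*} [Fintype κ]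

/-- The signed sum over the rows of block `b`, for a random assignment `ω` of a block, a label and
a sign to each row. -/
noncomputable def blockSum (x : Fin n → κ → ℝ) (ω : Fin n → Fin M × κ × ℤˣ) (b : Fin M) : ℝ :=
  ∑ i, if (ω i).1 = b then (((ω i).2.2 : ℤ) : ℝ) * x i (ω i).2.1 else 0

omit [Fintype κ] in
theorem blockSum_sub (x x' : Fin n → κ → ℝ) (ω : Fin n → Fin M × κ × ℤˣ) (b : Fin M) :
    blockSum (fun i j => x i j - x' i j) ω b = blockSum x ω b - blockSum x' ω b := by
  unfold blockSum
  rw [← Finset.sum_sub_distrib]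
  refine Finset.sum_congr rfl fun i _ => ?_
  split_ifs <;> ring

omit [Fintype κ] in
theorem blockSum_div (x : Fin n → κ → ℝ) (c : ℝ) (ω : Fin n → Fin M × κ × ℤˣ) (b : Fin M) :
    blockSum (fun i j => x i j / c) ω b = blockSum x ω b / c := by
  unfold blockSum
  rw [Finset.sum_div]
  refine Finset.sum_congr rfl fun i _ => ?_
  split_ifs <;> ring

/-- One row enters one block only, and averaging over its sign removes the sine term: `cos (p + x) +
cos (p - x) = 2 cos p cos x`. The phases `p` carry the other rows, so that the step can be iterated.
-/
theorem sum_prod_cos_step (S : Finset (Fin M)) (p : Fin M → ℝ) (x : κ → ℝ) :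
    ∑ w : Fin M × κ × ℤˣ,
      ∏ b ∈ S, Real.cos (p b + if w.1 = b then ((w.2.2 : ℤ) : ℝ) * x w.2.1 else 0) =
    (∏ b ∈ S, Real.cos (p b)) *
      ∑ w : Fin M × κ × ℤˣ, if w.1 ∈ S then Real.cos (x w.2.1) else 1 := by
  classical
  rw [Fintype.sum_prod_type, Fintype.sum_prod_type, Finset.mul_sum]
  refine Finset.sum_congr rfl fun c _ => ?_
  rw [Fintype.sum_prod_type, Fintype.sum_prod_type, Finset.mul_sum]
  refine Finset.sum_congr rfl fun j _ => ?_
  simp only [sum_intUnits]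
  by_cases hc : c ∈ S
  · simp only [hc, if_true]
    rw [← Finset.mul_prod_erase S _ hc, ← Finset.mul_prod_erase S _ hc,
      ← Finset.mul_prod_erase S _ hc]
    have : ∀ e : ℝ, ∏ b ∈ S.erase c, Real.cos (p b + if c = b then e else 0) =
        ∏ b ∈ S.erase c, Real.cos (p b) := fun e =>
      Finset.prod_congr rfl fun b hb => by
        rw [if_neg (Finset.ne_of_mem_erase hb).symm, add_zero]
    rw [this, this]
    simp [Real.cos_add]
    ring
  · simp only [hc, if_false]
    have : ∀ e : ℝ, ∏ b ∈ S, Real.cos (p b + if c = b then e else 0) =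
        ∏ b ∈ S, Real.cos (p b) := fun e =>
      Finset.prod_congr rfl fun b hb => by
        rw [if_neg (by rintro rfl; exact hc hb), add_zero]
    rw [this, this]; ring

theorem sum_prod_cos_blockSum (S : Finset (Fin M)) (p : Fin M → ℝ) (x : Fin n → κ → ℝ) :
    ∑ ω : Fin n → Fin M × κ × ℤˣ, ∏ b ∈ S, Real.cos (p b + blockSum x ω b) =
    (∏ b ∈ S, Real.cos (p b)) *
      ∏ i, ∑ w : Fin M × κ × ℤˣ, if w.1 ∈ S then Real.cos (x i w.2.1) else 1 := by
  induction n generalizing p with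
  | zero => simp [blockSum]
  | succ n ih =>
    rw [sum_fin_succ_arrow]
    have : ∀ (w : Fin M × κ × ℤˣ) (ω : Fin n → Fin M × κ × ℤˣ) (b : Fin M),
        p b + blockSum x (Fin.cons w ω : Fin (n + 1) → Fin M × κ × ℤˣ) b =
        (p b + if w.1 = b then ((w.2.2 : ℤ) : ℝ) * x 0 w.2.1 else 0) +
          blockSum (fun i => x i.succ) ω b := by
      intro w ω b
      simp only [blockSum, Fin.sum_univ_succ, Fin.cons_zero, Fin.cons_succ]
      ring
    simp only [this, ih, ← Finset.sum_mul]
    rw [sum_prod_cos_step, Fin.prod_univ_succ, mul_assoc]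

theorem cos_le_one_sub_sq_div_five {θ : ℝ} (h : |θ| ≤ 1) : Real.cos θ ≤ 1 - θ ^ 2 / 5 := by
  have h1 := Real.cos_le_one_sub_mul_cos_sq (x := θ) (h.trans (by linarith [Real.pi_gt_three]))
  have h2 : 1 / 5 ≤ 2 / Real.pi ^ 2 := by
    rw [div_le_div_iff₀ (by norm_num) (by positivity)]
    nlinarith [Real.pi_lt_d2, Real.pi_gt_three]
  nlinarith [sq_nonneg θ]

/-- A row falls into a block of `S` with label `j` with probability `|S|/(2m|κ|)`, and then its
cosine loses at least `x_j²/5`. Having twice as many blocks as `|S|` can reach keeps the average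
cosine nonnegative, as required for multiplying the upper bounds over rows. -/
theorem sum_cos_factor_bounds [Nonempty κ] {m : ℕ} (hM : M = 2 * m) (hm : 0 < m)
    (S : Finset (Fin M))
    (hS : S.card ≤ m) (x : κ → ℝ) (j : κ) (hj : |x j| ≤ 1) :
    0 ≤ (∑ w : Fin M × κ × ℤˣ, if w.1 ∈ S then Real.cos (x w.2.1) else 1) ∧
    (∑ w : Fin M × κ × ℤˣ, if w.1 ∈ S then Real.cos (x w.2.1) else 1) ≤
      Fintype.card (Fin M × κ × ℤˣ) *
        Real.exp (-(S.card / (10 * m * Fintype.card κ) * x j ^ 2)) := by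
  classical
  have hk : (0 : ℝ) < Fintype.card κ := by exact_mod_cast Fintype.card_pos
  have hmR : (0 : ℝ) < m := by exact_mod_cast hm
  have hSR : (S.card : ℝ) ≤ m := by exact_mod_cast hS
  have e1 : (∑ w : Fin M × κ × ℤˣ, if w.1 ∈ S then Real.cos (x w.2.1) else 1) =
      2 * (2 * m * Fintype.card κ - S.card * ∑ j, (1 - Real.cos (x j))) := by
    have : ∀ w : Fin M × κ × ℤˣ, (if w.1 ∈ S then Real.cos (x w.2.1) else 1) =
        1 - if w.1 ∈ S then (1 - Real.cos (x w.2.1)) else 0 := fun w => by split_ifs <;> ring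
    simp only [this, Finset.sum_sub_distrib]
    simp only [Fintype.sum_prod_type, Finset.sum_const, Finset.card_univ, Fintype.card_units_int,
      nsmul_eq_mul, mul_one, Finset.sum_ite_irrel]
    simp [hM, ← Finset.mul_sum]
    ring
  have hsum1 : ∑ j, (1 - Real.cos (x j)) ≤ Fintype.card κ * 2 := by
    rw [← Finset.card_univ, ← nsmul_eq_mul]
    exact Finset.sum_le_card_nsmul _ _ _ fun j _ => by linarith [Real.neg_one_le_cos (x j)]
  have hnn : ∀ j, 0 ≤ 1 - Real.cos (x j) := fun j => by linarith [Real.cos_le_one (x j)]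
  have hsum2 : x j ^ 2 / 5 ≤ ∑ j, (1 - Real.cos (x j)) := by
    refine le_trans ?_ (Finset.single_le_sum (fun j _ => hnn j) (Finset.mem_univ j))
    linarith [cos_le_one_sub_sq_div_five hj]
  have hs0 : (0 : ℝ) ≤ S.card := by positivity
  have hsum0 : 0 ≤ ∑ j, (1 - Real.cos (x j)) := Finset.sum_nonneg fun j _ => hnn j
  rw [e1]
  constructor
  · nlinarith [mul_le_mul hSR hsum1 hsum0 hmR.le]
  · have h3 := Real.add_one_le_exp (-(S.card / (10 * m * Fintype.card κ) * x j ^ 2))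
    have h4 : (Fintype.card (Fin M × κ × ℤˣ) : ℝ) = 4 * m * Fintype.card κ := by
      simp [hM, Fintype.card_units_int]; ring
    rw [h4]
    calc _ ≤ 2 * (2 * m * Fintype.card κ - S.card * (x j ^ 2 / 5)) := by gcongr
      _ = 4 * m * Fintype.card κ * (-(S.card / (10 * m * Fintype.card κ) * x j ^ 2) + 1) := by
          field_simp
          ring
      _ ≤ _ := by gcongr

open Classical in
/-- If the rows of `x` carry enough mass, then for most assignments `ω` some block sum over the
first half of the blocks is not small. -/
theorem card_blockSum_small_le [Nonempty κ] {m : ℕ} (hM : M = 2 * m) (hm : 0 < m)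
    (I : Finset (Fin M)) (hI : I.card = m) (x : Fin n → κ → ℝ) (j : Fin n → κ)
    (hj : ∀ i, |x i (j i)| ≤ 1) (hx : 30 * m * Fintype.card κ ≤ ∑ i, x i (j i) ^ 2) :
    ((Finset.univ.filter fun ω : Fin n → Fin M × κ × ℤˣ =>
      ∀ b ∈ I, |blockSum x ω b| < 1).card : ℝ) ≤
      (3 / 4) ^ m * Fintype.card (Fin n → Fin M × κ × ℤˣ) := by
  have hk : (0 : ℝ) < Fintype.card κ := by exact_mod_cast Fintype.card_pos
  have hmR : (0 : ℝ) < m := by exact_mod_cast hm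
  set N : ℝ := (Fintype.card (Fin n → Fin M × κ × ℤˣ) : ℝ) with hN
  have hN' : N = ∏ _i : Fin n, (Fintype.card (Fin M × κ × ℤˣ) : ℝ) := by
    rw [hN, Fintype.card_fun]; simp
  -- The mass hypothesis makes the total exponent at most `-3|S|`, and `e^{-3} ≤ 1/8`.
  have step : ∀ S ⊆ I, ∑ ω : Fin n → Fin M × κ × ℤˣ, ∏ b ∈ S, Real.cos (blockSum x ω b) ≤
      N * (1 / 8) ^ S.card := by
    intro S hS
    have h := sum_prod_cos_blockSum S (fun _ => 0) x
    simp only [zero_add, Real.cos_zero, Finset.prod_const_one, one_mul] at h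
    have hb := fun i => sum_cos_factor_bounds hM hm S (hI ▸ Finset.card_le_card hS) (x i) (j i)
      (hj i)
    rw [h]
    refine (Finset.prod_le_prod (fun i _ => (hb i).1) fun i _ => (hb i).2).trans ?_
    rw [Finset.prod_mul_distrib, ← hN', ← Real.exp_sum]
    have hN0 : 0 ≤ N := by positivity
    refine mul_le_mul_of_nonneg_left ?_ hN0
    have e3 : Real.exp (-3) ≤ 1 / 8 := by
      rw [Real.exp_neg, one_div]
      refine inv_anti₀ (by norm_num) ?_
      have h1 : (2 : ℝ) ≤ Real.exp 1 := by linarith [Real.add_one_le_exp (1 : ℝ)]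
      calc (8 : ℝ) = 2 ^ 3 := by norm_num
        _ ≤ Real.exp 1 ^ 3 := by gcongr
        _ = Real.exp 3 := by rw [← Real.exp_nat_mul]; norm_num
    calc _ ≤ Real.exp (S.card * (-3)) := by
          rw [Real.exp_le_exp, Finset.sum_neg_distrib, ← Finset.mul_sum, mul_neg, neg_le_neg_iff]
          rw [div_mul_eq_mul_div, le_div_iff₀ (by positivity)]
          have : (0 : ℝ) ≤ S.card := by positivity
          nlinarith [mul_le_mul_of_nonneg_left hx this]
      _ = Real.exp (-3) ^ S.card := by rw [Real.exp_nat_mul]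
      _ ≤ _ := by gcongr
  -- For `|s| < 1` one has `1 + cos s ≥ 3/2`, so the product dominates the indicator. Expanding it
  -- over subsets gives `(2/3)^m (1 + 1/8)^m = (3/4)^m`.
  have hind : ∀ ω : Fin n → Fin M × κ × ℤˣ,
      (if ∀ b ∈ I, |blockSum x ω b| < 1 then (1 : ℝ) else 0) ≤
        (2 / 3) ^ m * ∏ b ∈ I, (1 + Real.cos (blockSum x ω b)) := by
    intro ω
    have hp : 0 ≤ ∏ b ∈ I, (1 + Real.cos (blockSum x ω b)) :=
      Finset.prod_nonneg fun b _ => by linarith [Real.neg_one_le_cos (blockSum x ω b)]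
    split_ifs with h
    · have : ((3 : ℝ) / 2) ^ m ≤ ∏ b ∈ I, (1 + Real.cos (blockSum x ω b)) := by
        rw [← hI, ← Finset.prod_const]
        refine Finset.prod_le_prod (fun _ _ => by norm_num) fun b hb => ?_
        have h1 := Real.one_sub_sq_div_two_le_cos (x := blockSum x ω b)
        have h2 := (sq_lt_one_iff_abs_lt_one _).2 (h b hb)
        linarith
      calc (1 : ℝ) = (2 / 3) ^ m * (3 / 2) ^ m := by rw [← mul_pow]; norm_num
        _ ≤ _ := by gcongr
    · positivity
  calc ((Finset.univ.filter fun ω : Fin n → Fin M × κ × ℤˣ =>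
      ∀ b ∈ I, |blockSum x ω b| < 1).card : ℝ)
      = ∑ ω : Fin n → Fin M × κ × ℤˣ, if ∀ b ∈ I, |blockSum x ω b| < 1 then (1 : ℝ) else 0 := by
        simp
    _ ≤ ∑ ω : Fin n → Fin M × κ × ℤˣ, (2 / 3) ^ m * ∏ b ∈ I, (1 + Real.cos (blockSum x ω b)) :=
        Finset.sum_le_sum fun ω _ => hind ω
    _ = (2 / 3) ^ m * ∑ S ∈ I.powerset,
          ∑ ω : Fin n → Fin M × κ × ℤˣ, ∏ b ∈ S, Real.cos (blockSum x ω b) := by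
        rw [← Finset.mul_sum, Finset.sum_comm]
        simp only [Finset.prod_one_add]
    _ ≤ (2 / 3) ^ m * ∑ S ∈ I.powerset, N * (1 / 8) ^ S.card := by
        gcongr with S hS
        exact step S (Finset.mem_powerset.1 hS)
    _ = (3 / 4) ^ m * N := by
        have : ∑ S ∈ I.powerset, ((1 : ℝ) / 8) ^ S.card = (9 / 8) ^ m := by
          have h := Finset.prod_one_add (f := fun _ : Fin M => (1 / 8 : ℝ)) I
          simp only [Finset.prod_const, hI] at h
          rw [← h]; norm_num
        rw [← Finset.mul_sum, this, mul_left_comm, ← mul_pow]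
        norm_num [mul_comm]

end

/-! ### From shattered threshold tests to the packing bound -/

section
variable {α Q Q' : Type*} {up dn : α → Q → Prop}

theorem TestShatters.comap {T : Finset α} {S : Finset Q} (h : TestShatters up dn T S)
    {f : Q' → Q} (hf : Function.Injective f) {S' : Finset Q'} (hS : ∀ q ∈ S', f q ∈ S) :
    TestShatters (fun t q => up t (f q)) (fun t q => dn t (f q)) T S' := by
  classical
  intro P hP
  obtain ⟨t, ht, h1, h2⟩ := h (P.image f) (by
    intro x hx
    obtain ⟨q, hq, rfl⟩ := Finset.mem_image.1 hx
    exact hS q (hP hq))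
  refine ⟨t, ht, fun q hq => h1 _ (Finset.mem_image_of_mem f hq), fun q hq hqP => h2 _ (hS q hq) ?_⟩
  rintro hq'
  obtain ⟨q', hq', e⟩ := Finset.mem_image.1 hq'
  exact hqP (hf e ▸ hq')

/-- Shattered threshold tests on distinct rows give a lower bound on the Rademacher complexity. -/
theorem TestShatters.card_mul_le_radSum [Finite α] [Nonempty α] {T : Finset α} {S : Finset Q}
    (h : TestShatters up dn T S) {N : ℕ} (a : α → Fin N → ℝ) (row : Q → Fin N)
    (hrow : ∀ q ∈ S, ∀ q' ∈ S, row q = row q' → q = q') (θ : Q → ℝ) (g : ℝ)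
    (hup : ∀ t, ∀ q ∈ S, up t q → θ q + g ≤ a t (row q))
    (hdn : ∀ t, ∀ q ∈ S, dn t q → a t (row q) ≤ θ q) :
    S.card * (g / 2) ≤ radSum a := by
  classical
  rw [← Finset.card_image_of_injOn (f := row) (s := S) fun q hq q' hq' e => hrow q hq q' hq' e]
  refine _root_.card_mul_le_radSum a (S.image row)
    (fun i => if hi : ∃ q ∈ S, row q = i then θ hi.choose else 0) g fun ε => ?_
  obtain ⟨t, -, h1, h2⟩ := h (S.filter fun q => ε (row q) = 1) (Finset.filter_subset _ _)
  refine ⟨t, fun i hi => ?_⟩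
  have hi' : ∃ q ∈ S, row q = i := by simpa using hi
  obtain ⟨hq, hqi⟩ := hi'.choose_spec
  simp only [hi', dif_pos]
  set q := hi'.choose
  constructor
  · intro e
    have := hup t q hq (h1 q (Finset.mem_filter.2 ⟨hq, by rw [hqi, e]⟩))
    rwa [hqi] at this
  · intro e
    have := hdn t q hq (h2 q hq fun h => by
      have := (Finset.mem_filter.1 h).2
      rw [hqi, e] at this
      exact absurd this (by decide))
    rwa [hqi] at this

end

/-- A gap of length `τ` contains a full cell of a grid of mesh `τ/2`. The range `4 * A` needs at
most `8 * A / τ` grid points. -/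
theorem exists_grid_threshold {base w w' τ A : ℝ} {V : ℕ} (hτ : 0 < τ) (h1 : base ≤ w')
    (h2 : w' + τ ≤ w) (h3 : w ≤ base + 4 * A) (hV : 8 * A / τ ≤ V) :
    ∃ q : Fin V, base + ((q : ℕ) + 1) * (τ / 2) ≤ w ∧ w' ≤ base + (q : ℕ) * (τ / 2) := by
  have h4 : (⌈(w' - base) / (τ / 2)⌉₊ : ℝ) < (w' - base) / (τ / 2) + 1 :=
    Nat.ceil_lt_add_one (div_nonneg (by linarith) (by linarith))
  have h5 := Nat.le_ceil ((w' - base) / (τ / 2))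
  rw [div_le_iff₀ (by positivity)] at h5
  have h6 : (⌈(w' - base) / (τ / 2)⌉₊ - 1 : ℝ) * (τ / 2) < w' - base := by
    rwa [← lt_div_iff₀ (by positivity), sub_lt_iff_lt_add]
  have h7 : ⌈(w' - base) / (τ / 2)⌉₊ < V := by
    rw [div_le_iff₀ hτ] at hV
    have : (⌈(w' - base) / (τ / 2)⌉₊ : ℝ) < V := by
      by_contra! hcon
      nlinarith
    exact_mod_cast this
  exact ⟨⟨_, h7⟩, by simp only []; nlinarith, by simp only []; linarith⟩

section
variable {ι : Type*} [Finite ι] [Nonempty ι]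

-- For fixed block signs `ε`, the product of a row's sign with the sign of its block is again
-- uniform. The sum over blocks thus becomes an ordinary Rademacher sum with random labels.
omit [Finite ι] [Nonempty ι] in
theorem sum_radSum_blockSum_le {κ : Type*} [Fintype κ] {n M : ℕ} (v : ι → Fin n → κ → ℝ) {A : ℝ}
    (hA : ∀ y : Fin n → κ, radSum (fun t i => v t i (y i)) ≤ A) :
    ∑ ω : Fin n → Fin M × κ × ℤˣ, radSum (fun t b => blockSum (v t) ω b) ≤
      Fintype.card (Fin n → Fin M × κ × ℤˣ) * A := by
  simp only [radSum]
  rw [← Finset.mul_sum, Finset.sum_comm, one_div, inv_pow, inv_mul_le_iff₀ (by positivity)]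
  have e1 : ∀ (ε : Fin M → ℤˣ) (ω : Fin n → Fin M × κ × ℤˣ) (t : ι),
      ∑ b, ((ε b : ℤ) : ℝ) * blockSum (v t) ω b =
        ∑ i, (((ε (ω i).1 * (ω i).2.2 : ℤˣ) : ℤ) : ℝ) * v t i (ω i).2.1 := by
    intro ε ω t
    simp only [blockSum, Finset.mul_sum]
    rw [Finset.sum_comm]
    refine Finset.sum_congr rfl fun i _ => ?_
    rw [Finset.sum_eq_single (ω i).1]
    · simp [mul_assoc]
    · intro b _ hb
      simp [hb.symm]
    · simp
  have e2 : ∀ ε : Fin M → ℤˣ, ∑ ω : Fin n → Fin M × κ × ℤˣ,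
      ⨆ t, ∑ b, ((ε b : ℤ) : ℝ) * blockSum (v t) ω b ≤
        Fintype.card (Fin n → Fin M × κ × ℤˣ) * A := by
    intro ε
    simp only [e1]
    have hinv : Function.Involutive fun (ω : Fin n → Fin M × κ × ℤˣ) i =>
        ((ω i).1, (ω i).2.1, ε (ω i).1 * (ω i).2.2) := by
      intro ω; ext i <;> simp [← mul_assoc]
    rw [← Equiv.sum_comp hinv.toPerm]
    simp only [Function.Involutive.coe_toPerm, ← mul_assoc, Int.units_mul_self, one_mul]
    rw [← Equiv.sum_comp
      (Equiv.arrowProdEquivProdArrow (Fin n) (fun _ => Fin M) (fun _ => κ × ℤˣ)).symm,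
      Fintype.sum_prod_type]
    have h1 : ∀ β : Fin n → Fin M, ∑ ω : Fin n → κ × ℤˣ,
        ⨆ t, ∑ i, (((ω i).2 : ℤ) : ℝ) * v t i (ω i).1 ≤ Fintype.card (Fin n → κ × ℤˣ) * A := by
      intro β
      rw [← Equiv.sum_comp
        (Equiv.arrowProdEquivProdArrow (Fin n) (fun _ => κ) (fun _ => ℤˣ)).symm,
        Fintype.sum_prod_type]
      calc _ ≤ ∑ y : Fin n → κ, 2 ^ n * A := by
            refine Finset.sum_le_sum fun y _ => ?_
            have := hA y
            rwa [radSum, one_div, inv_pow, inv_mul_le_iff₀ (by positivity)] at this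
        _ = _ := by
            simp [Fintype.card_units_int, mul_pow]; ring
    calc _ ≤ ∑ β : Fin n → Fin M, (Fintype.card (Fin n → κ × ℤˣ) : ℝ) * A :=
          Finset.sum_le_sum fun β _ => h1 β
      _ = _ := by simp [Fintype.card_units_int, mul_pow]; ring
  calc _ ≤ ∑ ε : Fin M → ℤˣ, (Fintype.card (Fin n → Fin M × κ × ℤˣ) : ℝ) * A :=
        Finset.sum_le_sum fun ε _ => e2 ε
    _ = _ := by simp [Fintype.card_units_int]

open Classical in
/-- Packings of a family of coordinatewise maxima are small. -/
theorem packing_bound {n k L Λ V : ℕ} (hk : 0 < k) (v : ι → Fin n → Fin k → ℝ)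
    (col : ι → Fin n → Fin k)
    (hcol : ∀ t t' i, v t' i (col t i) ≤ v t' i (col t' i)) {A : ℝ} (hA0 : 0 < A)
    (hA : ∀ y : Fin n → Fin k, radSum (fun t i => v t i (y i)) ≤ A)
    (T : Finset ι) (hL : 1 ≤ L) (hT : 2 ^ L ≤ T.card) {r τ : ℝ} (hτ : 0 < τ)
    (hsep : ∀ t ∈ T, ∀ t' ∈ T, t ≠ t' →
      r ^ 2 ≤ ∑ i, (v t i (col t i) - v t' i (col t' i)) ^ 2)
    (hr : 240 * L * k * τ ^ 2 ≤ r ^ 2) (hV : 8 * A / τ ≤ V)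
    (hΛ : 2 * (n * (k * V) + 16 * L * V) ≤ 2 ^ Λ) :
    L * τ ≤ 32 * Λ ^ 2 * A := by
  obtain ⟨T, hTT, hTc⟩ := Finset.exists_subset_card_eq hT
  replace hsep := fun t ht t' ht' => hsep t (hTT ht) t' (hTT ht')
  clear hTT hT
  have : Nonempty (Fin k) := ⟨⟨0, hk⟩⟩
  -- With `8L` blocks in `I`, the union bound over at most `4^L` pairs costs `(4 (3/4)^8)^L ≤ 0.41`,
  -- less than one half.
  set m := 8 * L with hm
  set M := 2 * m with hM
  have hm0 : 0 < m := by omega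
  have : Nonempty (Fin M) := ⟨⟨0, by omega⟩⟩
  set I : Finset (Fin M) := Finset.univ.filter fun b => (b : ℕ) < m with hI
  have hIc : I.card = m := by
    rw [hI, Fin.card_filter_val_lt]; omega
  -- the label used to compare `t` and `t'` in row `i`
  set lab : ι → ι → Fin n → Fin k := fun t t' i =>
    if v t' i (col t' i) ≤ v t i (col t i) then col t i else col t' i with hlab
  have hlab1 : ∀ t t' i, (v t i (col t i) - v t' i (col t' i)) ^ 2 ≤
      (v t i (lab t t' i) - v t' i (lab t t' i)) ^ 2 := by
    intro t t' i
    simp only [hlab]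
    split_ifs with h
    · have := hcol t t' i
      apply sq_le_sq'  <;> linarith
    · have := hcol t' t i
      rw [← neg_sq (v t i _ - _), ← neg_sq (v t i (col t' i) - _)]
      apply sq_le_sq' <;> linarith
  set bad : ι × ι → Finset (Fin n → Fin M × Fin k × ℤˣ) := fun p =>
    Finset.univ.filter fun ω => ∀ b ∈ I,
      |blockSum (fun i j => (v p.1 i j - v p.2 i j) / τ) ω b| < 1 with hbad
  set pairs := T.offDiag.filter fun p => ∀ i, |v p.1 i (lab p.1 p.2 i) - v p.2 i (lab p.1 p.2 i)| < τ
    with hpairs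
  set N : ℝ := (Fintype.card (Fin n → Fin M × Fin k × ℤˣ) : ℝ) with hN
  have hN0 : 0 < N := by rw [hN]; exact_mod_cast Fintype.card_pos
  have hbadc : ∀ p ∈ pairs, ((bad p).card : ℝ) ≤ (3 / 4) ^ m * N := by
    intro p hp
    obtain ⟨hp1, hp2⟩ := Finset.mem_filter.1 hp
    obtain ⟨h1, h2, h3⟩ := Finset.mem_offDiag.1 hp1
    refine card_blockSum_small_le hM hm0 I hIc _ (lab p.1 p.2) (fun i => ?_) ?_
    · rw [abs_div, abs_of_pos hτ, div_le_one hτ]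
      exact (hp2 i).le
    · have h4 := (hr.trans (hsep _ h1 _ h2 h3)).trans
        (Finset.sum_le_sum fun i _ => hlab1 p.1 p.2 i)
      simp only [div_pow]
      rw [← Finset.sum_div, le_div_iff₀ (by positivity)]
      refine le_trans (le_of_eq ?_) h4
      rw [hm]; push_cast; rw [Fintype.card_fin]; ring
  -- By Markov, at least half of the assignments have block complexity at most `2 * A`; at most a
  -- fraction `0.41` is bad for some pair. So some assignment is good in both respects.
  obtain ⟨ω, hω1, hω2⟩ : ∃ ω : Fin n → Fin M × Fin k × ℤˣ,
      radSum (fun t b => blockSum (v t) ω b) ≤ 2 * A ∧ ∀ p ∈ pairs, ω ∉ bad p := by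
    by_contra! hcon
    set G := Finset.univ.filter fun ω : Fin n → Fin M × Fin k × ℤˣ =>
      radSum (fun t b => blockSum (v t) ω b) ≤ 2 * A with hG
    have hG1 : (G.card : ℝ) ≤ 0.41 * N := by
      have h1 : G ⊆ pairs.biUnion bad := fun ω hω => by
        obtain ⟨p, hp, h⟩ := hcon ω (Finset.mem_filter.1 hω).2
        exact Finset.mem_biUnion.2 ⟨p, hp, h⟩
      have h2 : (G.card : ℝ) ≤ ∑ p ∈ pairs, ((bad p).card : ℝ) := by
        exact_mod_cast (Finset.card_le_card h1).trans Finset.card_biUnion_le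
      have h3 : (pairs.card : ℝ) ≤ 4 ^ L := by
        have : pairs.card ≤ 4 ^ L := by
          calc pairs.card ≤ T.offDiag.card := Finset.card_filter_le _ _
            _ ≤ T.card * T.card := by rw [Finset.offDiag_card]; omega
            _ = 4 ^ L := by rw [hTc, ← mul_pow]; norm_num
        exact_mod_cast this
      calc (G.card : ℝ) ≤ ∑ p ∈ pairs, (3 / 4 : ℝ) ^ m * N := h2.trans (Finset.sum_le_sum hbadc)
        _ = pairs.card * ((3 / 4) ^ m * N) := by simp
        _ ≤ 4 ^ L * ((3 / 4) ^ m * N) := by gcongr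
        _ = (4 * (3 / 4) ^ 8) ^ L * N := by rw [hm, mul_pow, pow_mul]; ring
        _ ≤ 0.41 ^ L * N := by gcongr; norm_num
        _ ≤ 0.41 * N := by
            gcongr
            exact pow_le_of_le_one (by norm_num) (by norm_num) (by omega)
    have hG2 : (N - G.card) * (2 * A) ≤ N * A := by
      refine le_trans ?_ (sum_radSum_blockSum_le (M := M) v hA)
      have h1 : (N - G.card) = (Gᶜ).card := by
        rw [Finset.card_compl, Nat.cast_sub (Finset.card_le_univ _)]
      rw [h1, ← nsmul_eq_mul]
      refine (Finset.card_nsmul_le_sum Gᶜ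
        (fun ω => radSum (fun t b => blockSum (v t) ω b)) (2 * A) fun ω hω => ?_).trans ?_
      · have : ¬ _ := fun h => Finset.mem_compl.1 hω (Finset.mem_filter.2 ⟨Finset.mem_univ _, h⟩)
        exact (not_le.1 this).le
      · exact Finset.sum_le_sum_of_subset_of_nonneg (Finset.subset_univ _)
          fun ω _ _ => radSum_nonneg _
    nlinarith [mul_pos hN0 hA0]
  set u : ι → Fin M → ℝ := fun t b => blockSum (v t) ω b with hu
  -- A positive answer on a single score also demands that the label be the argmax. This is what
  -- later forces a shattered set to use one label per row; negative answers need no such condition.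
  set up : ι → (Fin n × Fin k × Fin V) ⊕ (Fin M × Fin V) → Prop := fun t => Sum.elim
    (fun q => col t q.1 = q.2.1 ∧
      (⨅ t, v t q.1 q.2.1) + ((q.2.2 : ℕ) + 1) * (τ / 2) ≤ v t q.1 q.2.1)
    (fun q => (⨅ t, u t q.1) + ((q.2 : ℕ) + 1) * (τ / 2) ≤ u t q.1) with hup
  set dn : ι → (Fin n × Fin k × Fin V) ⊕ (Fin M × Fin V) → Prop := fun t => Sum.elim
    (fun q => v t q.1 q.2.1 ≤ (⨅ t, v t q.1 q.2.1) + (q.2.2 : ℕ) * (τ / 2))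
    (fun q => u t q.1 ≤ (⨅ t, u t q.1) + (q.2 : ℕ) * (τ / 2)) with hdn
  have hinf : ∀ (f : ι → ℝ) t, (⨅ t, f t) ≤ f t := fun f t =>
    ciInf_le (Set.finite_range f).bddBelow t
  have hinf' : ∀ f : ι → ℝ, (∀ t t', |f t - f t'| ≤ 4 * A) →
      ∀ t, f t ≤ (⨅ t, f t) + 4 * A := fun f hf t => by
    obtain ⟨t', ht'⟩ := exists_eq_ciInf_of_finite (f := f)
    rw [← ht']
    linarith [(abs_le.1 (hf t t')).2]
  have hvr : ∀ i j t, v t i j ≤ (⨅ t, v t i j) + 4 * A := fun i j =>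
    hinf' (fun t => v t i j) fun t t' => by
      have := abs_sub_le_two_mul_radSum (fun t i => v t i ((fun _ => j) i)) t t' i
      have := hA (fun _ => j)
      linarith
  have hur : ∀ b t, u t b ≤ (⨅ t, u t b) + 4 * A := fun b =>
    hinf' (fun t => u t b) fun t t' => by
      have := abs_sub_le_two_mul_radSum u t t' b
      linarith
  have hdisj : ∀ t q, up t q → ¬ dn t q := by
    rintro t (q | q) h1 h2
    · have h1 := h1.2
      simp only [hdn, Sum.elim_inl] at h2
      linarith
    · simp only [hdn, hup, Sum.elim_inr] at h1 h2
      linarith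
  have hsep' : ∀ t ∈ T, ∀ t' ∈ T, t ≠ t' → ∃ q, (up t q ∧ dn t' q) ∨ (up t' q ∧ dn t q) := by
    intro t ht t' ht' hne
    -- Pairs with all differences below `τ` are separated by a block sum; the others by a score at
    -- the argmax label of the larger maximum.
    by_cases hp : (t, t') ∈ pairs
    · have := hω2 _ hp
      simp only [hbad, Finset.mem_filter, Finset.mem_univ, true_and, not_forall, not_lt] at this
      obtain ⟨b, -, hb⟩ := this
      rw [blockSum_div, blockSum_sub (v t) (v t'), abs_div, abs_of_pos hτ, one_le_div hτ,
        le_abs] at hb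
      rcases hb with hb | hb
      · obtain ⟨q, hq1, hq2⟩ := exists_grid_threshold (base := ⨅ t, u t b) (w := u t b)
          (w' := u t' b) hτ (hinf _ t') (by simp only [hu]; linarith) (hur b t) hV
        exact ⟨Sum.inr (b, q), Or.inl ⟨hq1, hq2⟩⟩
      · obtain ⟨q, hq1, hq2⟩ := exists_grid_threshold (base := ⨅ t, u t b) (w := u t' b)
          (w' := u t b) hτ (hinf _ t) (by simp only [hu]; linarith) (hur b t') hV
        exact ⟨Sum.inr (b, q), Or.inr ⟨hq1, hq2⟩⟩
    · simp only [hpairs, Finset.mem_filter, Finset.mem_offDiag, ht, ht', hne, not_forall,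
        not_lt, ne_eq, not_false_eq_true, true_and, and_self] at hp
      obtain ⟨i, hi⟩ := hp
      simp only [hlab] at hi
      split_ifs at hi with h
      · rw [abs_of_nonneg (by linarith [hcol t t' i])] at hi
        obtain ⟨q, hq1, hq2⟩ := exists_grid_threshold (base := ⨅ s, v s i (col t i))
          (w := v t i (col t i)) (w' := v t' i (col t i)) hτ
          (hinf (fun s => v s i (col t i)) t') (by linarith) (hvr i _ t) hV
        exact ⟨Sum.inl (i, col t i, q), Or.inl ⟨⟨rfl, hq1⟩, hq2⟩⟩
      · rw [abs_of_nonpos (by linarith [hcol t' t i])] at hi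
        obtain ⟨q, hq1, hq2⟩ := exists_grid_threshold (base := ⨅ s, v s i (col t' i))
          (w := v t' i (col t' i)) (w' := v t i (col t' i)) hτ
          (hinf (fun s => v s i (col t' i)) t) (by linarith) (hvr i _ t') hV
        exact ⟨Sum.inl (i, col t' i, q), Or.inr ⟨⟨rfl, hq1⟩, hq2⟩⟩
  obtain ⟨S, hS, hSL⟩ := exists_testShatters_card_ge hdisj T hsep' (Λ := Λ) (L := L) (by
    refine le_trans (le_of_eq ?_) hΛ
    simp only [Fintype.card_sum, Fintype.card_prod, Fintype.card_fin, hM, hm]; ring) hL hTc.ge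
  have hcard := Finset.card_toLeft_add_card_toRight (u := S)
  have hS1 : TestShatters _ _ T S.toLeft :=
    hS.comap (f := Sum.inl) Sum.inl_injective (S' := S.toLeft) (by simp)
  have hS2 : TestShatters _ _ T S.toRight :=
    hS.comap (f := Sum.inr) Sum.inr_injective (S' := S.toRight) (by simp)
  have hnat : ∀ (base w : ℝ) (q q' : ℕ), base + (q + 1) * (τ / 2) ≤ w → w ≤ base + q' * (τ / 2) →
      q < q' := by
    intro base w q q' h1 h2
    by_contra! hcon
    have : (q' : ℝ) ≤ q := by exact_mod_cast hcon
    nlinarith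
  have hb1 : S.toLeft.card * (τ / 2 / 2) ≤ A := by
    -- The all-positive pattern forces equal labels in a row. Two levels for one score cannot be
    -- shattered, since each of the two mixed patterns would put one level strictly below the other.
    have hinj : ∀ q ∈ S.toLeft, ∀ q' ∈ S.toLeft, q.1 = q'.1 → q = q' := by
      rintro ⟨i, j, q⟩ hq ⟨i', j', q'⟩ hq' (rfl : i = i')
      by_contra hne
      obtain ⟨t, -, h1, -⟩ := hS1 S.toLeft subset_rfl
      obtain rfl : j = j' := (h1 _ hq).1.symm.trans (h1 _ hq').1
      obtain ⟨t1, -, h2, h3⟩ := hS1 {(i, j, q)} (by simpa using hq)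
      obtain ⟨t2, -, h4, h5⟩ := hS1 {(i, j, q')} (by simpa using hq')
      have l1 := hnat _ _ _ _ (h2 (i, j, q) (by simp)).2
        (h3 (i, j, q') hq' (by simpa using Ne.symm hne))
      have l2 := hnat _ _ _ _ (h4 (i, j, q') (by simp)).2 (h5 (i, j, q) hq (by simpa using hne))
      simp only at l1 l2
      omega
    set y : Fin n → Fin k := fun i => if hi : ∃ q ∈ S.toLeft, q.1 = i then hi.choose.2.1 else ⟨0, hk⟩
      with hy
    have hyq : ∀ q ∈ S.toLeft, y q.1 = q.2.1 := by
      intro q hq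
      have hi : ∃ q' ∈ S.toLeft, q'.1 = q.1 := ⟨q, hq, rfl⟩
      simp only [hy, hi, dif_pos]
      rw [hinj _ hi.choose_spec.1 q hq hi.choose_spec.2]
    refine le_trans ?_ (hA y)
    refine hS1.card_mul_le_radSum _ (fun q => q.1) hinj
      (fun q => (⨅ t, v t q.1 q.2.1) + (q.2.2 : ℕ) * (τ / 2)) (τ / 2) ?_ ?_
    · intro t q hq h
      simp only [hyq q hq]
      have := h.2
      linarith
    · intro t q hq h
      simp only [hyq q hq]
      exact h
  have hb2 : S.toRight.card * (τ / 2 / 2) ≤ 2 * A := by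
    have hinj : ∀ q ∈ S.toRight, ∀ q' ∈ S.toRight, q.1 = q'.1 → q = q' := by
      rintro ⟨i, q⟩ hq ⟨i', q'⟩ hq' (rfl : i = i')
      by_contra hne
      obtain ⟨t1, -, h2, h3⟩ := hS2 {(i, q)} (by simpa using hq)
      obtain ⟨t2, -, h4, h5⟩ := hS2 {(i, q')} (by simpa using hq')
      have l1 := hnat _ _ _ _ (h2 (i, q) (by simp))
        (h3 (i, q') hq' (by simpa using Ne.symm hne))
      have l2 := hnat _ _ _ _ (h4 (i, q') (by simp)) (h5 (i, q) hq (by simpa using hne))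
      simp only at l1 l2
      omega
    refine le_trans ?_ hω1
    refine hS2.card_mul_le_radSum _ (fun q => q.1) hinj
      (fun q => (⨅ t, u t q.1) + (q.2 : ℕ) * (τ / 2)) (τ / 2) ?_ ?_
    · intro t q hq h
      simp only [hup, Sum.elim_inr] at h
      linarith
    · intro t q hq h
      exact h
  have hSL' : (L : ℝ) ≤ 2 * Λ ^ 2 * S.card := by exact_mod_cast hSL
  have hc' : (S.card : ℝ) = S.toLeft.card + S.toRight.card := by exact_mod_cast hcard.symm
  have hfin : S.card * τ ≤ 16 * A := by rw [hc']; linarith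
  calc L * τ ≤ 2 * Λ ^ 2 * S.card * τ := by gcongr
    _ = 2 * Λ ^ 2 * (S.card * τ) := by ring
    _ ≤ 2 * Λ ^ 2 * (16 * A) := by gcongr
    _ = _ := by ring

end

/-! ### Massart's lemma, chaining, and the `√k` bound for maxima -/

theorem sum_exp_signs_le {n : ℕ} (w : Fin n → ℝ) (c : ℝ) :
    ∑ ε : Fin n → ℤˣ, Real.exp (c * ∑ i, ((ε i : ℤ) : ℝ) * w i) ≤
      2 ^ n * Real.exp (c ^ 2 * (∑ i, w i ^ 2) / 2) := by
  have h1 : ∀ ε : Fin n → ℤˣ, Real.exp (c * ∑ i, ((ε i : ℤ) : ℝ) * w i) =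
      ∏ i, Real.exp (c * (((ε i : ℤ) : ℝ) * w i)) := fun ε => by
    rw [Finset.mul_sum, Real.exp_sum]
  simp only [h1]
  rw [← Fintype.piFinset_univ,
    Finset.sum_prod_piFinset Finset.univ fun (i : Fin n) (e : ℤˣ) =>
      Real.exp (c * (((e : ℤ) : ℝ) * w i))]
  have h2 : ∀ i, ∑ e : ℤˣ, Real.exp (c * (((e : ℤ) : ℝ) * w i)) ≤
      2 * Real.exp (c ^ 2 * w i ^ 2 / 2) := by
    intro i
    rw [sum_intUnits]
    have := Real.cosh_le_exp_half_sq (c * w i)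
    rw [Real.cosh_eq, div_le_iff₀ (by norm_num)] at this
    simp only [Units.val_one, Int.cast_one, one_mul, Units.val_neg, Int.cast_neg, neg_mul, mul_neg]
    rw [mul_pow] at this
    linarith
  calc _ ≤ ∏ i : Fin n, (2 * Real.exp (c ^ 2 * w i ^ 2 / 2)) :=
        Finset.prod_le_prod (fun i _ => Finset.sum_nonneg fun e _ => (Real.exp_pos _).le)
          fun i _ => h2 i
    _ = _ := by
        rw [Finset.prod_mul_distrib, ← Real.exp_sum, Finset.mul_sum, Finset.sum_div]
        simp

/-- Massart's finite class lemma. -/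
theorem radSum_le_of_card_le {κ : Type*} [Fintype κ] [Nonempty κ] {n L : ℕ} (w : κ → Fin n → ℝ)
    {R : ℝ} (hR : 0 < R) (hw : ∀ t, ∑ i, w t i ^ 2 ≤ R ^ 2) (hL : 1 ≤ L)
    (hκ : Fintype.card κ ≤ 2 ^ (2 * L)) : radSum w ≤ 2 * R * √L := by
  have hL0 : (0 : ℝ) < √L := Real.sqrt_pos.2 (by exact_mod_cast hL)
  have hLs : √(L : ℝ) ^ 2 = L := Real.sq_sqrt (by positivity)
  set c : ℝ := 2 * √L / R with hc
  have hc0 : 0 < c := by positivity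
  have hcR : c ^ 2 * R ^ 2 / 2 = 2 * L := by
    rw [hc, div_pow, mul_pow, hLs]; field_simp
  -- The tangent inequality `y ≤ e^{y - 4L} + 4L - 1` plays the role of Jensen's inequality for the
  -- logarithm.
  have hpt : ∀ ε : Fin n → ℤˣ, c * ⨆ t, ∑ i, ((ε i : ℤ) : ℝ) * w t i ≤
      4 * L - 1 + Real.exp (-(4 * L)) * ∑ t, Real.exp (c * ∑ i, ((ε i : ℤ) : ℝ) * w t i) := by
    intro ε
    obtain ⟨t, ht⟩ := exists_eq_ciSup_of_finite (f := fun t => ∑ i, ((ε i : ℤ) : ℝ) * w t i)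
    rw [← ht]
    have h1 := Real.add_one_le_exp (c * (∑ i, ((ε i : ℤ) : ℝ) * w t i) - 4 * L)
    have h2 := Finset.single_le_sum (f := fun t => Real.exp (c * ∑ i, ((ε i : ℤ) : ℝ) * w t i))
      (fun t _ => (Real.exp_pos _).le) (Finset.mem_univ t)
    have h3 := mul_le_mul_of_nonneg_left h2 (Real.exp_pos (-(4 * L : ℝ))).le
    rw [sub_eq_neg_add, Real.exp_add] at h1
    linarith
  have hsum := Finset.sum_le_sum fun ε (_ : ε ∈ Finset.univ) => hpt ε
  rw [← Finset.mul_sum, Finset.sum_add_distrib, ← Finset.mul_sum, Finset.sum_comm] at hsum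
  have h4 : ∑ t, ∑ ε : Fin n → ℤˣ, Real.exp (c * ∑ i, ((ε i : ℤ) : ℝ) * w t i) ≤
      2 ^ n * Real.exp (4 * L) := by
    calc _ ≤ ∑ _t : κ, 2 ^ n * Real.exp (2 * L) := by
          refine Finset.sum_le_sum fun t _ => (sum_exp_signs_le (w t) c).trans ?_
          gcongr
          rw [← hcR]
          have := hw t
          gcongr
      _ = 2 ^ n * (Fintype.card κ * Real.exp (2 * L)) := by simp; ring
      _ ≤ 2 ^ n * (Real.exp (2 * L) * Real.exp (2 * L)) := by
          gcongr
          calc (Fintype.card κ : ℝ) ≤ 2 ^ (2 * L) := by exact_mod_cast hκ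
            _ ≤ Real.exp 1 ^ (2 * L) := by
              gcongr; linarith [Real.add_one_le_exp (1 : ℝ)]
            _ = Real.exp (2 * L) := by rw [← Real.exp_nat_mul]; simp
      _ = _ := by rw [← Real.exp_add]; ring_nf
  have h5 : Real.exp (-(4 * L : ℝ)) *
      ∑ t, ∑ ε : Fin n → ℤˣ, Real.exp (c * ∑ i, ((ε i : ℤ) : ℝ) * w t i) ≤ 2 ^ n := by
    calc _ ≤ Real.exp (-(4 * L : ℝ)) * (2 ^ n * Real.exp (4 * L)) := by gcongr
      _ = _ := by rw [mul_left_comm, ← Real.exp_add]; simp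
  have h6 : c * ∑ ε : Fin n → ℤˣ, ⨆ t, ∑ i, ((ε i : ℤ) : ℝ) * w t i ≤ 2 ^ n * (4 * L) := by
    have : ∑ _ε : Fin n → ℤˣ, (4 * (L : ℝ) - 1) = 2 ^ n * (4 * L) - 2 ^ n := by
      simp [Fintype.card_units_int]
    linarith
  rw [radSum, one_div, inv_pow, inv_mul_le_iff₀ (by positivity)]
  rw [← le_div_iff₀' hc0] at h6
  refine h6.trans (le_of_eq ?_)
  rw [hc, mul_div_assoc]
  congr 1
  rw [div_div_eq_mul_div, div_eq_iff (by positivity)]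
  linear_combination (-4 * R) * hLs

section
variable {ι : Type*} [Finite ι] [Nonempty ι] {n : ℕ}

/-- A maximal separated subset is a net. -/
theorem exists_separated_net (x : ι → Fin n → ℝ) {r : ℝ} :
    ∃ N : Finset ι, N.Nonempty ∧
      (∀ t ∈ N, ∀ t' ∈ N, t ≠ t' → r ^ 2 ≤ ∑ i, (x t i - x t' i) ^ 2) ∧
      ∀ t, ∃ t' ∈ N, ∑ i, (x t i - x t' i) ^ 2 ≤ r ^ 2 := by
  classical
  have := Fintype.ofFinite ι
  set P := (Finset.univ : Finset (Finset ι)).filter fun N =>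
    ∀ t ∈ N, ∀ t' ∈ N, t ≠ t' → r ^ 2 ≤ ∑ i, (x t i - x t' i) ^ 2 with hP
  obtain ⟨N, hN, hmax⟩ := P.exists_max_image Finset.card ⟨∅, by simp [hP]⟩
  have hcov : ∀ t, ∃ t' ∈ N, ∑ i, (x t i - x t' i) ^ 2 ≤ r ^ 2 := by
    intro t
    by_contra! hcon
    have htN : t ∉ N := fun h => by
      have := hcon t h
      simp only [sub_self] at this
      norm_num at this
      nlinarith [sq_nonneg r]
    have := hmax (insert t N) (by
      simp only [hP, Finset.mem_filter, Finset.mem_univ, true_and] at hN ⊢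
      intro s hs s' hs' hne
      rcases Finset.mem_insert.1 hs with rfl | h <;> rcases Finset.mem_insert.1 hs' with rfl | h'
      · exact absurd rfl hne
      · exact (hcon s' h').le
      · refine (hcon s h).le.trans (le_of_eq ?_)
        exact Finset.sum_congr rfl fun i _ => by ring
      · exact hN s h s' h' hne)
    rw [Finset.card_insert_of_notMem htN] at this
    omega
  refine ⟨N, ?_, (Finset.mem_filter.1 hN).2, hcov⟩
  obtain ⟨t⟩ := ‹Nonempty ι›
  obtain ⟨t', ht', -⟩ := hcov t
  exact ⟨t', ht'⟩

theorem radSum_eq_zero_of_subsingleton {κ : Type*} [Nonempty κ] [Subsingleton κ]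
    (a : κ → Fin n → ℝ) : radSum a = 0 := by
  obtain ⟨t⟩ := ‹Nonempty κ›
  have : Unique κ := ⟨⟨t⟩, fun _ => Subsingleton.elim _ _⟩
  simp only [radSum, ciSup_unique, sum_mul_eq_zero_signs, mul_zero]

/-- Chaining bound from packing numbers at dyadic scales. -/
theorem radSum_le_of_packing (x : ι → Fin n → ℝ) {r₀ B : ℝ} (hr₀ : 0 < r₀) (hB : 0 ≤ B) (K : ℕ)
    (hdiam : ∀ t t', ∑ i, (x t i - x t' i) ^ 2 ≤ r₀ ^ 2)
    (hpack : ∀ l, 1 ≤ l → l ≤ K → ∀ (T : Finset ι) (L : ℕ), 1 ≤ L → 2 ^ L ≤ T.card →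
      (∀ t ∈ T, ∀ t' ∈ T, t ≠ t' → (r₀ / 2 ^ l) ^ 2 ≤ ∑ i, (x t i - x t' i) ^ 2) →
      r₀ / 2 ^ l * √L ≤ B) :
    radSum x ≤ 4 * B * K + √n * (r₀ / 2 ^ K) := by
  classical
  -- Each net point is linked to a point of the previous, coarser net. A link has length at most `r₀
  -- / 2^l`, twice the new scale, and Massart's lemma bounds its contribution by `4 * B`.
  have key : ∀ l ≤ K, ∃ N : Finset ι, N.Nonempty ∧
      (∀ t, ∃ t' ∈ N, ∑ i, (x t i - x t' i) ^ 2 ≤ (r₀ / 2 ^ l) ^ 2) ∧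
      radSum (fun t : N => x t) ≤ 4 * B * l := by
    intro l
    induction l with
    | zero =>
      intro _
      obtain ⟨t⟩ := ‹Nonempty ι›
      refine ⟨{t}, by simp, fun s => ⟨t, by simp, by simpa using hdiam s t⟩, ?_⟩
      have : Subsingleton ({t} : Finset ι) := by
        refine ⟨fun a b => Subtype.ext ?_⟩
        rw [Finset.mem_singleton.1 a.2, Finset.mem_singleton.1 b.2]
      have : Nonempty ({t} : Finset ι) := ⟨⟨t, by simp⟩⟩
      rw [radSum_eq_zero_of_subsingleton]; simp
    | succ l ih =>
      intro hl
      obtain ⟨N, hN, hcov, hrad⟩ := ih (by omega)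
      obtain ⟨N', hN', hsep, hcov'⟩ := exists_separated_net x (r := r₀ / 2 ^ (l + 1))
      refine ⟨N', hN', hcov', ?_⟩
      have : Nonempty N := hN.to_subtype
      have : Nonempty N' := hN'.to_subtype
      choose p hp hpd using hcov
      have h1 := radSum_add_le (fun t : N' => fun i => x (p t) i)
        (fun t : N' => fun i => x t i - x (p t) i)
      simp only [add_sub_cancel] at h1
      have h2 := radSum_comp_le (fun t : N => x t) (fun t : N' => ⟨p t, hp t⟩)
      have h3 : radSum (fun t : N' => fun i => x t i - x (p t) i) ≤ 4 * B := by
        rcases Nat.eq_zero_or_pos (Nat.log 2 N'.card) with h0 | hpos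
        · have hc1 : N'.card ≤ 1 := by
            rw [Nat.log_eq_zero_iff] at h0; omega
          have : Subsingleton N' := by
            rw [← Finset.card_le_one_iff_subsingleton_coe]; exact hc1
          rw [radSum_eq_zero_of_subsingleton]; linarith
        · have hc := Nat.pow_log_le_self 2 (Finset.card_ne_zero.2 hN')
          have hc' := Nat.lt_pow_succ_log_self (b := 2) (by norm_num) N'.card
          have h4 := hpack (l + 1) (by omega) hl N' _ hpos hc hsep
          refine (radSum_le_of_card_le _ (R := r₀ / 2 ^ l) (by positivity) (fun t : N' => hpd t) hpos
            ?_).trans ?_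
          · rw [Fintype.card_coe]
            exact hc'.le.trans (Nat.pow_le_pow_right (by norm_num) (by omega))
          · calc _ = 4 * (r₀ / 2 ^ (l + 1) * √(Nat.log 2 N'.card)) := by
                  rw [pow_succ]; field_simp; ring
              _ ≤ _ := by gcongr
      push_cast
      calc _ ≤ _ := h1
        _ ≤ 4 * B * l + 4 * B := add_le_add (h2.trans hrad) h3
        _ = _ := by ring
  obtain ⟨N, hN, hcov, hrad⟩ := key K le_rfl
  have : Nonempty N := hN.to_subtype
  choose p hp hpd using hcov
  have h1 := radSum_add_le (fun t => fun i => x (p t) i) (fun t => fun i => x t i - x (p t) i)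
  simp only [add_sub_cancel] at h1
  have h2 := radSum_comp_le (fun t : N => x t) (fun t : ι => ⟨p t, hp t⟩)
  have h3 : radSum (fun t i => x t i - x (p t) i) ≤ √n * (r₀ / 2 ^ K) := by
    refine radSum_le_of_forall_le _ fun ε t => ?_
    refine (Real.sum_mul_le_sqrt_mul_sqrt _ _ _).trans ?_
    have e : ∀ i, (((ε i : ℤ) : ℝ)) ^ 2 = 1 := fun i => by
      rcases Int.units_eq_one_or (ε i) with e | e <;> simp [e]
    simp only [e]
    have : √(∑ i, (x t i - x (p t) i) ^ 2) ≤ r₀ / 2 ^ K :=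
      Real.sqrt_le_iff.2 ⟨by positivity, hpd t⟩
    simpa using mul_le_mul_of_nonneg_left this (Real.sqrt_nonneg n)
  exact h1.trans (add_le_add (h2.trans hrad) h3)

theorem radSum_le_two_mul_of_range (x : ι → Fin n → ℝ) {A : ℝ}
    (hx : ∀ t t' i, |x t i - x t' i| ≤ 2 * A) : radSum x ≤ n * (2 * A) := by
  obtain ⟨t₀⟩ := id ‹Nonempty ι›
  refine (radSum_le_of_abs_sub_le x (fun t i => x t i - x t₀ i)
    (fun t t' i => by rw [sub_sub_sub_cancel_right])).trans ?_
  refine radSum_le_of_forall_le _ fun ε t => ?_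
  calc _ ≤ ∑ _i : Fin n, 2 * A := by
        refine Finset.sum_le_sum fun i _ => ?_
        have := abs_le.1 (hx t t₀ i)
        rcases Int.units_eq_one_or (ε i) with e | e <;> simp [e] <;> linarith
    _ = _ := by simp

/-- Parameters in the regime of few labels. -/
theorem radSum_max_le_aux [Fintype ι] {k : ℕ} (hn : 0 < n) (hk : 0 < k) (hkn : k ≤ n ^ 2)
    (hι : Fintype.card ι ≤ 2 ^ n) (v : ι → Fin n → Fin k → ℝ) (col : ι → Fin n → Fin k)
    (hcol : ∀ t t' i, v t' i (col t i) ≤ v t' i (col t' i)) {A : ℝ} (hA0 : 0 < A)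
    (hA : ∀ y : Fin n → Fin k, radSum (fun t i => v t i (y i)) ≤ A)
    (hrange : ∀ t t' i, |v t i (col t i) - v t' i (col t' i)| ≤ 2 * A) :
    radSum (fun t i => v t i (col t i)) ≤
      (2048 * (Nat.log 2 n + 2) * (19 + 5 * Nat.log 2 n) ^ 2 + 1) * √k * A := by
  set Λ := 19 + 5 * Nat.log 2 n with hΛ
  set K := Nat.log 2 n + 2 with hK
  have hnR : (0 : ℝ) < n := by exact_mod_cast hn
  have hkR : (0 : ℝ) < k := by exact_mod_cast hk
  have hk1 : (1 : ℝ) ≤ √k := Real.one_le_sqrt.2 (by exact_mod_cast hk)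
  have hlog1 : 2 ^ Nat.log 2 n ≤ n := Nat.pow_log_le_self 2 hn.ne'
  have hlog2 : n < 2 ^ (Nat.log 2 n + 1) := Nat.lt_pow_succ_log_self (by norm_num) n
  have hK1 : (2 : ℝ) ^ K ≤ 4 * n := by
    have : 2 ^ K ≤ 4 * n := by rw [hK, pow_add]; omega
    exact_mod_cast this
  have hK2 : 2 * (n : ℝ) ≤ 2 ^ K := by
    have : 2 * n ≤ 2 ^ K := by
      rw [hK, show Nat.log 2 n + 2 = (Nat.log 2 n + 1) + 1 from rfl, pow_succ]; omega
    exact_mod_cast this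
  have hsn : √(n : ℝ) ^ 2 = n := Real.sq_sqrt hnR.le
  have hsn0 : 0 < √(n : ℝ) := Real.sqrt_pos.2 hnR
  -- The diameter is at most `2A√n`, and `2^K ≥ 2n` makes the remainder below the last scale at most
  -- `A`.
  have hmain := radSum_le_of_packing (fun t i => v t i (col t i)) (r₀ := 2 * A * √n)
    (B := 512 * Λ ^ 2 * √k * A) (by positivity) (by positivity) K ?_ ?_
  · refine hmain.trans ?_
    have h1 : √n * (2 * A * √n / 2 ^ K) ≤ 1 * A := by
      rw [mul_div_assoc', div_le_iff₀ (by positivity)]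
      calc _ = A * (2 * n) := by linear_combination 2 * A * hsn
        _ ≤ A * 2 ^ K := by gcongr
        _ = _ := by ring
    have h2 : 1 * A ≤ √k * A := by gcongr
    push_cast [hK, hΛ] at h1 ⊢
    linarith
  · intro t t'
    calc _ ≤ ∑ _i : Fin n, (2 * A) ^ 2 := by
          refine Finset.sum_le_sum fun i _ => ?_
          rw [sq_le_sq, abs_of_pos (by positivity : 0 < 2 * A)]
          exact hrange t t' i
      _ = _ := by simp only [Finset.sum_const, Finset.card_univ, Fintype.card_fin, nsmul_eq_mul]
                  linear_combination -(4 * A ^ 2) * hsn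
  · intro l hl hlK T L hL hT hsep
    set r := 2 * A * √n / 2 ^ l with hr
    have hr0 : 0 < r := by positivity
    have hLR : (1 : ℝ) ≤ L := by exact_mod_cast hL
    -- This is where the bound `2^n` on the number of members enters: it keeps the number of tests
    -- polynomial in `n`, hence `Λ` logarithmic.
    have hLn : L ≤ n := by
      have := hT.trans ((Finset.card_le_univ T).trans hι)
      exact (Nat.pow_le_pow_iff_right (by norm_num)).1 this
    have hLnR : (L : ℝ) ≤ n := by exact_mod_cast hLn
    have hrA : A ≤ r * (2 * √n) := by
      rw [hr, div_mul_eq_mul_div, le_div_iff₀ (by positivity)]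
      calc A * 2 ^ l ≤ A * 2 ^ K := by gcongr; norm_num
        _ ≤ A * (4 * n) := by gcongr
        _ = _ := by linear_combination -(4 * A) * hsn
    set q := √(240 * L * k) with hq
    have hq0 : 0 < q := Real.sqrt_pos.2 (by positivity)
    have hqs : q ^ 2 = 240 * L * k := Real.sq_sqrt (by positivity)
    have hq1 : q ≤ 16 * √L * √k := by
      rw [hq, Real.sqrt_le_left (by positivity), mul_pow, mul_pow, Real.sq_sqrt (by positivity),
        Real.sq_sqrt hkR.le]
      have : (0 : ℝ) ≤ L * k := by positivity
      linarith
    have hsk : √(k : ℝ) ≤ n := by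
      rw [Real.sqrt_le_left hnR.le]; exact_mod_cast hkn
    have hq2 : q ≤ 16 * √n * n := by
      refine hq1.trans ?_
      gcongr
    -- `τ = r / √(240 L k)` is the largest gap allowed by the mass condition. With `V = 256 n²`
    -- levels and `k ≤ n²`, twice the number of tests is at most `2^14 n^5 ≤ 2^Λ`.
    have := packing_bound (Λ := Λ) (V := 256 * n ^ 2) hk v col hcol hA0 hA T hL hT
      (r := r) (τ := r / q) (by positivity) hsep (by
        rw [div_pow, hqs, mul_div_cancel₀ _ (by positivity)]) (by
        rw [div_div_eq_mul_div, div_le_iff₀ hr0]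
        push_cast
        calc 8 * A * q ≤ 8 * (r * (2 * √n)) * (16 * √n * n) := by gcongr
          _ = 256 * n ^ 2 * r := by linear_combination 256 * r * n * hsn) (by
        calc 2 * (n * (k * (256 * n ^ 2)) + 16 * L * (256 * n ^ 2))
            ≤ 2 * (n * (n ^ 2 * (256 * n ^ 2)) + 16 * n * (256 * n ^ 2)) := by gcongr
          _ = 2 * (256 * n ^ 5 + 16 * 256 * (n ^ 3 * 1)) := by ring
          _ ≤ 2 * (256 * n ^ 5 + 16 * 256 * (n ^ 3 * n ^ 2)) := by
              gcongr; exact Nat.one_le_pow _ _ hn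
          _ ≤ 2 ^ 14 * n ^ 5 := by ring_nf; omega
          _ ≤ 2 ^ 14 * (2 ^ (Nat.log 2 n + 1)) ^ 5 := by gcongr
          _ = 2 ^ Λ := by rw [hΛ, ← pow_mul, ← pow_add]; congr 1; ring)
    have hLs : √(L : ℝ) ^ 2 = L := Real.sq_sqrt (by positivity)
    have hL0 : 0 < √(L : ℝ) := Real.sqrt_pos.2 (by linarith)
    rw [mul_div_assoc', div_le_iff₀ hq0] at this
    have h2 : √L * (r * √L) ≤ √L * (512 * Λ ^ 2 * √k * A) := by
      calc _ = L * r := by linear_combination r * hLs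
        _ ≤ 32 * Λ ^ 2 * A * q := this
        _ ≤ 32 * Λ ^ 2 * A * (16 * √L * √k) := by gcongr
        _ = _ := by ring
    exact le_of_mul_le_mul_left h2 hL0

/-- The Rademacher complexity of the coordinatewise maxima of a vector-valued family is at most
`√k` times the worst-label complexity, up to logarithmic factors. -/
theorem radSum_max_le {k : ℕ} (hn : 0 < n) (hk : 0 < k)
    (v : ι → Fin n → Fin k → ℝ) (col : ι → Fin n → Fin k)
    (hcol : ∀ t t' i, v t' i (col t i) ≤ v t' i (col t' i)) {A : ℝ}
    (hA : ∀ y : Fin n → Fin k, radSum (fun t i => v t i (y i)) ≤ A) :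
    radSum (fun t i => v t i (col t i)) ≤ 1500000 * (1 + Real.log n) ^ 3 * √k * A := by
  have hnR : (1 : ℝ) ≤ n := by exact_mod_cast hn
  have hk1 : (1 : ℝ) ≤ √k := Real.one_le_sqrt.2 (by exact_mod_cast hk)
  have hlog : 0 ≤ Real.log n := Real.log_nonneg hnR
  have hA0 : 0 ≤ A := (radSum_nonneg _).trans (hA fun _ => ⟨0, hk⟩)
  have hone : 1 ≤ (1 + Real.log n) ^ 3 := one_le_pow₀ (by linarith)
  have hrange : ∀ t t' i, |v t i (col t i) - v t' i (col t' i)| ≤ 2 * A := by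
    have h : ∀ t t' i j, v t i j - v t' i j ≤ 2 * A := fun t t' i j => by
      have := abs_sub_le_two_mul_radSum (fun t i => v t i ((fun _ => j) i)) t t' i
      have := hA (fun _ => j)
      have := (abs_le.1 ‹|v t i j - v t' i j| ≤ _›).2
      linarith
    intro t t' i
    refine abs_sub_le_iff.2 ⟨?_, ?_⟩
    · linarith [hcol t t' i, h t t' i (col t i)]
    · linarith [hcol t' t i, h t' t i (col t' i)]
  -- When `k > n²`, already `√k ≥ n` and the range bound suffices.
  by_cases htriv : A = 0 ∨ n ^ 2 < k
  · refine (radSum_le_two_mul_of_range _ hrange).trans ?_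
    rcases htriv with rfl | h
    · simp
    · have h1 : (n : ℝ) ≤ √k := Real.le_sqrt_of_sq_le (by exact_mod_cast h.le)
      calc (n : ℝ) * (2 * A) ≤ √k * (2 * A) := by gcongr
        _ = (2 * 1) * √k * A := by ring
        _ ≤ 1500000 * (1 + Real.log n) ^ 3 * √k * A := by gcongr; norm_num
  · push Not at htriv
    have hA0' : 0 < A := lt_of_le_of_ne hA0 (Ne.symm htriv.1)
    -- Only one maximizer per sign vector matters, which reduces the family to `2^n` members.
    choose φ hφ using fun ε : Fin n → ℤˣ => exists_eq_ciSup_of_finite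
      (f := fun t => ∑ i, ((ε i : ℤ) : ℝ) * v t i (col t i))
    have hle : radSum (fun t i => v t i (col t i)) ≤
        radSum (fun ε i => v (φ ε) i (col (φ ε) i)) := by
      unfold radSum
      gcongr with ε
      rw [← hφ ε]
      exact le_iSup_finite (fun ε' => ∑ i, ((ε i : ℤ) : ℝ) * v (φ ε') i (col (φ ε') i)) ε
    have := radSum_max_le_aux hn hk htriv.2 (by simp [Fintype.card_units_int])
      (fun ε => v (φ ε)) (fun ε => col (φ ε)) (fun t t' => hcol _ _) hA0'
      (fun y => (radSum_comp_le (fun t i => v t i (y i)) φ).trans (hA y)) (fun t t' => hrange _ _)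
    refine (hle.trans this).trans ?_
    have hl : (Nat.log 2 n : ℝ) ≤ 2 * Real.log n := by
      have h1 : (2 : ℝ) ^ Nat.log 2 n ≤ n := by exact_mod_cast Nat.pow_log_le_self 2 hn.ne'
      have h2 := Real.log_le_log (by positivity) h1
      rw [Real.log_pow] at h2
      nlinarith [Real.log_two_gt_d9, (Nat.cast_nonneg (Nat.log 2 n) : (0 : ℝ) ≤ _)]
    gcongr
    calc 2048 * ((Nat.log 2 n : ℝ) + 2) * (19 + 5 * (Nat.log 2 n : ℝ)) ^ 2 + 1
        ≤ 2048 * (2 * (1 + Real.log n)) * (19 * (1 + Real.log n)) ^ 2 + (1 + Real.log n) ^ 3 := by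
          gcongr <;> linarith
      _ = 1478657 * (1 + Real.log n) ^ 3 := by ring
      _ ≤ _ := by gcongr; norm_num

end

/-! ### Bounded differences, symmetrization and uniform deviation -/

section
variable {Z : Type*} [MeasurableSpace Z] (P : Measure Z) [IsProbabilityMeasure P]

theorem integrable_of_measurable_of_bound {Y : Type*} [MeasurableSpace Y] (Q : Measure Y)
    [IsFiniteMeasure Q] {f : Y → ℝ} (hf : Measurable f) {K : ℝ} (hK : ∀ y, |f y| ≤ K) :
    Integrable f Q :=
  Integrable.of_bound hf.aestronglyMeasurable K (ae_of_all _ hK)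

theorem measurable_finCons {n : ℕ} :
    Measurable fun p : Z × (Fin n → Z) => (Fin.cons p.1 p.2 : Fin (n + 1) → Z) :=
  measurable_pi_lambda _ fun i => by
    refine Fin.cases ?_ (fun i => ?_) i
    · simpa using measurable_fst
    · simp only [Fin.cons_succ]
      exact (measurable_pi_apply i).comp measurable_snd

theorem integral_pi_fin_succ {n : ℕ} {f : (Fin (n + 1) → Z) → ℝ} :
    ∫ s, f s ∂(Measure.pi fun _ => P) =
      ∫ p, f (Fin.cons p.1 p.2) ∂(P.prod (Measure.pi fun _ : Fin n => P)) := by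
  have h := (measurePreserving_piFinSuccAbove (fun _ : Fin (n + 1) => P) 0).symm
  rw [← h.integral_comp (MeasurableEquiv.measurableEmbedding _)]
  simp [MeasurableEquiv.piFinSuccAbove, Fin.consEquiv]

theorem abs_integral_le_of_abs_le {f : Z → ℝ} {K : ℝ} (hK : ∀ z, |f z| ≤ K) :
    |∫ z, f z ∂P| ≤ K := by
  simpa using norm_integral_le_of_norm_le_const (μ := P)
    (ae_of_all _ fun z => (Real.norm_eq_abs (f z)).trans_le (hK z))

/-- Exponential moment bound for functions with bounded differences. -/
theorem integral_exp_le_of_bounded_differences {n : ℕ} (f : (Fin n → Z) → ℝ) (hf : Measurable f)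
    {K : ℝ} (hK : ∀ s, |f s| ≤ K) {c : ℝ}
    (hc : ∀ s i z, |f (Function.update s i z) - f s| ≤ c) (l : ℝ) :
    ∫ s, Real.exp (l * (f s - ∫ s, f s ∂(Measure.pi fun _ => P))) ∂(Measure.pi fun _ => P) ≤
      Real.exp (n * (l ^ 2 * c ^ 2 / 8)) := by
  induction n with
  | zero =>
    have : ∀ s, f s = f default := fun s => by rw [Subsingleton.elim s default]
    simp [this]
  | succ n ih =>
    have hfc : Measurable fun p : Z × (Fin n → Z) => f (Fin.cons p.1 p.2) :=
      hf.comp measurable_finCons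
    have hint : Integrable (fun p : Z × (Fin n → Z) => f (Fin.cons p.1 p.2))
        (P.prod (Measure.pi fun _ : Fin n => P)) :=
      integrable_of_measurable_of_bound _ hfc fun p => hK _
    -- Conditional mean given the first coordinate. Its values lie in an interval of length `c`, so
    -- Hoeffding's lemma applies to it; the remaining coordinates go to the induction hypothesis.
    set g : Z → ℝ := fun x => ∫ s, f (Fin.cons x s) ∂(Measure.pi fun _ : Fin n => P) with hg
    have hgm : Measurable g := hfc.stronglyMeasurable.integral_prod_right.measurable
    have hfx : ∀ x, Measurable fun s : Fin n → Z => f (Fin.cons x s) := fun x =>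
      hfc.comp measurable_prodMk_left
    have hfi : ∀ x, Integrable (fun s : Fin n → Z => f (Fin.cons x s))
        (Measure.pi fun _ : Fin n => P) := fun x =>
      integrable_of_measurable_of_bound _ (hfx x) fun _ => hK _
    set E := ∫ s, f s ∂(Measure.pi fun _ : Fin (n + 1) => P) with hE
    have hEg : E = ∫ x, g x ∂P := by
      rw [hE, integral_pi_fin_succ, integral_prod _ hint]
    have hgK : ∀ x, |g x| ≤ K := fun x => abs_integral_le_of_abs_le _ fun s => hK (Fin.cons x s)
    have hgc : ∀ x x', g x - g x' ≤ c := by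
      intro x x'
      rw [hg, ← integral_sub (hfi x) (hfi x')]
      calc _ ≤ ∫ _s, c ∂(Measure.pi fun _ : Fin n => P) := by
            refine integral_mono ((hfi x).sub (hfi x')) (integrable_const _) fun s => ?_
            have := hc (Fin.cons x' s) 0 x
            rw [Fin.update_cons_zero] at this
            exact (abs_le.1 this).2
        _ = c := by simp
    have hne : Nonempty Z := nonempty_of_isProbabilityMeasure P
    have hbdd : BddBelow (Set.range g) := ⟨-K, by rintro _ ⟨x, rfl⟩; exact (abs_le.1 (hgK x)).1⟩
    set a := ⨅ x, g x with ha
    have hIcc : ∀ x, g x ∈ Set.Icc a (a + c) := fun x => by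
      refine ⟨ciInf_le hbdd x, ?_⟩
      have : g x - c ≤ a := le_ciInf fun x' => by linarith [hgc x x']
      linarith
    have hoeff := (hasSubgaussianMGF_of_mem_Icc (μ := P) hgm.aemeasurable (ae_of_all _ hIcc)).mgf_le l
    rw [mgf] at hoeff
    have hexpm : Measurable fun p : Z × (Fin n → Z) =>
        Real.exp (l * (f (Fin.cons p.1 p.2) - E)) :=
      ((hfc.sub_const _).const_mul _).exp
    have hexpi : Integrable (fun p : Z × (Fin n → Z) => Real.exp (l * (f (Fin.cons p.1 p.2) - E)))
        (P.prod (Measure.pi fun _ : Fin n => P)) := by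
      refine integrable_of_measurable_of_bound _ hexpm (K := Real.exp (|l| * (K + |E|))) fun p => ?_
      rw [abs_of_pos (Real.exp_pos _), Real.exp_le_exp]
      refine (le_abs_self _).trans ?_
      rw [abs_mul]
      gcongr
      exact (abs_sub _ _).trans (by gcongr; exact hK _)
    rw [integral_pi_fin_succ, integral_prod _ hexpi]
    have hstep : ∀ x, ∫ s, Real.exp (l * (f (Fin.cons x s) - E)) ∂(Measure.pi fun _ : Fin n => P) ≤
        Real.exp (l * (g x - E)) * Real.exp (n * (l ^ 2 * c ^ 2 / 8)) := by
      intro x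
      have := ih (fun s => f (Fin.cons x s)) (hfx x) (fun s => hK _) (fun s i z => by
        have := hc (Fin.cons x s) i.succ z
        rwa [← Fin.cons_update] at this)
      calc _ = ∫ s, Real.exp (l * (g x - E)) * Real.exp (l * (f (Fin.cons x s) - g x))
              ∂(Measure.pi fun _ : Fin n => P) := by
            congr 1; ext s; rw [← Real.exp_add]; ring_nf
        _ = Real.exp (l * (g x - E)) * ∫ s, Real.exp (l * (f (Fin.cons x s) - g x))
              ∂(Measure.pi fun _ : Fin n => P) := integral_const_mul _ _
        _ ≤ _ := by gcongr
    have hgi : Integrable (fun x => Real.exp (l * (g x - E))) P := by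
      refine integrable_of_measurable_of_bound _ (by fun_prop) (K := Real.exp (|l| * (K + |E|)))
        fun p => ?_
      rw [abs_of_pos (Real.exp_pos _), Real.exp_le_exp]
      refine (le_abs_self _).trans ?_
      rw [abs_mul]
      gcongr
      exact (abs_sub _ _).trans (by gcongr; exact hgK _)
    calc _ ≤ ∫ x, Real.exp (l * (g x - E)) * Real.exp (n * (l ^ 2 * c ^ 2 / 8)) ∂P :=
          integral_mono hexpi.integral_prod_left (hgi.mul_const _) hstep
      _ = (∫ x, Real.exp (l * (g x - E)) ∂P) * Real.exp (n * (l ^ 2 * c ^ 2 / 8)) :=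
          integral_mul_const _ _
      _ ≤ Real.exp (l ^ 2 * c ^ 2 / 8) * Real.exp (n * (l ^ 2 * c ^ 2 / 8)) := by
          gcongr
          rw [hEg]
          refine hoeff.trans (le_of_eq ?_)
          congr 1
          simp only [add_sub_cancel_left, NNReal.coe_pow, NNReal.coe_div, coe_nnnorm, Real.norm_eq_abs,
            NNReal.coe_ofNat, div_pow, sq_abs]
          ring
      _ = _ := by rw [← Real.exp_add]; push_cast; ring_nf

end

section
variable {ι : Type*} [Finite ι] [Nonempty ι]

theorem abs_iSup_le {f : ι → ℝ} {K : ℝ} (h : ∀ t, |f t| ≤ K) : |⨆ t, f t| ≤ K := by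
  obtain ⟨t, ht⟩ := exists_eq_ciSup_of_finite (f := f)
  rw [← ht]; exact h t

theorem abs_iSup_sub_iSup_le {f g : ι → ℝ} {K : ℝ} (h : ∀ t, |f t - g t| ≤ K) :
    |(⨆ t, f t) - ⨆ t, g t| ≤ K := by
  refine abs_sub_le_iff.2 ⟨?_, ?_⟩ <;> rw [sub_le_iff_le_add]
  · refine ciSup_le fun t => ?_
    linarith [(abs_le.1 (h t)).2, le_iSup_finite g t]
  · refine ciSup_le fun t => ?_
    linarith [(abs_le.1 (h t)).1, le_iSup_finite f t]

theorem abs_signs_sum_le {n : ℕ} (ε : Fin n → ℤˣ) (a : Fin n → ℝ) :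
    |∑ i, ((ε i : ℤ) : ℝ) * a i| ≤ ∑ i, |a i| := by
  refine (Finset.abs_sum_le_sum_abs _ _).trans (Finset.sum_le_sum fun i _ => ?_)
  rcases Int.units_eq_one_or (ε i) with e | e <;> simp [e]

theorem abs_radSum_le {n : ℕ} {a : ι → Fin n → ℝ} {K : ℝ} (h : ∀ t, ∑ i, |a t i| ≤ K) :
    |radSum a| ≤ K := by
  rw [abs_of_nonneg (radSum_nonneg a)]
  exact radSum_le_of_forall_le a fun ε t => ((le_abs_self _).trans (abs_signs_sum_le ε _)).trans (h t)

theorem abs_radSum_sub_radSum_le {n : ℕ} {a b : ι → Fin n → ℝ} {K : ℝ}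
    (h : ∀ t, ∑ i, |a t i - b t i| ≤ K) : |radSum a - radSum b| ≤ K := by
  have key : ∀ a b : ι → Fin n → ℝ, (∀ t, ∑ i, |a t i - b t i| ≤ K) →
      radSum a - radSum b ≤ K := by
    intro a b h
    have h1 := radSum_add_le b fun t i => a t i - b t i
    simp only [add_sub_cancel] at h1
    linarith [(abs_le.1 (abs_radSum_le (a := fun t i => a t i - b t i) h)).2]
  refine abs_sub_le_iff.2 ⟨key a b h, key b a fun t => ?_⟩
  simpa only [abs_sub_comm] using h t

variable {Z : Type*} [MeasurableSpace Z] (P : Measure Z) [IsProbabilityMeasure P]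

omit [Nonempty ι] in
theorem measurable_radSum {Y : Type*} [MeasurableSpace Y] {n : ℕ} {a : Y → ι → Fin n → ℝ}
    (ha : ∀ t i, Measurable fun y => a y t i) : Measurable fun y => radSum (a y) := by
  have := Finite.to_countable (α := ι)
  refine Measurable.const_mul (Finset.measurable_sum _ fun ε _ => Measurable.iSup fun t => ?_) _
  exact Finset.measurable_sum _ fun i _ => (ha t i).const_mul _

/-- Write `R + (E h - h x)` as the average of `R + 2 E h` and `R - 2 h x`. The first is at most `E
sup (R + 2h)`, so no ghost sample is needed. -/
theorem symmetrization_step (h : ι → Z → ℝ) (hm : ∀ t, Measurable (h t))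
    (h0 : ∀ t z, |h t z| ≤ 1) (R : ι → ℝ) :
    ∫ x, ⨆ t, (R t + (∫ z, h t z ∂P - h t x)) ∂P ≤
      (1 / 2) * ∑ e : ℤˣ, ∫ x, ⨆ t, (R t + ((e : ℤ) : ℝ) * (2 * h t x)) ∂P := by
  have := Finite.to_countable (α := ι)
  obtain ⟨C, hC⟩ : ∃ C, ∀ t, |R t| ≤ C :=
    ⟨⨆ t, |R t|, fun t => le_iSup_finite (fun t => |R t|) t⟩
  have hint : ∀ e : ℝ, |e| ≤ 1 → Integrable (fun x => ⨆ t, (R t + e * (2 * h t x))) P := by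
    intro e he
    refine integrable_of_measurable_of_bound _
      (Measurable.iSup fun t => (((hm t).const_mul 2).const_mul e).const_add _) (K := C + 2)
      fun x => abs_iSup_le fun t => ?_
    refine (abs_add_le _ _).trans (add_le_add (hC t) ?_)
    rw [abs_mul, abs_mul, abs_two]
    nlinarith [h0 t x, abs_nonneg (h t x), abs_nonneg e]
  have h1 := hint 1 (by simp)
  have h2 := hint (-1) (by simp)
  have hhi : ∀ t, Integrable (h t) P := fun t =>
    integrable_of_measurable_of_bound _ (hm t) (h0 t)
  rw [sum_intUnits]
  simp only [Units.val_one, Int.cast_one, Units.val_neg, Int.cast_neg]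
  set a := ∫ x, ⨆ t, (R t + (1 : ℝ) * (2 * h t x)) ∂P with ha
  have hpt : ∀ x, ⨆ t, (R t + (∫ z, h t z ∂P - h t x)) ≤
      1 / 2 * a + 1 / 2 * ⨆ t, (R t + (-1 : ℝ) * (2 * h t x)) := by
    intro x
    refine ciSup_le fun t => ?_
    have e1 : R t + 2 * ∫ z, h t z ∂P ≤ a := by
      have : R t + 2 * ∫ z, h t z ∂P = ∫ z, (R t + (1 : ℝ) * (2 * h t z)) ∂P := by
        simp only [one_mul]
        rw [integral_add (integrable_const _) ((hhi t).const_mul 2), integral_const_mul]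
        simp
      rw [this]
      refine integral_mono ((integrable_const _).add (((hhi t).const_mul 2).const_mul 1)) h1
        fun z => le_iSup_finite (fun t => R t + (1 : ℝ) * (2 * h t z)) t
    have e2 := le_iSup_finite (fun t => R t + (-1 : ℝ) * (2 * h t x)) t
    linarith
  calc _ ≤ ∫ x, (1 / 2 * a + 1 / 2 * ⨆ t, (R t + (-1 : ℝ) * (2 * h t x))) ∂P := by
        refine integral_mono ?_ ((integrable_const _).add (h2.const_mul _)) hpt
        refine integrable_of_measurable_of_bound _
          (Measurable.iSup fun t => ((hm t).const_sub _).const_add _) (K := C + 2)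
          fun x => abs_iSup_le fun t => ?_
        refine (abs_add_le _ _).trans (add_le_add (hC t) ?_)
        have := abs_integral_le_of_abs_le P (h0 t)
        refine (abs_sub _ _).trans ?_
        linarith [h0 t x]
    _ = _ := by
        rw [integral_add (integrable_const _) (h2.const_mul _), integral_const, integral_const_mul]
        simp only [probReal_univ, one_smul]
        ring

/-- Symmetrization. -/
theorem symmetrization (h : ι → Z → ℝ) (hm : ∀ t, Measurable (h t))
    (h0 : ∀ t z, |h t z| ≤ 1) {n : ℕ} (R : ι → ℝ) :
    ∫ s, ⨆ t, (R t + ∑ i, (∫ z, h t z ∂P - h t (s i))) ∂(Measure.pi fun _ : Fin n => P) ≤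
      (1 / 2) ^ n * ∑ ε : Fin n → ℤˣ,
        ∫ s, ⨆ t, (R t + ∑ i, ((ε i : ℤ) : ℝ) * (2 * h t (s i))) ∂(Measure.pi fun _ : Fin n => P) := by
  have := Finite.to_countable (α := ι)
  have hI : ∀ t, |∫ z, h t z ∂P| ≤ 1 := fun t =>
    abs_integral_le_of_abs_le P (h0 t)
  induction n generalizing R with
  | zero => simp
  | succ n ih =>
    obtain ⟨C, hC⟩ : ∃ C, ∀ t, |R t| ≤ C :=
      ⟨⨆ t, |R t|, fun t => le_iSup_finite (fun t => |R t|) t⟩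
    have hb1 : ∀ t x, |∫ z, h t z ∂P - h t x| ≤ 2 := fun t x =>
      (abs_sub _ _).trans (by linarith [h0 t x, hI t])
    have hb2 : ∀ (e : ℤˣ) t x, |((e : ℤ) : ℝ) * (2 * h t x)| ≤ 2 := fun e t x => by
      rcases Int.units_eq_one_or e with e | e <;> simp [e, abs_mul] <;> linarith [h0 t x]
    have hbs : ∀ (a : Fin n → ℝ), (∀ i, |a i| ≤ 2) → |∑ i, a i| ≤ n * 2 := fun a ha => by
      refine (Finset.abs_sum_le_sum_abs _ _).trans ?_
      simpa using Finset.sum_le_card_nsmul Finset.univ (fun i => |a i|) 2 fun i _ => ha i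
    have hmx : ∀ t, Measurable fun p : Z × (Fin n → Z) => h t p.1 := fun t =>
      (hm t).comp measurable_fst
    have hms : ∀ t i, Measurable fun p : Z × (Fin n → Z) => h t (p.2 i) := fun t i =>
      (hm t).comp ((measurable_pi_apply i).comp measurable_snd)
    have i1 : Integrable (fun p : Z × (Fin n → Z) => ⨆ t, (R t + ((∫ z, h t z ∂P - h t p.1) +
        ∑ i, (∫ z, h t z ∂P - h t (p.2 i))))) (P.prod (Measure.pi fun _ : Fin n => P)) := by
      refine integrable_of_measurable_of_bound _ (K := C + (2 + n * 2))
        (Measurable.iSup fun t => (((hmx t).const_sub _).add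
          (Finset.measurable_sum _ fun i _ => (hms t i).const_sub _)).const_add _)
        fun p => abs_iSup_le fun t => ?_
      exact (abs_add_le _ _).trans (add_le_add (hC t) ((abs_add_le _ _).trans
        (add_le_add (hb1 _ _) (hbs _ fun i => hb1 _ _))))
    have i2 : ∀ ε : Fin n → ℤˣ, Integrable (fun p : Z × (Fin n → Z) =>
        ⨆ t, (R t + (∑ i, ((ε i : ℤ) : ℝ) * (2 * h t (p.2 i)) + (∫ z, h t z ∂P - h t p.1))))
        (P.prod (Measure.pi fun _ : Fin n => P)) := by
      intro ε
      refine integrable_of_measurable_of_bound _ (K := C + (n * 2 + 2))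
        (Measurable.iSup fun t => ((Finset.measurable_sum _ fun i _ =>
          ((hms t i).const_mul 2).const_mul _).add ((hmx t).const_sub _)).const_add _)
        fun p => abs_iSup_le fun t => ?_
      exact (abs_add_le _ _).trans (add_le_add (hC t) ((abs_add_le _ _).trans
        (add_le_add (hbs _ fun i => hb2 _ _ _) (hb1 _ _))))
    have i3 : ∀ (e : ℤˣ) (ε : Fin n → ℤˣ), Integrable (fun p : Z × (Fin n → Z) =>
        ⨆ t, (R t + (∑ i, ((ε i : ℤ) : ℝ) * (2 * h t (p.2 i)) + ((e : ℤ) : ℝ) * (2 * h t p.1))))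
        (P.prod (Measure.pi fun _ : Fin n => P)) := by
      intro e ε
      refine integrable_of_measurable_of_bound _ (K := C + (n * 2 + 2))
        (Measurable.iSup fun t => ((Finset.measurable_sum _ fun i _ =>
          ((hms t i).const_mul 2).const_mul _).add (((hmx t).const_mul 2).const_mul _)).const_add _)
        fun p => abs_iSup_le fun t => ?_
      exact (abs_add_le _ _).trans (add_le_add (hC t) ((abs_add_le _ _).trans
        (add_le_add (hbs _ fun i => hb2 _ _ _) (hb2 _ _ _))))
    rw [sum_fin_succ_arrow]
    simp only [integral_pi_fin_succ, Fin.sum_univ_succ, Fin.cons_zero, Fin.cons_succ]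
    calc _ = ∫ x, ∫ s, ⨆ t, ((R t + (∫ z, h t z ∂P - h t x)) +
            ∑ i, (∫ z, h t z ∂P - h t (s i))) ∂(Measure.pi fun _ : Fin n => P) ∂P := by
          rw [integral_prod _ i1]
          simp only [add_assoc]
      _ ≤ ∫ x, (1 / 2) ^ n * ∑ ε : Fin n → ℤˣ, ∫ s, ⨆ t, (R t +
            (∑ i, ((ε i : ℤ) : ℝ) * (2 * h t (s i)) + (∫ z, h t z ∂P - h t x)))
              ∂(Measure.pi fun _ : Fin n => P) ∂P := by
          refine integral_mono ?_ ?_ fun x => ?_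
          · simpa only [add_assoc] using i1.integral_prod_left
          · exact (integrable_finsetSum _ fun ε _ => (i2 ε).integral_prod_left).const_mul _
          · refine (ih fun t => R t + (∫ z, h t z ∂P - h t x)).trans (le_of_eq ?_)
            simp only [add_assoc, add_comm (∫ z, h _ z ∂P - h _ x)]
      _ = (1 / 2) ^ n * ∑ ε : Fin n → ℤˣ, ∫ s, ∫ x, ⨆ t, ((R t +
            ∑ i, ((ε i : ℤ) : ℝ) * (2 * h t (s i))) + (∫ z, h t z ∂P - h t x)) ∂P
              ∂(Measure.pi fun _ : Fin n => P) := by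
          rw [integral_const_mul, integral_finsetSum _ fun ε _ => (i2 ε).integral_prod_left]
          congr 1
          refine Finset.sum_congr rfl fun ε _ => ?_
          rw [integral_integral_swap (i2 ε)]
          simp only [add_assoc]
      _ ≤ (1 / 2) ^ n * ∑ ε : Fin n → ℤˣ, ∫ s, (1 / 2) * ∑ e : ℤˣ, ∫ x, ⨆ t, (R t +
            (∑ i, ((ε i : ℤ) : ℝ) * (2 * h t (s i)) + ((e : ℤ) : ℝ) * (2 * h t x))) ∂P
              ∂(Measure.pi fun _ : Fin n => P) := by
          refine mul_le_mul_of_nonneg_left (Finset.sum_le_sum fun ε _ => ?_) (by positivity)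
          refine integral_mono ?_ ?_ fun s => ?_
          · simpa only [add_assoc] using (i2 ε).integral_prod_right
          · exact (integrable_finsetSum _ fun e _ => (i3 e ε).integral_prod_right).const_mul _
          · refine (symmetrization_step P h hm h0 _).trans (le_of_eq ?_)
            simp only [add_assoc]
      _ = _ := by
          have : ∀ ε : Fin n → ℤˣ, ∫ s, (1 / 2 : ℝ) * ∑ e : ℤˣ, ∫ x, ⨆ t, (R t +
            (∑ i, ((ε i : ℤ) : ℝ) * (2 * h t (s i)) + ((e : ℤ) : ℝ) * (2 * h t x))) ∂P
              ∂(Measure.pi fun _ : Fin n => P) = 1 / 2 * ∑ e : ℤˣ,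
              ∫ p, ⨆ t, (R t + (∑ i, ((ε i : ℤ) : ℝ) * (2 * h t (p.2 i)) +
                ((e : ℤ) : ℝ) * (2 * h t p.1))) ∂(P.prod (Measure.pi fun _ : Fin n => P)) := by
            intro ε
            rw [integral_const_mul, integral_finsetSum _ fun e _ => (i3 e ε).integral_prod_right]
            congr 1
            refine Finset.sum_congr rfl fun e _ => ?_
            rw [integral_prod_symm _ (i3 e ε)]
          simp only [this]
          rw [← Finset.mul_sum, Finset.sum_comm, ← mul_assoc, pow_succ]
          congr 1
          refine Finset.sum_congr rfl fun e _ => Finset.sum_congr rfl fun ε _ => ?_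
          simp only [add_comm (∑ i, ((ε i : ℤ) : ℝ) * _)]

/-- Uniform deviation bound for a finite class of `[0,1]`-valued functions with empirical
Rademacher complexity. -/
theorem uniform_deviation (h : ι → Z → ℝ) (hm : ∀ t, Measurable (h t))
    (h0 : ∀ t z, 0 ≤ h t z) (h1 : ∀ t z, h t z ≤ 1) {n : ℕ} (hn : 0 < n) {δ : ℝ} (hδ : 0 < δ)
    (hδ' : δ < 1) :
    (Measure.pi fun _ : Fin n => P) {s | ∃ t, 1 / (n : ℝ) * ∑ i, h t (s i) +
      2 / n * radSum (fun t i => h t (s i)) + 3 * √(Real.log (1 / δ) / (2 * n)) < ∫ z, h t z ∂P} ≤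
      ENNReal.ofReal δ := by
  have := Finite.to_countable (α := ι)
  have hnR : (0 : ℝ) < n := by exact_mod_cast hn
  have habs : ∀ t z, |h t z| ≤ 1 := fun t z => abs_le.2 ⟨by linarith [h0 t z], h1 t z⟩
  have hI : ∀ t, |∫ z, h t z ∂P| ≤ 1 := fun t =>
    abs_integral_le_of_abs_le P (habs t)
  set μ := Measure.pi fun _ : Fin n => P with hμ
  set D : (Fin n → Z) → ℝ := fun s => ⨆ t, (0 + ∑ i, (∫ z, h t z ∂P - h t (s i))) with hD
  -- Subtracting the empirical complexity before concentrating avoids a second confidence event.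
  -- Changing one point moves `D` by at most `1` and `radSum` by at most `1`, hence `F` by at most
  -- `3`.
  set F : (Fin n → Z) → ℝ := fun s => D s - 2 * radSum (fun t i => h t (s i)) with hF
  have hms : ∀ t i, Measurable fun s : Fin n → Z => h t (s i) := fun t i =>
    (hm t).comp (measurable_pi_apply i)
  have hDm : Measurable D := Measurable.iSup fun t =>
    (Finset.measurable_sum _ fun i _ => (hms t i).const_sub _).const_add _
  have hRm : Measurable fun s : Fin n → Z => radSum (fun t i => h t (s i)) :=
    measurable_radSum hms
  have hFm : Measurable F := hDm.sub (hRm.const_mul 2)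
  have hDb : ∀ s, |D s| ≤ n * 2 := fun s => abs_iSup_le fun t => by
    rw [zero_add]
    refine (Finset.abs_sum_le_sum_abs _ _).trans ?_
    simpa using Finset.sum_le_card_nsmul Finset.univ (fun i => |∫ z, h t z ∂P - h t (s i)|) 2
      fun i _ => (abs_sub _ _).trans (by linarith [hI t, habs t (s i)])
  have hRb : ∀ s : Fin n → Z, |radSum (fun t i => h t (s i))| ≤ n * 1 := fun s =>
    abs_radSum_le fun t => by
      simpa using Finset.sum_le_card_nsmul Finset.univ (fun i => |h t (s i)|) 1
        fun i _ => habs _ _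
  have hFb : ∀ s, |F s| ≤ n * 2 + 2 * (n * 1) := fun s => by
    refine (abs_sub _ _).trans (add_le_add (hDb s) ?_)
    rw [abs_mul, abs_two]
    linarith [hRb s]
  have hDi : Integrable D μ := integrable_of_measurable_of_bound _ hDm hDb
  have hRi : Integrable (fun s : Fin n → Z => radSum (fun t i => h t (s i))) μ :=
    integrable_of_measurable_of_bound _ hRm hRb
  have hup : ∀ (s : Fin n → Z) i z t, ∑ j, |h t (Function.update s i z j) - h t (s j)| ≤ 1 := by
    intro s i z t
    rw [Finset.sum_eq_single i]
    · simp only [Function.update_self]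
      exact abs_le.2 ⟨by linarith [h0 t z, h1 t (s i)], by linarith [h0 t (s i), h1 t z]⟩
    · intro j _ hj
      rw [Function.update_of_ne hj]; simp
    · simp
  have hFc : ∀ s i z, |F (Function.update s i z) - F s| ≤ 3 := by
    intro s i z
    have e1 : |D (Function.update s i z) - D s| ≤ 1 := abs_iSup_sub_iSup_le fun t => by
      rw [zero_add, zero_add, ← Finset.sum_sub_distrib]
      refine (Finset.abs_sum_le_sum_abs _ _).trans ?_
      simpa only [sub_sub_sub_cancel_left, abs_sub_comm] using hup s i z t
    have e2 := abs_radSum_sub_radSum_le (a := fun t j => h t (Function.update s i z j))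
      (b := fun t j => h t (s j)) (hup s i z)
    have e3 := abs_le.1 e1
    have e4 := abs_le.1 e2
    simp only [hF]
    exact abs_le.2 ⟨by linarith [e3.1, e4.2], by linarith [e3.2, e4.1]⟩
  have hFE : ∫ s, F s ∂μ ≤ 0 := by
    rw [hF, integral_sub hDi (hRi.const_mul 2), sub_nonpos]
    refine (symmetrization P h hm habs fun _ => 0).trans (le_of_eq ?_)
    have : ∀ s : Fin n → Z, 2 * radSum (fun t i => h t (s i)) = (1 / 2) ^ n * ∑ ε : Fin n → ℤˣ,
        ⨆ t, (0 + ∑ i, ((ε i : ℤ) : ℝ) * (2 * h t (s i))) := fun s => by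
      rw [← radSum_const_mul _ (by norm_num)]
      simp only [radSum, zero_add]
    simp only [this]
    rw [integral_const_mul, integral_finsetSum]
    intro ε _
    refine integrable_of_measurable_of_bound _ (K := n * 2) (Measurable.iSup fun t =>
      (Finset.measurable_sum _ fun i _ => ((hms t i).const_mul 2).const_mul _).const_add _)
      fun s => abs_iSup_le fun t => ?_
    rw [zero_add]
    refine (abs_signs_sum_le ε _).trans ?_
    have : ∀ i ∈ Finset.univ, |2 * h t (s i)| ≤ 2 := fun i _ => by
      rw [abs_mul, abs_two]; linarith [habs t (s i)]
    simpa using Finset.sum_le_card_nsmul Finset.univ (fun i => |2 * h t (s i)|) 2 this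
  set l := Real.log (1 / δ) with hl
  have hl0 : 0 < l := Real.log_pos (by rw [lt_div_iff₀ hδ]; linarith)
  set w := √(l / (2 * n)) with hw
  have hw2 : w ^ 2 = l / (2 * n) := Real.sq_sqrt (by positivity)
  have hw0 : 0 < w := Real.sqrt_pos.2 (by positivity)
  -- `4w/3` minimizes the Chernoff exponent `-3nwλ + 9nλ²/8`, with minimum `-2nw² = -ln(1/δ)`.
  have hmc := integral_exp_le_of_bounded_differences P F hFm hFb hFc (4 / 3 * w)
  have hexpi : ∀ c : ℝ, Integrable (fun s => Real.exp (4 / 3 * w * (F s - c))) μ := fun c => by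
    refine integrable_of_measurable_of_bound _ (by fun_prop)
      (K := Real.exp (4 / 3 * w * (n * 2 + 2 * (n * 1) + |c|))) fun s => ?_
    rw [abs_of_pos (Real.exp_pos _), Real.exp_le_exp]
    have := (abs_le.1 (hFb s)).2
    have := neg_abs_le c
    gcongr
    linarith
  have hcher := measure_ge_le_exp_mul_mgf (μ := μ) (X := fun s => F s - ∫ s, F s ∂μ) (n * (3 * w))
    (by positivity : 0 ≤ 4 / 3 * w) (hexpi _)
  have hle : μ.real {s | (n : ℝ) * (3 * w) ≤ F s - ∫ s, F s ∂μ} ≤ δ := by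
    refine hcher.trans ?_
    calc _ ≤ Real.exp (-(4 / 3 * w) * (n * (3 * w))) *
          Real.exp (n * ((4 / 3 * w) ^ 2 * 3 ^ 2 / 8)) := by
          gcongr
          exact hmc
      _ = Real.exp (-l) := by
          rw [← Real.exp_add]
          congr 1
          have : (n : ℝ) * w ^ 2 = l / 2 := by rw [hw2]; field_simp
          linear_combination (-2) * this
      _ = δ := by
          rw [hl, ← Real.log_inv, one_div, inv_inv, Real.exp_log hδ]
  calc _ ≤ μ {s | (n : ℝ) * (3 * w) ≤ F s - ∫ s, F s ∂μ} := by
        refine measure_mono ?_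
        rintro s ⟨t, ht⟩
        simp only [Set.mem_ofPred_eq]
        have e1 := le_iSup_finite (fun t => 0 + ∑ i, (∫ z, h t z ∂P - h t (s i))) t
        have e2 : (0 : ℝ) + ∑ i : Fin n, (∫ z, h t z ∂P - h t (s i)) =
            n * ∫ z, h t z ∂P - ∑ i, h t (s i) := by
          rw [zero_add, Finset.sum_sub_distrib]; simp
        rw [e2] at e1
        have e3 := mul_lt_mul_of_pos_left ht hnR
        have e4 : (n : ℝ) * (1 / n * ∑ i, h t (s i) + 2 / n * radSum (fun t i => h t (s i)) + 3 * w)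
            = ∑ i, h t (s i) + 2 * radSum (fun t i => h t (s i)) + n * (3 * w) := by
          field_simp
        rw [e4] at e3
        have e5 : F s = D s - 2 * radSum (fun t i => h t (s i)) := rfl
        have e6 : n * ∫ z, h t z ∂P - ∑ i, h t (s i) ≤ D s := e1
        linarith
    _ = ENNReal.ofReal (μ.real {s | (n : ℝ) * (3 * w) ≤ F s - ∫ s, F s ∂μ}) :=
        (ofReal_measureReal (measure_ne_top _ _)).symm
    _ ≤ _ := ENNReal.ofReal_le_ofReal hle

end

/-! ### The ramp loss and the complexity of the composed classes -/

theorem ramp_eq {γ : ℝ} (hγ : 0 < γ) (z : ℝ) : ramp γ z = max 0 (min 1 (1 - z / γ)) := by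
  unfold ramp
  split_ifs with h1 h2
  · have : z / γ ≤ 0 := div_nonpos_of_nonpos_of_nonneg h1 hγ.le
    rw [min_eq_left (by linarith), max_eq_right zero_le_one]
  · have e1 : 0 < z / γ := div_pos (not_le.1 h1) hγ
    have e2 : z / γ < 1 := (div_lt_one hγ).2 h2
    rw [min_eq_right (by linarith), max_eq_right (by linarith)]
  · have : 1 ≤ z / γ := (one_le_div hγ).2 (not_lt.1 h2)
    rw [max_eq_left ((min_le_right _ _).trans (by linarith))]

theorem ramp_nonneg {γ : ℝ} (hγ : 0 < γ) (z : ℝ) : 0 ≤ ramp γ z := by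
  rw [ramp_eq hγ]; exact le_max_left _ _

theorem ramp_le_one {γ : ℝ} (hγ : 0 < γ) (z : ℝ) : ramp γ z ≤ 1 := by
  rw [ramp_eq hγ]; exact max_le zero_le_one (min_le_left _ _)

theorem abs_ramp_sub_le {γ : ℝ} (hγ : 0 < γ) (z w : ℝ) :
    |ramp γ z - ramp γ w| ≤ |1 / γ * z - 1 / γ * w| := by
  rw [ramp_eq hγ, ramp_eq hγ]
  refine (abs_max_sub_max_le_max (0 : ℝ) _ 0 _).trans ?_
  rw [sub_self, abs_zero, max_eq_right (abs_nonneg _)]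
  refine (abs_min_sub_min_le_max (1 : ℝ) _ 1 _).trans ?_
  rw [sub_self, abs_zero, max_eq_right (abs_nonneg _), sub_sub_sub_cancel_left]
  rw [abs_sub_comm]
  apply le_of_eq
  congr 1
  ring

section
variable {k : ℕ}

theorem nonempty_ne (hk : 2 ≤ k) (j : Fin k) : Nonempty {y' : Fin k // y' ≠ j} := by
  have : Nontrivial (Fin k) := Fin.nontrivial_iff_two_le.2 hk
  obtain ⟨y, hy⟩ := exists_ne j
  exact ⟨⟨y, hy⟩⟩

theorem rampLoss_nonneg {γ : ℝ} (hγ : 0 < γ) (v : Fin k → ℝ) (j : Fin k) : 0 ≤ rampLoss γ v j :=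
  ramp_nonneg hγ _

theorem rampLoss_le_one {γ : ℝ} (hγ : 0 < γ) (v : Fin k → ℝ) (j : Fin k) : rampLoss γ v j ≤ 1 :=
  ramp_le_one hγ _

theorem abs_rampLoss_sub_le {γ : ℝ} (hγ : 0 < γ) (hk : 2 ≤ k) (v w : Fin k → ℝ) (j : Fin k) :
    |rampLoss γ v j - rampLoss γ w j| ≤ ∑ i, |1 / γ * v i - 1 / γ * w i| := by
  have := nonempty_ne hk j
  have key : |(⨆ y' : {y' : Fin k // y' ≠ j}, v y') - ⨆ y' : {y' : Fin k // y' ≠ j}, w y'| ≤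
      ∑ i ∈ Finset.univ.erase j, |v i - w i| :=
    abs_iSup_sub_iSup_le fun t => Finset.single_le_sum (f := fun i => |v i - w i|)
      (fun i _ => abs_nonneg _) (Finset.mem_erase.2 ⟨t.2, Finset.mem_univ _⟩)
  have hs : ∑ i, |1 / γ * v i - 1 / γ * w i| = 1 / γ * ∑ i, |v i - w i| := by
    rw [Finset.mul_sum]
    refine Finset.sum_congr rfl fun i _ => ?_
    rw [← mul_sub, abs_mul, abs_of_pos (by positivity : 0 < 1 / γ)]
  rw [hs, ← Finset.add_sum_erase _ _ (Finset.mem_univ j)]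
  refine (abs_ramp_sub_le hγ _ _).trans ?_
  rw [← mul_sub, abs_mul, abs_of_pos (by positivity : 0 < 1 / γ)]
  gcongr
  rw [sub_sub_sub_comm]
  exact (abs_sub _ _).trans (by linarith)

theorem continuous_rampLoss {γ : ℝ} (hγ : 0 < γ) (hk : 2 ≤ k) (j : Fin k) :
    Continuous fun v : Fin k → ℝ => rampLoss γ v j := by
  rw [continuous_iff_continuousAt]
  intro w
  rw [ContinuousAt, tendsto_iff_dist_tendsto_zero]
  have hz : Tendsto (fun v : Fin k → ℝ => ∑ i, |1 / γ * v i - 1 / γ * w i|) (𝓝 w) (𝓝 0) := by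
    have : Continuous fun v : Fin k → ℝ => ∑ i, |1 / γ * v i - 1 / γ * w i| := by fun_prop
    simpa using this.tendsto w
  exact squeeze_zero (fun _ => dist_nonneg)
    (fun v => (Real.dist_eq _ _).trans_le (abs_rampLoss_sub_le hγ hk v w j)) hz

theorem rampLoss_eq_one_of_misclassifies {γ : ℝ} {v : Fin k → ℝ} {y : Fin k}
    (h : Misclassifies v y) : rampLoss γ v y = 1 := by
  obtain ⟨j, hj, hv⟩ := h
  have := le_iSup_finite (fun y' : {y' : Fin k // y' ≠ y} => v y') ⟨j, hj⟩
  simp only at this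
  rw [rampLoss, ramp, if_pos (by linarith)]

/-- `ℓ^∞` distance of the ramp outputs at the score vectors `v` and `w`. -/
noncomputable def rampSupDist (γ : ℝ) (v w : Fin k → ℝ) : ℝ :=
  ⨆ j, |rampLoss γ v j - rampLoss γ w j|

theorem abs_sub_le_rampSupDist (γ : ℝ) (v w : Fin k → ℝ) (j : Fin k) :
    |rampLoss γ v j - rampLoss γ w j| ≤ rampSupDist γ v w :=
  le_iSup_finite (fun j => |rampLoss γ v j - rampLoss γ w j|) j

theorem rampSupDist_le_rampDist (hk : 2 ≤ k) (γ : ℝ) (v w : Fin k → ℝ) :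
    rampSupDist γ v w ≤ rampDist γ v w := by
  have : Nonempty (Fin k) := ⟨⟨0, by omega⟩⟩
  exact ciSup_le fun j => Finset.single_le_sum (f := fun j => |rampLoss γ v j - rampLoss γ w j|)
    (fun i _ => abs_nonneg _) (Finset.mem_univ j)

theorem rampSupDist_nonneg (hk : 2 ≤ k) (γ : ℝ) (v w : Fin k → ℝ) : 0 ≤ rampSupDist γ v w :=
  (abs_nonneg _).trans (abs_sub_le_rampSupDist γ v w ⟨0, by omega⟩)

theorem rampSupDist_le_one {γ : ℝ} (hγ : 0 < γ) (hk : 2 ≤ k) (v w : Fin k → ℝ) :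
    rampSupDist γ v w ≤ 1 := by
  have : Nonempty (Fin k) := ⟨⟨0, by omega⟩⟩
  refine ciSup_le fun j => abs_le.2 ⟨?_, ?_⟩ <;>
  linarith [rampLoss_nonneg hγ v j, rampLoss_le_one hγ v j, rampLoss_nonneg hγ w j,
    rampLoss_le_one hγ w j]

theorem tendsto_rampSupDist {γ : ℝ} (hγ : 0 < γ) (hk : 2 ≤ k) {u v : ℕ → Fin k → ℝ}
    {a b : Fin k → ℝ} (hu : Tendsto u atTop (𝓝 a)) (hv : Tendsto v atTop (𝓝 b)) :
    Tendsto (fun j => rampSupDist γ (u j) (v j)) atTop (𝓝 (rampSupDist γ a b)) := by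
  have : Nonempty (Fin k) := ⟨⟨0, by omega⟩⟩
  have he : ∀ v w : Fin k → ℝ, rampSupDist γ v w =
      Finset.univ.sup' Finset.univ_nonempty fun j => |rampLoss γ v j - rampLoss γ w j| :=
    fun v w => by rw [Finset.sup'_univ_eq_ciSup]; rfl
  simp only [he]
  exact Tendsto.finset_sup'_nhds_apply _ fun j _ =>
    ((((continuous_rampLoss hγ hk j).tendsto a).comp hu).sub
      (((continuous_rampLoss hγ hk j).tendsto b).comp hv)).abs

variable {ι ι' : Type*} [Finite ι] [Nonempty ι] [Finite ι'] [Nonempty ι'] {n : ℕ}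

/-- The ramp is `1/γ`-Lipschitz in the margin. The score at the true label costs `A`, and the
maximum over the other labels is covered by `radSum_max_le`. -/
theorem radSum_rampLoss_le (hn : 0 < n) (hk : 2 ≤ k) {γ : ℝ} (hγ : 0 < γ)
    (v : ι → Fin n → Fin k → ℝ) (y : Fin n → Fin k) {A : ℝ}
    (hA : ∀ y : Fin n → Fin k, radSum (fun t i => v t i (y i)) ≤ A) :
    radSum (fun t i => rampLoss γ (v t i) (y i)) ≤
      1500001 * (1 + Real.log n) ^ 3 * (√k / γ) * A := by
  have hnR : (1 : ℝ) ≤ n := by exact_mod_cast hn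
  have hk1 : (1 : ℝ) ≤ √k := Real.one_le_sqrt.2 (by exact_mod_cast (by omega : 1 ≤ k))
  have hone : 1 ≤ (1 + Real.log n) ^ 3 := one_le_pow₀ (by linarith [Real.log_nonneg hnR])
  have hA0 : 0 ≤ A := (radSum_nonneg _).trans (hA y)
  set x : ι → Fin n → ℝ := fun t i => ⨆ y' : {y' : Fin k // y' ≠ y i}, v t i y' with hx
  have hcol : ∀ t i, ∃ c : {y' : Fin k // y' ≠ y i}, v t i c = x t i := fun t i => by
    have := nonempty_ne hk (y i)
    exact exists_eq_ciSup_of_finite (f := fun y' : {y' : Fin k // y' ≠ y i} => v t i y')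
  choose col hcol using hcol
  have h1 : radSum x ≤ 1500000 * (1 + Real.log n) ^ 3 * √k * A := by
    have := radSum_max_le hn (by omega) v (fun t i => col t i) (fun t t' i => by
      rw [hcol t' i]
      exact le_iSup_finite (fun y' : {y' : Fin k // y' ≠ y i} => v t' i y') (col t i)) hA
    simpa only [hcol] using this
  have h2 : radSum (fun t i => rampLoss γ (v t i) (y i)) ≤
      radSum (fun t i => 1 / γ * (v t i (y i) + -x t i)) :=
    radSum_le_of_abs_sub_le _ _ fun t t' i => by
      simp only [← sub_eq_add_neg]
      exact abs_ramp_sub_le hγ _ _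
  rw [radSum_const_mul _ (by positivity)] at h2
  have h3 := radSum_add_le (fun t i => v t i (y i)) fun t i => -x t i
  rw [radSum_neg] at h3
  calc _ ≤ _ := h2
    _ ≤ 1 / γ * (1 * 1 * A + 1500000 * (1 + Real.log n) ^ 3 * √k * A) := by
        gcongr
        exact h3.trans (add_le_add ((hA y).trans (by linarith)) h1)
    _ ≤ 1 / γ * ((1 + Real.log n) ^ 3 * √k * A + 1500000 * (1 + Real.log n) ^ 3 * √k * A) := by
        gcongr
    _ = _ := by ring

/-- Contraction with the `2k` scores of `f` and `g` as features. A labelling by features selects in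
each row a score of `f` or one of `g`; zeroing the other rows splits it into two single-class sums.
-/
theorem radSum_rampSupDist_le (hk : 2 ≤ k) {γ : ℝ} (hγ : 0 < γ)
    (f : ι → Fin n → Fin k → ℝ) (g : ι' → Fin n → Fin k → ℝ) {A B : ℝ}
    (hA : ∀ y : Fin n → Fin k, radSum (fun t i => f t i (y i)) ≤ A)
    (hB : ∀ y : Fin n → Fin k, radSum (fun t i => g t i (y i)) ≤ B) :
    radSum (fun (p : ι × ι') i => rampSupDist γ (f p.1 i) (g p.2 i)) ≤
      2 * k / γ * (A + B) := by
  have : Nonempty (Fin k) := ⟨⟨0, by omega⟩⟩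
  have hγ' : 0 < 1 / γ := by positivity
  have h := radSum_le_card_mul (κ := Fin k ⊕ Fin k)
    (fun (p : ι × ι') i => rampSupDist γ (f p.1 i) (g p.2 i))
    (fun p i => Sum.elim (fun j => 1 / γ * f p.1 i j) fun j => 1 / γ * g p.2 i j)
    (fun p q i => by
      rw [Fintype.sum_sum_type]
      simp only [Sum.elim_inl, Sum.elim_inr]
      refine abs_iSup_sub_iSup_le fun j => (abs_abs_sub_abs_le_abs_sub _ _).trans ?_
      rw [sub_sub_sub_comm]
      exact (abs_sub _ _).trans (add_le_add (abs_rampLoss_sub_le hγ hk _ _ _)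
        (abs_rampLoss_sub_le hγ hk _ _ _)))
    (A := 1 / γ * (A + B)) (fun y => by
      classical
      set j₀ : Fin k := ⟨0, by omega⟩
      set yF : Fin n → Fin k := fun i => Sum.elim id (fun _ => j₀) (y i) with hyF
      set yG : Fin n → Fin k := fun i => Sum.elim (fun _ => j₀) id (y i) with hyG
      have e1 := radSum_add_le (fun (p : ι × ι') i => if (y i).isLeft then 1 / γ * f p.1 i (yF i) else 0)
        (fun (p : ι × ι') i => if (y i).isLeft then 0 else 1 / γ * g p.2 i (yG i))
      have e2 : radSum (fun (p : ι × ι') i => if (y i).isLeft then 1 / γ * f p.1 i (yF i) else 0) ≤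
          1 / γ * A := by
        refine (radSum_le_of_abs_sub_le _ (fun (p : ι × ι') i => 1 / γ * f p.1 i (yF i))
          fun p q i => ?_).trans ?_
        · split_ifs <;> simp
        · rw [radSum_const_mul _ hγ'.le]
          gcongr
          exact (radSum_comp_le (fun t i => f t i (yF i)) (Prod.fst : ι × ι' → ι)).trans (hA _)
      have e3 : radSum (fun (p : ι × ι') i => if (y i).isLeft then 0 else 1 / γ * g p.2 i (yG i)) ≤
          1 / γ * B := by
        refine (radSum_le_of_abs_sub_le _ (fun (p : ι × ι') i => 1 / γ * g p.2 i (yG i))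
          fun p q i => ?_).trans ?_
        · split_ifs <;> simp
        · rw [radSum_const_mul _ hγ'.le]
          gcongr
          exact (radSum_comp_le (fun t i => g t i (yG i)) (Prod.snd : ι × ι' → ι')).trans (hB _)
      have e4 : (fun (p : ι × ι') i => Sum.elim (fun j => 1 / γ * f p.1 i j)
          (fun j => 1 / γ * g p.2 i j) (y i)) = fun p i =>
          (if (y i).isLeft then 1 / γ * f p.1 i (yF i) else 0) +
            if (y i).isLeft then 0 else 1 / γ * g p.2 i (yG i) := by
        ext p i
        simp only [hyF, hyG]
        rcases y i with j | j <;> simp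
      rw [e4]
      linarith)
  refine h.trans (le_of_eq ?_)
  simp only [Fintype.card_sum, Fintype.card_fin]
  push_cast
  ring

end

/-! ### From finite subfamilies to pointwise measurable classes -/

theorem EReal.coe_finsetSum {κ : Type*} (s : Finset κ) (f : κ → ℝ) :
    ((∑ i ∈ s, f i : ℝ) : EReal) = ∑ i ∈ s, (f i : EReal) := by
  classical
  induction s using Finset.induction_on with
  | empty => simp
  | insert a s ha ih => rw [Finset.sum_insert ha, Finset.sum_insert ha, EReal.coe_add, ih]

theorem coe_radSum_le_rademacherMulti {X ι : Type*} [Finite ι] [Nonempty ι] {n k : ℕ}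
    {F : Set (X → Fin k → ℝ)} (φ : ι → X → Fin k → ℝ) (hφ : ∀ t, φ t ∈ F) (x : Fin n → X)
    (y : Fin n → Fin k) :
    ((1 / (n : ℝ) * radSum (fun t i => φ t (x i) (y i)) : ℝ) : EReal) ≤ rademacherMulti F x := by
  refine le_trans ?_ (le_iSup _ y)
  rw [← radSum_const_mul _ (by positivity), radSum, rademacher, EReal.coe_mul,
    EReal.coe_finsetSum]
  refine mul_le_mul_of_nonneg_left (Finset.sum_le_sum fun ε _ => ?_)
    (EReal.coe_nonneg.2 (by positivity))
  obtain ⟨t, ht⟩ := exists_eq_ciSup_of_finite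
    (f := fun t => ∑ i, ((ε i : ℤ) : ℝ) * (1 / (n : ℝ) * φ t (x i) (y i)))
  rw [← ht]
  refine le_iSup₂_of_le (fun p : X × Fin k => φ t p.1 p.2) ⟨φ t, hφ t, rfl⟩ (le_of_eq ?_)
  rw [Finset.mul_sum]
  congr 1
  exact Finset.sum_congr rfl fun i _ => by ring

theorem radSum_le_of_rademacherMulti_le {X ι : Type*} [Finite ι] [Nonempty ι] {n k : ℕ} (hn : 0 < n)
    {F : Set (X → Fin k → ℝ)} (φ : ι → X → Fin k → ℝ) (hφ : ∀ t, φ t ∈ F) (x : Fin n → X) {r : ℝ}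
    (hr : rademacherMulti F x = r) (y : Fin n → Fin k) :
    radSum (fun t i => φ t (x i) (y i)) ≤ n * r := by
  have h := coe_radSum_le_rademacherMulti φ hφ x y
  rw [hr, EReal.coe_le_coe_iff] at h
  have hnR : (0 : ℝ) < n := by exact_mod_cast hn
  rwa [one_div, inv_mul_le_iff₀ hnR] at h

theorem rademacherMulti_nonneg {X : Type*} {n k : ℕ} (hk : 0 < k) {F : Set (X → Fin k → ℝ)}
    (hF : F.Nonempty) (x : Fin n → X) : 0 ≤ rademacherMulti F x := by
  obtain ⟨f, hf⟩ := hF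
  have h := coe_radSum_le_rademacherMulti (fun _ : Unit => f) (fun _ => hf) x (fun _ => ⟨0, hk⟩)
  rwa [radSum_eq_zero_of_subsingleton, mul_zero] at h

theorem measurableSet_iUnion_iInter_ge {Y : Type*} [MeasurableSpace Y] {b : ℕ → Set Y}
    (hb : ∀ N, MeasurableSet (b N)) : MeasurableSet (⋃ N, ⋂ N' ≥ N, b N') :=
  MeasurableSet.iUnion fun _ => MeasurableSet.iInter fun N' => MeasurableSet.iInter fun _ => hb N'

theorem measure_iUnion_iInter_ge_le {Y : Type*} [MeasurableSpace Y] (Q : Measure Y) {b : ℕ → Set Y}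
    {c : ENNReal} (hb : ∀ N, Q (b N) ≤ c) : Q (⋃ N, ⋂ N' ≥ N, b N') ≤ c := by
  rw [Monotone.measure_iUnion]
  · exact iSup_le fun N => (measure_mono (Set.iInter₂_subset N le_rfl)).trans (hb N)
  · intro N N' h
    exact Set.iInter₂_mono' fun i hi => ⟨i, le_trans h hi, subset_rfl⟩

section
variable {X : Type*} [MeasurableSpace X]

theorem measure_le_densityRatioSup_smul (μ ν : Measure X) [IsFiniteMeasure μ] [IsFiniteMeasure ν]
    (h : densityRatioSup μ ν ≠ ⊤) : μ ≤ densityRatioSup μ ν • ν := by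
  unfold densityRatioSup at h ⊢
  split_ifs at h ⊢ with hac
  · conv_lhs => rw [← Measure.withDensity_rnDeriv_eq μ ν hac]
    rw [← withDensity_const]
    exact withDensity_mono (ENNReal.ae_le_essSup _)
  · exact absurd rfl h

/-- Needed because `0 * ⊤ = 0` in `EReal`: an infinite complexity must make the whole bound
infinite. -/
theorem densityRatioSup_ne_zero (μ ν : Measure X) [IsProbabilityMeasure μ] [IsFiniteMeasure ν] :
    densityRatioSup μ ν ≠ 0 := by
  intro h
  have h1 := measure_le_densityRatioSup_smul μ ν (by rw [h]; exact ENNReal.zero_ne_top) Set.univ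
  rw [h, zero_smul] at h1
  simp at h1

theorem integral_le_densityRatioSup_mul (μ ν : Measure X) [IsFiniteMeasure μ] [IsFiniteMeasure ν]
    (h : densityRatioSup μ ν ≠ ⊤) {f : X → ℝ} (hf : Measurable f) (h0 : ∀ x, 0 ≤ f x)
    (h1 : ∀ x, f x ≤ 1) : ∫ x, f x ∂μ ≤ (densityRatioSup μ ν).toReal * ∫ x, f x ∂ν := by
  have hi : Integrable f ν := integrable_of_measurable_of_bound ν hf (K := 1) fun x =>
    abs_le.2 ⟨by linarith [h0 x], h1 x⟩
  refine (integral_mono_measure (measure_le_densityRatioSup_smul μ ν h) (ae_of_all _ h0)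
    (hi.smul_measure h)).trans (le_of_eq ?_)
  rw [integral_smul_measure, smul_eq_mul]

theorem tendsto_integral_of_abs_le_one (μ : Measure X) [IsFiniteMeasure μ] {u : ℕ → X → ℝ}
    {f : X → ℝ} (hu : ∀ j, Measurable (u j)) (h1 : ∀ j x, |u j x| ≤ 1)
    (h : ∀ x, Tendsto (fun j => u j x) atTop (𝓝 (f x))) :
    Tendsto (fun j => ∫ x, u j x ∂μ) atTop (𝓝 (∫ x, f x ∂μ)) :=
  tendsto_integral_of_dominated_convergence (fun _ => 1)
    (fun j => (hu j).aestronglyMeasurable) (integrable_const _)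
    (fun j => ae_of_all _ fun x => (Real.norm_eq_abs _).trans_le (h1 j x)) (ae_of_all _ h)

variable {k n m : ℕ}

theorem measurable_rampLoss_prod {γ : ℝ} (hγ : 0 < γ) (hk : 2 ≤ k) {g : X → Fin k → ℝ}
    (hg : Measurable g) : Measurable fun q : X × Fin k => rampLoss γ (g q.1) q.2 :=
  measurable_from_prod_countable_left fun y => (continuous_rampLoss hγ hk y).measurable.comp hg

theorem measurable_rampSupDist {γ : ℝ} (hγ : 0 < γ) (hk : 2 ≤ k) {f g : X → Fin k → ℝ}
    (hf : Measurable f) (hg : Measurable g) : Measurable fun x => rampSupDist γ (f x) (g x) :=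
  Measurable.iSup fun j => continuous_abs.measurable.comp
    (((continuous_rampLoss hγ hk j).measurable.comp hf).sub
      ((continuous_rampLoss hγ hk j).measurable.comp hg))

/-- Outside an event of small probability, the true ramp risk is controlled by the empirical one,
for every member of the closure of a sequence of predictors. -/
theorem exists_bad_event_rampLoss (hn : 0 < n) (hk : 2 ≤ k) (μ : Measure (X × Fin k))
    [IsProbabilityMeasure μ] {G : Set (X → Fin k → ℝ)} (g₀ : ℕ → X → Fin k → ℝ)
    (hg₀ : ∀ j, g₀ j ∈ G) (hm : ∀ j, Measurable (g₀ j))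
    (hG : ∀ g ∈ G, ∃ u : ℕ → X → Fin k → ℝ, (∀ j, u j ∈ Set.range g₀) ∧
      ∀ x, Tendsto (fun j => u j x) atTop (𝓝 (g x)))
    {γ δ : ℝ} (hγ : 0 < γ) (hδ : 0 < δ) (hδ' : δ < 1) :
    ∃ B : Set (Fin n → X × Fin k), MeasurableSet B ∧
      (Measure.pi fun _ : Fin n => μ) B ≤ ENNReal.ofReal δ ∧
      ∀ s ∉ B, ∀ r : ℝ, rademacherMulti G (fun i => (s i).1) = r → ∀ g ∈ G,
        ∫ q, rampLoss γ (g q.1) q.2 ∂μ ≤ 1 / (n : ℝ) * ∑ i, rampLoss γ (g (s i).1) (s i).2 +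
          3000002 * (1 + Real.log n) ^ 3 * (√k / γ) * r + 3 * √(Real.log (1 / δ) / (2 * n)) := by
  have hnR : (0 : ℝ) < n := by exact_mod_cast hn
  set h : ℕ → X × Fin k → ℝ := fun j q => rampLoss γ (g₀ j q.1) q.2 with hh
  have hhm : ∀ j, Measurable (h j) := fun j => measurable_rampLoss_prod hγ hk (hm j)
  have hsm : ∀ j i, Measurable fun s : Fin n → X × Fin k => h j (s i) := fun j i =>
    (hhm j).comp (measurable_pi_apply i)
  -- Failure of the bound for the first `N + 1` predictors. These events need not be nested, because
  -- the complexity term also grows with `N`; the exceptional set is therefore their lower limit,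
  -- outside which the bound holds for arbitrarily large `N`.
  set b : ℕ → Set (Fin n → X × Fin k) := fun N => {s | ∃ t : Fin (N + 1),
    1 / (n : ℝ) * ∑ i, h t (s i) + 2 / n * radSum (fun (t : Fin (N + 1)) i => h t (s i)) +
      3 * √(Real.log (1 / δ) / (2 * n)) < ∫ z, h t z ∂μ} with hb
  have hbm : ∀ N, MeasurableSet (b N) := fun N => by
    have : b N = ⋃ t : Fin (N + 1), {s | 1 / (n : ℝ) * ∑ i, h t (s i) +
      2 / n * radSum (fun (t : Fin (N + 1)) i => h t (s i)) +
      3 * √(Real.log (1 / δ) / (2 * n)) < ∫ z, h t z ∂μ} := by ext s; simp [hb]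
    rw [this]
    refine MeasurableSet.iUnion fun t => measurableSet_lt ?_ measurable_const
    exact (((Finset.measurable_sum _ fun i _ => hsm t i).const_mul _).add
      ((measurable_radSum (a := fun (s : Fin n → X × Fin k) (t : Fin (N + 1)) i => h t (s i))
        fun t i => hsm t i).const_mul _)).add_const _
  refine ⟨⋃ N, ⋂ N' ≥ N, b N', measurableSet_iUnion_iInter_ge hbm,
    measure_iUnion_iInter_ge_le _ fun N => uniform_deviation μ (fun t : Fin (N + 1) => h t)
      (fun t => hhm t) (fun t z => rampLoss_nonneg hγ _ _) (fun t z => rampLoss_le_one hγ _ _)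
      hn hδ hδ', ?_⟩
  intro s hs r hr
  have hbase : ∀ j, ∫ q, rampLoss γ (g₀ j q.1) q.2 ∂μ ≤
      1 / (n : ℝ) * ∑ i, rampLoss γ (g₀ j (s i).1) (s i).2 +
      3000002 * (1 + Real.log n) ^ 3 * (√k / γ) * r + 3 * √(Real.log (1 / δ) / (2 * n)) := by
    intro j
    simp only [Set.mem_iUnion, Set.mem_iInter, not_exists, not_forall] at hs
    obtain ⟨N, hN, hsN⟩ := hs j
    simp only [hb, Set.mem_ofPred_eq, not_exists, not_lt] at hsN
    have h1 := hsN ⟨j, by omega⟩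
    have h2 := radSum_rampLoss_le hn hk hγ (fun (t : Fin (N + 1)) i => g₀ t (s i).1)
      (fun i => (s i).2) (radSum_le_of_rademacherMulti_le hn (fun t : Fin (N + 1) => g₀ t)
        (fun t => hg₀ t) (fun i => (s i).1) hr)
    have h3 := mul_le_mul_of_nonneg_left h2 (by positivity : (0 : ℝ) ≤ 2 / n)
    have h4 : 2 / (n : ℝ) * (1500001 * (1 + Real.log n) ^ 3 * (√k / γ) * (n * r)) =
        3000002 * (1 + Real.log n) ^ 3 * (√k / γ) * r := by field_simp; ring
    rw [h4] at h3
    simp only [hh] at h1 h3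
    linarith
  intro g hg
  obtain ⟨u, hu, hlim⟩ := hG g hg
  choose c hc using hu
  -- The complexity of the full class does not depend on the predictor, so both sides pass to the
  -- limit along the approximating sequence.
  refine le_of_tendsto_of_tendsto' (tendsto_integral_of_abs_le_one μ
    (u := fun j q => rampLoss γ (u j q.1) q.2) (fun j => by rw [← hc j]; exact hhm (c j))
    (fun j q => ?_) fun q => ((continuous_rampLoss hγ hk q.2).tendsto _).comp (hlim q.1))
    (((tendsto_finsetSum _ fun i _ =>
      ((continuous_rampLoss hγ hk (s i).2).tendsto _).comp (hlim (s i).1)).const_mul _).add_const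
      _ |>.add_const _) fun j => ?_
  · exact abs_le.2 ⟨by linarith [rampLoss_nonneg hγ (u j q.1) q.2], rampLoss_le_one hγ _ _⟩
  · simp only [Function.comp_apply, ← hc j]
    exact hbase (c j)

/-- The same for the distance between the ramp outputs of two predictors, on the augmented
sample. -/
theorem exists_bad_event_rampSupDist (hmpos : 0 < m) (hk : 2 ≤ k) (μ : Measure (X × Fin k))
    [IsProbabilityMeasure μ] (ν : Kernel (Fin n → X) X) [IsMarkovKernel ν]
    {F G : Set (X → Fin k → ℝ)} (f₀ g₀ : ℕ → X → Fin k → ℝ)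
    (hf₀ : ∀ j, f₀ j ∈ F) (hg₀ : ∀ j, g₀ j ∈ G) (hfm : ∀ j, Measurable (f₀ j))
    (hgm : ∀ j, Measurable (g₀ j))
    (hF : ∀ f ∈ F, ∃ u : ℕ → X → Fin k → ℝ, (∀ j, u j ∈ Set.range f₀) ∧
      ∀ x, Tendsto (fun j => u j x) atTop (𝓝 (f x)))
    (hG : ∀ g ∈ G, ∃ u : ℕ → X → Fin k → ℝ, (∀ j, u j ∈ Set.range g₀) ∧
      ∀ x, Tendsto (fun j => u j x) atTop (𝓝 (g x)))
    {γ δ : ℝ} (hγ : 0 < γ) (hδ : 0 < δ) (hδ' : δ < 1) :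
    ∃ B : Set ((Fin n → X × Fin k) × (Fin m → X)), MeasurableSet B ∧
      sampleLaw μ ν m B ≤ ENNReal.ofReal δ ∧
      ∀ s z, (s, z) ∉ B → ∀ r r' : ℝ, rademacherMulti F z = r → rademacherMulti G z = r' →
        ∀ f ∈ F, ∀ g ∈ G,
        ∫ x, rampSupDist γ (f x) (g x) ∂(ν fun i => (s i).1) ≤
          1 / (m : ℝ) * ∑ i, rampSupDist γ (f (z i)) (g (z i)) +
          4 * k / γ * (r + r') + 3 * √(Real.log (1 / δ) / (2 * m)) := by
  have hmR : (0 : ℝ) < m := by exact_mod_cast hmpos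
  set h : ℕ × ℕ → X → ℝ := fun j x => rampSupDist γ (f₀ j.1 x) (g₀ j.2 x) with hh
  have hhm : ∀ j, Measurable (h j) := fun j => measurable_rampSupDist hγ hk (hfm _) (hgm _)
  have hsm : ∀ j i, Measurable fun p : (Fin n → X × Fin k) × (Fin m → X) => h j (p.2 i) :=
    fun j i => (hhm j).comp ((measurable_pi_apply i).comp measurable_snd)
  have hsx : Measurable fun p : (Fin n → X × Fin k) × (Fin m → X) => fun i => (p.1 i).1 :=
    measurable_pi_lambda _ fun i =>
      measurable_fst.comp ((measurable_pi_apply i).comp measurable_fst)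
  set b : ℕ → Set ((Fin n → X × Fin k) × (Fin m → X)) := fun N =>
    {p | ∃ t : Fin (N + 1) × Fin (N + 1), 1 / (m : ℝ) * ∑ i, h (t.1, t.2) (p.2 i) +
      2 / m * radSum (fun (t : Fin (N + 1) × Fin (N + 1)) i => h (t.1, t.2) (p.2 i)) +
      3 * √(Real.log (1 / δ) / (2 * m)) < ∫ x, h (t.1, t.2) x ∂(ν fun i => (p.1 i).1)} with hb
  have hbm : ∀ N, MeasurableSet (b N) := fun N => by
    have : b N = ⋃ t : Fin (N + 1) × Fin (N + 1), {p | 1 / (m : ℝ) * ∑ i, h (t.1, t.2) (p.2 i) +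
      2 / m * radSum (fun (t : Fin (N + 1) × Fin (N + 1)) i => h (t.1, t.2) (p.2 i)) +
      3 * √(Real.log (1 / δ) / (2 * m)) < ∫ x, h (t.1, t.2) x ∂(ν fun i => (p.1 i).1)} := by
      ext p; simp [hb]
    rw [this]
    refine MeasurableSet.iUnion fun t => measurableSet_lt ?_ ?_
    · exact (((Finset.measurable_sum _ fun i _ => hsm _ i).const_mul _).add
        ((measurable_radSum (a := fun (p : (Fin n → X × Fin k) × (Fin m → X))
          (t : Fin (N + 1) × Fin (N + 1)) i => h (t.1, t.2) (p.2 i)) fun t i => hsm _ i).const_mul _)).add_const _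
    · exact ((hhm (t.1, t.2)).stronglyMeasurable.integral_kernel (κ := ν)).measurable.comp hsx
  refine ⟨⋃ N, ⋂ N' ≥ N, b N', measurableSet_iUnion_iInter_ge hbm,
    measure_iUnion_iInter_ge_le _ fun N => ?_, ?_⟩
  · rw [sampleLaw, Measure.compProd_apply (hbm N)]
    -- Given the labelled sample, the distribution of the `z_i` is a fixed product measure; the
    -- conditional bound `δ` is then integrated.
    calc _ ≤ ∫⁻ _s, ENNReal.ofReal δ ∂(Measure.pi fun _ : Fin n => μ) :=
          lintegral_mono fun s => uniform_deviation (ν fun i => (s i).1)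
            (fun t : Fin (N + 1) × Fin (N + 1) => h (t.1, t.2)) (fun t => hhm _)
            (fun t z => rampSupDist_nonneg hk γ _ _) (fun t z => rampSupDist_le_one hγ hk _ _)
            hmpos hδ hδ'
      _ = _ := by simp
  intro s z hs r r' hr hr'
  have hbase : ∀ j j', ∫ x, rampSupDist γ (f₀ j x) (g₀ j' x) ∂(ν fun i => (s i).1) ≤
      1 / (m : ℝ) * ∑ i, rampSupDist γ (f₀ j (z i)) (g₀ j' (z i)) +
      4 * k / γ * (r + r') + 3 * √(Real.log (1 / δ) / (2 * m)) := by
    intro j j'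
    simp only [Set.mem_iUnion, Set.mem_iInter, not_exists, not_forall] at hs
    obtain ⟨N, hN, hsN⟩ := hs (max j j')
    have hj : j ≤ N := (le_max_left _ _).trans hN
    have hj' : j' ≤ N := (le_max_right _ _).trans hN
    simp only [hb, Set.mem_ofPred_eq, not_exists, not_lt] at hsN
    have h1 := hsN (⟨j, by omega⟩, ⟨j', by omega⟩)
    have h2 := radSum_rampSupDist_le hk hγ (fun (t : Fin (N + 1)) i => f₀ t (z i))
      (fun (t : Fin (N + 1)) i => g₀ t (z i))
      (radSum_le_of_rademacherMulti_le hmpos (fun t : Fin (N + 1) => f₀ t) (fun t => hf₀ t) z hr)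
      (radSum_le_of_rademacherMulti_le hmpos (fun t : Fin (N + 1) => g₀ t) (fun t => hg₀ t) z hr')
    have h3 := mul_le_mul_of_nonneg_left h2 (by positivity : (0 : ℝ) ≤ 2 / m)
    have h4 : 2 / (m : ℝ) * (2 * k / γ * (m * r + m * r')) = 4 * k / γ * (r + r') := by
      field_simp; ring
    rw [h4] at h3
    simp only [hh] at h1 h3
    linarith
  intro f hf g hg
  obtain ⟨u, hu, hulim⟩ := hF f hf
  obtain ⟨v, hv, hvlim⟩ := hG g hg
  choose c hc using hu
  choose d hd using hv
  have hlim : ∀ x, Tendsto (fun j => rampSupDist γ (u j x) (v j x)) atTop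
      (𝓝 (rampSupDist γ (f x) (g x))) := fun x =>
    tendsto_rampSupDist hγ hk (hulim x) (hvlim x)
  refine le_of_tendsto_of_tendsto' (tendsto_integral_of_abs_le_one _ (fun j => ?_)
    (fun j x => ?_) hlim)
    (((tendsto_finsetSum _ fun i _ => hlim (z i)).const_mul _).add_const _ |>.add_const _)
    fun j => ?_
  · rw [← hc j, ← hd j]; exact hhm (c j, d j)
  · exact abs_le.2 ⟨by linarith [rampSupDist_nonneg hk γ (u j x) (v j x)],
      rampSupDist_le_one hγ hk _ _⟩
  · rw [← hc j, ← hd j]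
    exact hbase (c j) (d j)

/-- The sup-norm distance bounds the change of loss at every label, so the second term no longer
involves `y` and depends only on the marginal. -/
theorem measureReal_misclassifies_le (hk : 2 ≤ k) (μ : Measure (X × Fin k))
    [IsProbabilityMeasure μ] {γ : ℝ} (hγ : 0 < γ) {f g : X → Fin k → ℝ} (hf : Measurable f)
    (hg : Measurable g) :
    μ.real {q | Misclassifies (f q.1) q.2} ≤ ∫ q, rampLoss γ (g q.1) q.2 ∂μ +
      ∫ x, rampSupDist γ (f x) (g x) ∂(μ.map Prod.fst) := by
  have hi : ∀ {f : X → Fin k → ℝ}, Measurable f →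
      Integrable (fun q : X × Fin k => rampLoss γ (f q.1) q.2) μ := fun {f} hf =>
    integrable_of_measurable_of_bound μ (measurable_rampLoss_prod hγ hk hf) (K := 1) fun q =>
      abs_le.2 ⟨by linarith [rampLoss_nonneg hγ (f q.1) q.2], rampLoss_le_one hγ _ _⟩
  have hd := measurable_rampSupDist hγ hk hf hg
  have hdi : Integrable (fun q : X × Fin k => rampSupDist γ (f q.1) (g q.1)) μ :=
    integrable_of_measurable_of_bound μ (hd.comp measurable_fst) (K := 1) fun q =>
      abs_le.2 ⟨by linarith [rampSupDist_nonneg hk γ (f q.1) (g q.1)], rampSupDist_le_one hγ hk _ _⟩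
  have h1 := mul_meas_ge_le_integral_of_nonneg
    (ae_of_all μ fun q : X × Fin k => rampLoss_nonneg hγ (f q.1) q.2) (hi hf) 1
  rw [one_mul] at h1
  rw [integral_map measurable_fst.aemeasurable hd.aestronglyMeasurable, ← integral_add (hi hg) hdi]
  refine (measureReal_mono fun q hq => ?_).trans (h1.trans (integral_mono (hi hf) ((hi hg).add hdi)
    fun q => ?_))
  · exact (rampLoss_eq_one_of_misclassifies hq).ge
  · have := (abs_le.1 (abs_sub_le_rampSupDist γ (f q.1) (g q.1) q.2)).2
    linarith

end

/-! ### Combination of the estimates -/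

theorem EReal.add_eq_top_of_left {a b : EReal} (ha : a = ⊤) (hb : 0 ≤ b) : a + b = ⊤ := by
  rw [ha]
  exact EReal.top_add_of_ne_bot (by rintro rfl; simp at hb)

theorem EReal.add_eq_top_of_right {a b : EReal} (ha : 0 ≤ a) (hb : b = ⊤) : a + b = ⊤ := by
  rw [add_comm]; exact EReal.add_eq_top_of_left hb ha

theorem EReal.exists_coe_of_nonneg {a : EReal} (h0 : 0 ≤ a) (h : a ≠ ⊤) : ∃ r : ℝ, a = r := by
  lift a to ℝ using ⟨h, by rintro rfl; simp at h0⟩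
  exact ⟨a, rfl⟩

theorem mainTheorem7 :
    ∃ (C : ℝ) (p : ℕ), 0 < C ∧
      ∀ {X : Type*} [MeasurableSpace X] (n m k : ℕ) (_hn : 0 < n) (_hm : 0 < m) (_hk : 2 ≤ k)
        (μ : Measure (X × Fin k)) [IsProbabilityMeasure μ]
        (ν : Kernel (Fin n → X) X) [IsMarkovKernel ν]
        (F G : Set (X → Fin k → ℝ)) (_hF : PointwiseMeasurable F) (_hG : PointwiseMeasurable G)
        (γ δ : ℝ) (_hγ : 0 < γ) (_hδ : 0 < δ) (_hδ' : δ < 1),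
        ∃ E : Set ((Fin n → X × Fin k) × (Fin m → X)), MeasurableSet E ∧
          ENNReal.ofReal (1 - 2 * δ) ≤ sampleLaw μ ν m E ∧
          ∀ s z, (s, z) ∈ E → ∀ f ∈ F, ∀ g ∈ G,
            ((μ.real {q | Misclassifies (f q.1) q.2} : ℝ) : EReal) ≤
              (densityRatioSup (μ.map Prod.fst) (ν fun i => (s i).1) : EReal) *
                  ((1 / (m : ℝ) * ∑ i, rampDist γ (f (z i)) (g (z i)) : ℝ) : EReal)
                + ((1 / (n : ℝ) * ∑ i, rampLoss γ (g (s i).1) (s i).2 : ℝ) : EReal)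
                + (((C * (1 + Real.log m) ^ p * ((k : ℝ) ^ (3 / 2 : ℝ) / γ) : ℝ) : EReal) *
                      (densityRatioSup (μ.map Prod.fst) (ν fun i => (s i).1) : EReal) *
                      (rademacherMulti F z + rademacherMulti G z)
                  + ((C * (1 + Real.log n) ^ p * (√(k : ℝ) / γ) : ℝ) : EReal) *
                      rademacherMulti G (fun i => (s i).1))
                + ((3 * √(Real.log (1 / δ) / (2 * n)) : ℝ) : EReal) *
                    (1 + (densityRatioSup (μ.map Prod.fst) (ν fun i => (s i).1) : EReal) *
                      ((√((n : ℝ) / m) : ℝ) : EReal)) := by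
  -- `3000002` is twice the constant of `radSum_rampLoss_le`; the factor two comes from
  -- symmetrization.
  refine ⟨3000002, 3, by norm_num, ?_⟩
  intro X _ n m k hn hm hk μ _ ν _ F G hF hG γ δ hγ hδ hδ'
  have hprob : IsProbabilityMeasure (sampleLaw μ ν m) := by unfold sampleLaw; infer_instance
  -- For an empty class the complexity is `⊥` rather than nonnegative, but the claim is then
  -- vacuous.
  rcases F.eq_empty_or_nonempty with rfl | hFne
  · refine ⟨Set.univ, MeasurableSet.univ, ?_, by simp⟩
    rw [measure_univ, ← ENNReal.ofReal_one]
    exact ENNReal.ofReal_le_ofReal (by linarith)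
  rcases G.eq_empty_or_nonempty with rfl | hGne
  · refine ⟨Set.univ, MeasurableSet.univ, ?_, by simp⟩
    rw [measure_univ, ← ENNReal.ofReal_one]
    exact ENNReal.ofReal_le_ofReal (by linarith)
  obtain ⟨hFm, F₀, hF₀, hF₀c, hFlim⟩ := hF
  obtain ⟨hGm, G₀, hG₀, hG₀c, hGlim⟩ := hG
  have hF₀ne : F₀.Nonempty := by
    obtain ⟨f, hf⟩ := hFne
    obtain ⟨u, hu, -⟩ := hFlim f hf
    exact ⟨_, hu 0⟩
  have hG₀ne : G₀.Nonempty := by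
    obtain ⟨g, hg⟩ := hGne
    obtain ⟨u, hu, -⟩ := hGlim g hg
    exact ⟨_, hu 0⟩
  obtain ⟨f₀, rfl⟩ := hF₀c.exists_eq_range hF₀ne
  obtain ⟨g₀, rfl⟩ := hG₀c.exists_eq_range hG₀ne
  have hf₀ : ∀ j, f₀ j ∈ F := fun j => hF₀ ⟨j, rfl⟩
  have hg₀ : ∀ j, g₀ j ∈ G := fun j => hG₀ ⟨j, rfl⟩
  obtain ⟨B₁, hB₁m, hB₁, hB₁'⟩ := exists_bad_event_rampLoss hn hk μ g₀ hg₀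
    (fun j => hGm _ (hg₀ j)) hGlim hγ hδ hδ'
  obtain ⟨B₂, hB₂m, hB₂, hB₂'⟩ := exists_bad_event_rampSupDist hm hk μ ν f₀ g₀ hf₀ hg₀
    (fun j => hFm _ (hf₀ j)) (fun j => hGm _ (hg₀ j)) hFlim hGlim hγ hδ hδ'
  have hB₁f : sampleLaw μ ν m (Prod.fst ⁻¹' B₁) ≤ ENNReal.ofReal δ := by
    rw [← Measure.fst_apply hB₁m, sampleLaw, Measure.fst_compProd]
    exact hB₁
  refine ⟨(Prod.fst ⁻¹' B₁ ∪ B₂)ᶜ, ((measurable_fst hB₁m).union hB₂m).compl, ?_, ?_⟩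
  · rw [prob_compl_eq_one_sub ((measurable_fst hB₁m).union hB₂m),
      ENNReal.ofReal_sub _ (by positivity), ENNReal.ofReal_one]
    refine tsub_le_tsub_left ((measure_union_le _ _).trans ((add_le_add hB₁f hB₂).trans ?_)) _
    rw [← ENNReal.ofReal_add hδ.le hδ.le, two_mul]
  intro s z hsz f hf g hg
  simp only [Set.mem_compl_iff, Set.mem_union, Set.mem_preimage, not_or] at hsz
  have : IsProbabilityMeasure (μ.map Prod.fst) :=
    Measure.isProbabilityMeasure_map measurable_fst.aemeasurable
  have hnR : (1 : ℝ) ≤ n := by exact_mod_cast hn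
  have hmR : (1 : ℝ) ≤ m := by exact_mod_cast hm
  have hkR : (1 : ℝ) ≤ k := by exact_mod_cast (by omega : 1 ≤ k)
  have hlm : 0 ≤ Real.log m := Real.log_nonneg hmR
  have hln : 0 ≤ Real.log n := Real.log_nonneg hnR
  have hlδ : 0 < Real.log (1 / δ) := Real.log_pos (by rw [lt_div_iff₀ hδ]; linarith)
  have hD0 : (densityRatioSup (μ.map Prod.fst) (ν fun i => (s i).1)) ≠ 0 :=
    densityRatioSup_ne_zero _ _
  set D := densityRatioSup (μ.map Prod.fst) (ν fun i => (s i).1) with hD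
  have hDE : (0 : EReal) < D := EReal.coe_ennreal_pos_iff_ne_zero.2 hD0
  have hRF0 := rademacherMulti_nonneg (by omega) hFne z
  have hRG0 := rademacherMulti_nonneg (by omega) hGne z
  have hRn0 := rademacherMulti_nonneg (by omega) hGne fun i => (s i).1
  set c₁ : ℝ := 3000002 * (1 + Real.log m) ^ 3 * ((k : ℝ) ^ (3 / 2 : ℝ) / γ) with hc₁
  set c₂ : ℝ := 3000002 * (1 + Real.log n) ^ 3 * (√(k : ℝ) / γ) with hc₂
  set w : ℝ := 3 * √(Real.log (1 / δ) / (2 * n)) with hw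
  set q : ℝ := √((n : ℝ) / m) with hq
  set a : ℝ := 1 / (m : ℝ) * ∑ i, rampDist γ (f (z i)) (g (z i)) with ha
  set e : ℝ := 1 / (n : ℝ) * ∑ i, rampLoss γ (g (s i).1) (s i).2 with he
  have hkpow : 0 < (k : ℝ) ^ (3 / 2 : ℝ) := Real.rpow_pos_of_pos (by linarith) _
  have hsk : 0 < √(k : ℝ) := Real.sqrt_pos.2 (by linarith)
  have hc₁0 : 0 < c₁ := by positivity
  have hc₂0 : 0 < c₂ := by positivity
  have hw0 : 0 < w := by positivity
  have hq0 : 0 < q := by positivity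
  have ha0 : 0 ≤ a := mul_nonneg (by positivity) (Finset.sum_nonneg fun i _ =>
    Finset.sum_nonneg fun j _ => abs_nonneg _)
  have he0 : 0 ≤ e := mul_nonneg (by positivity) (Finset.sum_nonneg fun i _ =>
    rampLoss_nonneg hγ _ _)
  have t₁ : (0 : EReal) ≤ D * (a : EReal) := EReal.mul_nonneg hDE.le (EReal.coe_nonneg.2 ha0)
  have t₂ : (0 : EReal) ≤ (e : EReal) := EReal.coe_nonneg.2 he0
  have t₃ : (0 : EReal) ≤ (c₁ : EReal) * D * (rademacherMulti F z + rademacherMulti G z) :=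
    EReal.mul_nonneg (EReal.mul_nonneg (EReal.coe_nonneg.2 hc₁0.le) hDE.le) (add_nonneg hRF0 hRG0)
  have t₄ : (0 : EReal) ≤ (c₂ : EReal) * rademacherMulti G (fun i => (s i).1) :=
    EReal.mul_nonneg (EReal.coe_nonneg.2 hc₂0.le) hRn0
  have t₅ : (0 : EReal) ≤ (w : EReal) * (1 + D * (q : EReal)) :=
    EReal.mul_nonneg (EReal.coe_nonneg.2 hw0.le)
      (add_nonneg zero_le_one (EReal.mul_nonneg hDE.le (EReal.coe_nonneg.2 hq0.le)))
  -- Every summand is nonnegative, so one infinite ingredient makes the right-hand side `⊤`.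
  -- Afterwards everything is real.
  by_cases hDtop : D = ⊤
  · refine le_top.trans (EReal.add_eq_top_of_right
      (add_nonneg (add_nonneg t₁ t₂) (add_nonneg t₃ t₄)) ?_).ge
    rw [hDtop, EReal.coe_ennreal_top, EReal.top_mul_of_pos (EReal.coe_pos.2 hq0),
      EReal.add_eq_top_of_right zero_le_one rfl, EReal.mul_top_of_pos (EReal.coe_pos.2 hw0)]
  have hDc : (0 : EReal) < (c₁ : EReal) * D := EReal.mul_pos (EReal.coe_pos.2 hc₁0) hDE
  by_cases hRF : rademacherMulti F z = ⊤
  · refine le_top.trans (EReal.add_eq_top_of_left (EReal.add_eq_top_of_right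
      (add_nonneg t₁ t₂) (EReal.add_eq_top_of_left ?_ t₄)) t₅).ge
    rw [EReal.add_eq_top_of_left hRF hRG0, EReal.mul_top_of_pos hDc]
  by_cases hRG : rademacherMulti G z = ⊤
  · refine le_top.trans (EReal.add_eq_top_of_left (EReal.add_eq_top_of_right
      (add_nonneg t₁ t₂) (EReal.add_eq_top_of_left ?_ t₄)) t₅).ge
    rw [EReal.add_eq_top_of_right hRF0 hRG, EReal.mul_top_of_pos hDc]
  by_cases hRn : rademacherMulti G (fun i => (s i).1) = ⊤
  · refine le_top.trans (EReal.add_eq_top_of_left (EReal.add_eq_top_of_right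
      (add_nonneg t₁ t₂) (EReal.add_eq_top_of_right t₃ ?_)) t₅).ge
    rw [hRn, EReal.mul_top_of_pos (EReal.coe_pos.2 hc₂0)]
  obtain ⟨rF, hrF⟩ := EReal.exists_coe_of_nonneg hRF0 hRF
  obtain ⟨rG, hrG⟩ := EReal.exists_coe_of_nonneg hRG0 hRG
  obtain ⟨rn, hrn⟩ := EReal.exists_coe_of_nonneg hRn0 hRn
  have hrF0 : 0 ≤ rF := by rw [hrF] at hRF0; exact EReal.coe_nonneg.1 hRF0
  have hrG0 : 0 ≤ rG := by rw [hrG] at hRG0; exact EReal.coe_nonneg.1 hRG0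
  have b₁ := hB₁' s hsz.1 rn hrn g hg
  have b₂ := hB₂' s z hsz.2 rF rG hrF hrG f hf g hg
  have b₃ := measureReal_misclassifies_le hk μ hγ (hFm f hf) (hGm g hg)
  have b₄ := integral_le_densityRatioSup_mul (μ.map Prod.fst) (ν fun i => (s i).1) hDtop
    (measurable_rampSupDist hγ hk (hFm f hf) (hGm g hg)) (fun x => rampSupDist_nonneg hk γ _ _)
    (fun x => rampSupDist_le_one hγ hk _ _)
  rw [← hD] at b₄
  have hreal : μ.real {q | Misclassifies (f q.1) q.2} ≤ D.toReal * a + e +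
      (c₁ * D.toReal * (rF + rG) + c₂ * rn) + w * (1 + D.toReal * q) := by
    have d0 : 0 ≤ D.toReal := ENNReal.toReal_nonneg
    have i₁ : 1 / (m : ℝ) * ∑ i, rampSupDist γ (f (z i)) (g (z i)) ≤ a := by
      rw [ha]
      gcongr with i
      exact rampSupDist_le_rampDist hk γ _ _
    have i₂ : 4 * k / γ ≤ c₁ := by
      have hkp : (k : ℝ) ≤ (k : ℝ) ^ (3 / 2 : ℝ) := by
        conv_lhs => rw [← Real.rpow_one (k : ℝ)]
        exact Real.rpow_le_rpow_of_exponent_le hkR (by norm_num)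
      have hone : 1 ≤ (1 + Real.log m) ^ 3 := one_le_pow₀ (by linarith)
      calc 4 * k / γ = 4 * 1 * (k / γ) := by ring
        _ ≤ c₁ := by
          rw [hc₁]
          gcongr
          norm_num
    -- The deviation over the `m` augmented points, rescaled to the form of the last term of the
    -- bound.
    have i₃ : 3 * √(Real.log (1 / δ) / (2 * m)) = w * q := by
      rw [hw, hq, mul_assoc, ← Real.sqrt_mul (by positivity)]
      congr 2
      field_simp
    have i₄ : ∫ x, rampSupDist γ (f x) (g x) ∂(ν fun i => (s i).1) ≤
        a + c₁ * (rF + rG) + w * q := by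
      refine b₂.trans ?_
      rw [i₃]
      gcongr
    have i₅ := mul_le_mul_of_nonneg_left i₄ d0
    have i₆ : D.toReal * (a + c₁ * (rF + rG) + w * q) + w =
      D.toReal * a + c₁ * D.toReal * (rF + rG) + w * (1 + D.toReal * q) := by ring
    linarith
  rw [hrF, hrG, hrn, ← EReal.coe_ennreal_toReal hDtop]
  exact_mod_cast hreal
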